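/- Let $F_n$ be the free group on $a_1,\dots,a_n$, let $H\le F_n$ be a finitely generated subgroup with a free basis $h_1,\dots,h_r$, let $g\in F_n$, and let $\langle x\rangle$ be infinite cyclic. Let $\mathfrak I_g$ be the kernel of the homomorphism $H*\langle x\rangle\to F_n$ that is the inclusion on $H$ and sends $x$ to $g$. The degree of an element of $H*\langle x\rangle$ is the number of occurrences of $x$ and $x^{-1}$ in its cyclic reduction (as a word in $h_1^{\pm1},\dots,h_r^{\pm1},x^{\pm1}$). For an integer $d\ge 0$ let $\mathfrak J_{g,d}$ be the set of elements of $\mathfrak I_g$ of degree $d$. For real $M\ge 0$ let $\rho_{g,d}(M)$ be the number of cyclically reduced words of length at most $M$ in the letters $h_1^{\pm1},\dots,h_r^{\pm1},x^{\pm1}$ that represent an element of $\mathfrak J_{g,d}$. A function $\rho$ has exponential growth if there are $\alpha,\beta>0$ with $e^{\alpha M}\le\rho(M)\le e^{\beta M}$ for all sufficiently large $M$, and polynomial growth of degree $k$ (an integer $k\ge 0$) if there are $\alpha,\beta>0$ with $\alpha M^k\le\rho(M)\le\beta M^k$ for all sufficiently large $M$. **Theorem.** (1) For every $d\ge 0$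 such that $\mathfrak J_{g,d}\neq\emptyset$, exactly one of the following holds: $\rho_{g,d}$ has exponential growth; $\rho_{g,d}$ has polynomial growth of degree $k$ for some integer $k\ge 0$. (2) There is an algorithm that, given $n$, $r$, $d$ and the reduced words in $a_1^{\pm1},\dots,a_n^{\pm1}$ that represent $h_1,\dots,h_r,g$, decides whether $\mathfrak J_{g,d}$ is empty, or $\rho_{g,d}$ has exponential growth, or $\rho_{g,d}$ has polynomial growth, and in the last case computes the degree $k$. It runs in polynomial time: there are constants $C,c$ such that a single random access machine (whose registers hold natural numbers and whose basic operations, including addition and multiplication, take one unit of time each) does this in at most $C\,(n+r+L+d+1)^c$ steps for all such inputs, where $L$ is the maximum of the lengths of the reduced words representing $h_1,\dots,h_r,g$. -/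

import Mathlib

open Filter

noncomputable section

/-! ### Growth of functions and of languages -/

/-- `ρ` has exponential growth: `exp (α M) ≤ ρ M ≤ exp (β M)` for some `α, β > 0` and all
sufficiently large real `M`. -/
def HasExponentialGrowth (ρ : ℝ → ℝ) : Prop :=
  ∃ α β : ℝ, 0 < α ∧ 0 < β ∧
    ∀ᶠ M in atTop, Real.exp (α * M) ≤ ρ M ∧ ρ M ≤ Real.exp (β * M)

/-- `ρ` has polynomial growth of degree `k`: `α M ^ k ≤ ρ M ≤ β M ^ k` for some `α, β > 0` and all
sufficiently large real `M`. -/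
def HasPolynomialGrowth (ρ : ℝ → ℝ) (k : ℕ) : Prop :=
  ∃ α β : ℝ, 0 < α ∧ 0 < β ∧
    ∀ᶠ M in atTop, α * M ^ k ≤ ρ M ∧ ρ M ≤ β * M ^ k

/-- The growth function of a language: the number of its words of length at most `M`.
(It is used for finite alphabets only, where the set that is counted is finite.) -/
def languageGrowth {A : Type*} (L : Language A) (M : ℝ) : ℝ :=
  ((({w : List A | w ∈ L ∧ (w.length : ℝ) ≤ M}).ncard : ℕ) : ℝ)

/-! ### Equations over a subgroup of a free group

`F n` is the free group on `Fin n`, `H` is a subgroup with a free basis `b` indexed by `Fin r`, and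
the equations are the elements of the free product `H ∗ ⟨x⟩`, with `⟨x⟩` infinite cyclic. -/

namespace FreeEq

open Monoid.Coprod

variable {n r : ℕ} {H : Subgroup (FreeGroup (Fin n))}

/-- The group `H ∗ ⟨x⟩` in which equations with coefficients in `H` live. -/
abbrev EqGroup (H : Subgroup (FreeGroup (Fin n))) : Type :=
  Monoid.Coprod H (Multiplicative ℤ)

/-- The variable `x`, i.e. the generator of the second free factor. -/
def x (H : Subgroup (FreeGroup (Fin n))) : EqGroup H := inr (Multiplicative.ofAdd 1)

/-- The evaluation homomorphism `H ∗ ⟨x⟩ → F n` that is the inclusion on `H` and sends `x`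
to `g`. -/
def evalHom (H : Subgroup (FreeGroup (Fin n))) (g : FreeGroup (Fin n)) :
    EqGroup H →* FreeGroup (Fin n) :=
  lift H.subtype (zpowersHom (FreeGroup (Fin n)) g)

/-- The ideal of `g`: all the equations `w` with `w(g) = 1`. -/
def ideal (H : Subgroup (FreeGroup (Fin n))) (g : FreeGroup (Fin n)) : Subgroup (EqGroup H) :=
  (evalHom H g).ker

/-- The generators of `H ∗ ⟨x⟩`: `some i` stands for the basis element `h i` of `H` and `none` for
the variable `x`. The alphabet of the words is `Gen r × Bool`, where `(s, true)` is the letter `s`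
and `(s, false)` is its formal inverse, as in `FreeGroup`. -/
abbrev Gen (r : ℕ) : Type := Option (Fin r)

/-- The isomorphism from the free group on `h 1, …, h r, x` to `H ∗ ⟨x⟩` given by the basis. -/
def genEquiv (b : FreeGroupBasis (Fin r) H) : FreeGroup (Gen r) ≃* EqGroup H :=
  MonoidHom.toMulEquiv
    (FreeGroup.lift fun s : Gen r => s.elim (x H) fun i => inl (b i))
    (lift ((FreeGroup.map some).comp b.repr.toMonoidHom)
      (zpowersHom (FreeGroup (Gen r)) (FreeGroup.of none)))
    (by
      ext s
      cases s with
      | none => simp [x]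
      | some i => simp)
    (by
      refine hom_ext ?_ ?_
      · have hb : ∀ u : FreeGroup (Fin r),
            FreeGroup.lift (fun s : Gen r => s.elim (x H) fun i => (inl (b i) : EqGroup H))
              (FreeGroup.map some u) = inl (b.repr.symm u) := by
          intro u
          have h : (FreeGroup.lift fun s : Gen r =>
                s.elim (x H) fun i => (inl (b i) : EqGroup H)).comp (FreeGroup.map some) =
              (inl : H →* EqGroup H).comp b.repr.symm.toMonoidHom := by
            ext i
            simp
            rfl
          exact DFunLike.congr_fun h u
        refine MonoidHom.ext fun a => ?_
        simp [hb]
      · ext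
        simp [x])

/-- The element of `H ∗ ⟨x⟩` represented by a word. -/
def wordElement (b : FreeGroupBasis (Fin r) H) (w : List (Gen r × Bool)) : EqGroup H :=
  genEquiv b (FreeGroup.mk w)

/-- The number of occurrences of `x` and of its inverse in a word. -/
def xCount (w : List (Gen r × Bool)) : ℕ := w.countP fun s => s.1.isNone

/-- The degree of an equation: the number of occurrences of `x` and of its inverse in its cyclic
reduction. -/
def degree (b : FreeGroupBasis (Fin r) H) (w : EqGroup H) : ℕ :=
  xCount (FreeGroup.reduceCyclically ((genEquiv b).symm w).toWord)

/-- The set of all the equations of degree `d` in the ideal of `g`. -/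
def idealDeg (b : FreeGroupBasis (Fin r) H) (g : FreeGroup (Fin n)) (d : ℕ) : Set (EqGroup H) :=
  {w | w ∈ ideal H g ∧ degree b w = d}

/-- The language of all cyclically reduced words that represent an element of `S`. -/
def cyclicLanguage (b : FreeGroupBasis (Fin r) H) (S : Set (EqGroup H)) :
    Language (Gen r × Bool) :=
  {w | FreeGroup.IsCyclicallyReduced w ∧ wordElement b w ∈ S}

/-- The number of cyclically reduced words of length at most `M` that represent an equation of
degree `d` in the ideal of `g`. -/
def rho (b : FreeGroupBasis (Fin r) H) (g : FreeGroup (Fin n)) (d : ℕ) : ℝ → ℝ :=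
  languageGrowth (cyclicLanguage b (idealDeg b g d))

/-- The maximum of the lengths of the reduced words that represent `h 1, …, h r, g`. -/
def maxLength (b : FreeGroupBasis (Fin r) H) (g : FreeGroup (Fin n)) : ℕ :=
  max (Finset.univ.sup fun i : Fin r => (b i : FreeGroup (Fin n)).norm) g.norm

end FreeEq

/-! ### Random access machines

Registers `0, 1, 2, …` hold natural numbers. The input is a finite sequence of natural numbers in a
read-only input array. Every instruction takes one unit of time. -/

namespace RAM

/-- The instructions; `R i` denotes the content of register `i`, and `I i` that of cell `i` of the
input array. -/
inductive Instr : Type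
  /-- `R i := c` -/
  | const (i c : ℕ)
  /-- `R i := R j + R k` -/
  | add (i j k : ℕ)
  /-- `R i := R j - R k`, truncated at `0` -/
  | sub (i j k : ℕ)
  /-- `R i := R j * R k` -/
  | mul (i j k : ℕ)
  /-- `R i := R (R j)` -/
  | load (i j : ℕ)
  /-- `R (R i) := R j` -/
  | store (i j : ℕ)
  /-- `R i := I (R j)`, which is `0` beyond the end of the input -/
  | read (i j : ℕ)
  /-- Continue at instruction `l`. -/
  | jump (l : ℕ)
  /-- Continue at instruction `l` if `R i = 0`, and at the next instruction otherwise. -/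
  | jumpZero (i l : ℕ)

/-- A program is a finite list of instructions, numbered from `0`. -/
abbrev Program : Type := List Instr

/-- A configuration: the number of the next instruction and the contents of the registers. -/
structure Config : Type where
  pc : ℕ
  reg : ℕ → ℕ

/-- The initial configuration. -/
def Config.init : Config := ⟨0, fun _ => 0⟩

/-- Write `v` into register `i` and go on to the next instruction. -/
def Config.write (s : Config) (i v : ℕ) : Config := ⟨s.pc + 1, Function.update s.reg i v⟩

/-- The effect of one instruction, with input array `I`. -/
def Instr.exec (I : List ℕ) (s : Config) : Instr → Config
  | .const i c => s.write i c
  | .add i j k => s.write i (s.reg j + s.reg k)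
  | .sub i j k => s.write i (s.reg j - s.reg k)
  | .mul i j k => s.write i (s.reg j * s.reg k)
  | .load i j => s.write i (s.reg (s.reg j))
  | .store i j => s.write (s.reg i) (s.reg j)
  | .read i j => s.write i (I.getD (s.reg j) 0)
  | .jump l => ⟨l, s.reg⟩
  | .jumpZero i l => ⟨if s.reg i = 0 then l else s.pc + 1, s.reg⟩

/-- A machine has halted when there is no instruction left at its program counter. -/
def Halted (P : Program) (s : Config) : Prop := P.length ≤ s.pc

/-- One step of computation; a halted machine does not change any more. -/
def step (P : Program) (I : List ℕ) (s : Config) : Config :=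
  match P[s.pc]? with
  | some instr => instr.exec I s
  | none => s

/-- On input `I`, the program `P` halts after at most `t` steps with `out` in register `0`. -/
def OutputsWithin (P : Program) (I : List ℕ) (t out : ℕ) : Prop :=
  Halted P ((step P I)^[t] Config.init) ∧ ((step P I)^[t] Config.init).reg 0 = out

end RAM

/-! ### The algorithmic problem -/

namespace FreeEq

variable {n r : ℕ} {H : Subgroup (FreeGroup (Fin n))}

/-- A word in the generators of `F n` as a sequence of numbers: its length, and then for every letter
the index of the generator and `1` for the generator itself, `0` for its inverse. -/
def encodeWord (w : List (Fin n × Bool)) : List ℕ :=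
  w.length :: w.flatMap fun s => [(s.1 : ℕ), if s.2 then 1 else 0]

/-- The input of the algorithm: `n`, `r`, `d`, and the reduced words that represent
`h 1, …, h r, g`. -/
def encodeInput (b : FreeGroupBasis (Fin r) H) (g : FreeGroup (Fin n)) (d : ℕ) : List ℕ :=
  [n, r, d] ++ ((List.ofFn fun i : Fin r => encodeWord (b i : FreeGroup (Fin n)).toWord).flatten ++
    encodeWord g.toWord)

/-- The possible answers of the algorithm. -/
inductive Answer : Type
  /-- there is no equation of degree `d` at all -/
  | noEquation
  /-- exponential growth -/
  | exponential
  /-- polynomial growth of degree `k` -/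
  | polynomial (k : ℕ)

/-- The number by which an answer is output. -/
def Answer.code : Answer → ℕ
  | .noEquation => 0
  | .exponential => 1
  | .polynomial k => k + 2

/-- What it means that an answer is correct. -/
def Answer.IsCorrect (b : FreeGroupBasis (Fin r) H) (g : FreeGroup (Fin n)) (d : ℕ) :
    Answer → Prop
  | .noEquation => idealDeg b g d = ∅
  | .exponential => HasExponentialGrowth (rho b g d)
  | .polynomial k => HasPolynomialGrowth (rho b g d) k

end FreeEq

end

/-!
Why the theorem is true. In degree `0` only the trivial equation exists, because the `h i` are a basis.
In degree `d > 0`, a cyclically reduced word in the letters `h i`, `x` and their inverses is a closed path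
in a finite automaton, the rose of the reduced words of the `h i` and of `g` (`rose`); the word
evaluates to `1` at `g` if and only if the path spells the trivial element of the free group, and its degree
is the number of passages through the petals of `x`. So `rho` counts, up to linear changes of
the length, paths of degree `d` that spell `1` (`count_le_wordCount`, `wordCount_le_sum`).

In the Cayley tree of the free group, a path that begins with a letter and spells `1` has to come
back through the edge of this letter. Cutting it at its first return yields a context-free grammar with
unique derivations, whose nonterminals `(b, p, q)` stand for the paths from `p` to `q` that spell `1`
and avoid the neighbour `b` of the origin (`Auto.grammar`, `Auto.counts`). This grammar is graded by
the degree, and in degree `0` every nonterminal derives at most one word, again because the `h i` are a basis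
(`Auto.Rigid`). Therefore a rule whose part of degree `0` is fixed behaves like an edge of a finite
graph on the nonterminals.

The growth is read off from the cycles of this graph (`Grammar.A`). A nonterminal on two different
cycles makes the growth exponential. Otherwise every derivation tree of degree `k` has a bounded number of
branchings, every cycle that it passes through contributes one free parameter, and the growth is
polynomial, its degree being the largest number of cycles on a derivation. The lower bounds
(`Counts.growsExp`, `Counts.growsPoly`) come from the superadditivity of unique derivations along
a cycle, the upper bound (`Counts.boundedPoly`) from an induction on the degree and on the number
of nonterminals that can be reached. The exponent of a nonexponential nonterminal is bounded by `2 d (NV + 1)`, so that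
cutting the exponents off at a larger number `V` loses nothing and detects exponential growth.

All the relations involved are least fixed points of monotone rules on sets of polynomial size. The
machine computes them as tables by plain iteration (`HCmp.lfp`). Its programs are built from a Hoare
logic with a time bound (`Sim`), in which functions (`Cmp`), predicates (`CmpP`) and transformations of
the memory (`HCmp`) that are computable in polynomial time are closed under arithmetic, bounded
quantification, bounded sums and loops, all of which run for the same number of rounds.
-/

/-! ### Hoare triples with running times for random access machines -/

namespace RAM

/-- The instructions `l` occupy the positions `b, b + 1, …` of the program `P`. -/
def Placed (P : Program) (b : ℕ) (l : List Instr) : Prop :=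
  ∀ i < l.length, P[b + i]? = l[i]?

theorem placed_append {P : Program} {b : ℕ} {l m : List Instr} :
    Placed P b (l ++ m) ↔ Placed P b l ∧ Placed P (b + l.length) m := by
  constructor
  · intro h
    refine ⟨fun i hi => ?_, fun i hi => ?_⟩
    · rw [h i (by simp; omega), List.getElem?_append_left hi]
    · rw [add_assoc, h (l.length + i) (by simp; omega), List.getElem?_append_right (by omega)]
      congr 1; omega
  · rintro ⟨h1, h2⟩ i hi
    by_cases hl : i < l.length
    · rw [h1 i hl, List.getElem?_append_left hl]
    · rw [List.getElem?_append_right (by omega), ← h2 (i - l.length) (by simp at hi; omega)]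
      congr 1; omega

theorem step_of_getElem? {P : Program} {I : List ℕ} {b : ℕ} {reg : ℕ → ℕ} {ins : Instr}
    (h : P[b]? = some ins) : step P I ⟨b, reg⟩ = ins.exec I ⟨b, reg⟩ := by
  simp [step, h]

/-- A Hoare triple for position-independent code, with an auxiliary logical variable `x`: there is a
piece of code that, started with registers satisfying `Pre x`, runs through to its end within
`C * (bd x + 1) ^ D` steps and leaves registers satisfying `Post x`. The code and the constants
`C`, `D` do not depend on `x`. -/
def Sim {X : Type} (inp : X → List ℕ) (bd : X → ℕ) (Pre Post : X → (ℕ → ℕ) → Prop) : Prop :=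
  ∃ (code : ℕ → List Instr) (len C D : ℕ), (∀ b, (code b).length = len) ∧
    ∀ x reg, Pre x reg → ∃ reg' t, t ≤ C * (bd x + 1) ^ D ∧ Post x reg' ∧
      ∀ P b, Placed P b (code b) → (step P (inp x))^[t] ⟨b, reg⟩ = ⟨b + len, reg'⟩

variable {X Y : Type} {inp : X → List ℕ} {bd : X → ℕ} {Pre Mid Post : X → (ℕ → ℕ) → Prop}

theorem Sim.instr (ins : Instr)
    (h : ∀ x reg, Pre x reg →
      ∃ reg', (∀ b, ins.exec (inp x) ⟨b, reg⟩ = ⟨b + 1, reg'⟩) ∧ Post x reg') :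
    Sim inp bd Pre Post := by
  refine ⟨fun _ => [ins], 1, 1, 0, fun _ => rfl, fun x reg hp => ?_⟩
  obtain ⟨reg', h1, h2⟩ := h x reg hp
  refine ⟨reg', 1, by simp, h2, fun P b hP => ?_⟩
  have := hP 0 (by simp)
  simp only [add_zero] at this
  rw [Function.iterate_one, step_of_getElem? (by rw [this]; rfl), h1]

theorem Sim.seq (h1 : Sim inp bd Pre Mid) (h2 : Sim inp bd Mid Post) : Sim inp bd Pre Post := by
  obtain ⟨c1, l1, C1, D1, hl1, h1⟩ := h1
  obtain ⟨c2, l2, C2, D2, hl2, h2⟩ := h2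
  refine ⟨fun b => c1 b ++ c2 (b + l1), l1 + l2, C1 + C2, D1 + D2, by simp [hl1, hl2], ?_⟩
  intro x reg hp
  obtain ⟨r1, t1, ht1, hm, hr1⟩ := h1 x reg hp
  obtain ⟨r2, t2, ht2, hq, hr2⟩ := h2 x r1 hm
  refine ⟨r2, t2 + t1, ?_, hq, fun P b hP => ?_⟩
  · have e1 : (bd x + 1) ^ D1 ≤ (bd x + 1) ^ (D1 + D2) :=
      Nat.pow_le_pow_right (by omega) (by omega)
    have e2 : (bd x + 1) ^ D2 ≤ (bd x + 1) ^ (D1 + D2) :=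
      Nat.pow_le_pow_right (by omega) (by omega)
    have := Nat.mul_le_mul_left C1 e1
    have := Nat.mul_le_mul_left C2 e2
    rw [add_mul]; omega
  · rw [placed_append, hl1] at hP
    rw [Function.iterate_add_apply, hr1 P b hP.1, hr2 P _ hP.2, add_assoc]

theorem Sim.conseq {Pre' Post' : X → (ℕ → ℕ) → Prop} (h : Sim inp bd Pre Post)
    (h1 : ∀ x reg, Pre' x reg → Pre x reg) (h2 : ∀ x reg, Post x reg → Post' x reg) :
    Sim inp bd Pre' Post' := by
  obtain ⟨c, l, C, D, hl, h⟩ := h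
  refine ⟨c, l, C, D, hl, fun x reg hp => ?_⟩
  obtain ⟨r, t, ht, hq, hr⟩ := h x reg (h1 x reg hp)
  exact ⟨r, t, ht, h2 _ _ hq, hr⟩

/-- The loop `for i < bd: body`, with loop counter in register `c` and scratch register `u`. Register
`2` holds the bound. -/
theorem Sim.loop {c u : ℕ} (hcu : c ≠ u) (hc : c ≠ 2) (hu : u ≠ 2)
    {Inv : X → ℕ → (ℕ → ℕ) → Prop}
    (hIc : ∀ x i reg v, Inv x i reg → Inv x i (Function.update reg c v))
    (hIu : ∀ x i reg v, Inv x i reg → Inv x i (Function.update reg u v))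
    (hbody : Sim (fun y : X × ℕ => inp y.1) (fun y => bd y.1)
      (fun y reg => Inv y.1 y.2 reg ∧ reg c = y.2 ∧ reg 2 = bd y.1)
      (fun y reg => Inv y.1 (y.2 + 1) reg ∧ reg c = y.2 ∧ reg 2 = bd y.1)) :
    Sim inp bd (fun x reg => Inv x 0 reg ∧ reg 2 = bd x)
      (fun x reg => Inv x (bd x) reg ∧ reg 2 = bd x) := by
  obtain ⟨code, len, C, D, hlen, hb⟩ := hbody
  let code' : ℕ → List Instr := fun b =>
    [.const c 0, .sub u 2 c, .jumpZero u (b + (len + 6))] ++ (code (b + 3) ++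
      [.const u 1, .add c c u, .jump (b + 1)])
  have key : ∀ k x i reg, i + k = bd x → Inv x i reg → reg c = i → reg 2 = bd x →
      ∃ reg' t, t ≤ k * (C * (bd x + 1) ^ D + 5) + 2 ∧ Inv x (bd x) reg' ∧ reg' 2 = bd x ∧
      ∀ P b, Placed P b (code' b) →
        (step P (inp x))^[t] ⟨b + 1, reg⟩ = ⟨b + (len + 6), reg'⟩ := by
    intro k
    induction k with
    | zero =>
      intro x i reg hi hI hrc hr2
      have hi' : i = bd x := by omega
      refine ⟨Function.update reg u 0, 2, by simp, hi' ▸ hIu _ _ _ _ hI,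
        by rw [Function.update_of_ne hu.symm, hr2], fun P b hP => ?_⟩
      have p1 := hP 1 (by simp [code'])
      have p2 := hP 2 (by simp [code'])
      simp only [code', List.cons_append, List.getElem?_cons_succ, List.getElem?_cons_zero] at p1 p2
      rw [Function.iterate_succ_apply, Function.iterate_one, step_of_getElem? p1]
      simp only [Instr.exec, Config.write, hrc, hr2, hi', Nat.sub_self]
      rw [step_of_getElem? p2]
      simp [Instr.exec]
    | succ k ih =>
      intro x i reg hi hI hrc hr2
      obtain ⟨r1, t1, ht1, ⟨hI1, hc1, h21⟩, hr1⟩ := hb (x, i) (Function.update reg u (bd x - i))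
        ⟨hIu _ _ _ _ hI, by rw [Function.update_of_ne hcu, hrc],
          by rw [Function.update_of_ne hu.symm, hr2]⟩
      simp only at hI1 hc1 h21 ht1
      obtain ⟨r2, t2, ht2, hI2, h22, hr2'⟩ := ih x (i + 1)
        (Function.update (Function.update r1 u 1) c (i + 1)) (by omega)
        (hIc _ _ _ _ (hIu _ _ _ _ hI1)) (by simp)
        (by rw [Function.update_of_ne hc.symm, Function.update_of_ne hu.symm, h21])
      refine ⟨r2, t2 + (3 + (t1 + 2)), ?_, hI2, h22, fun P b hP => ?_⟩
      · rw [add_mul]; omega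
      · have hP0 := hP
        have p1 := hP 1 (by simp [code'])
        have p2 := hP 2 (by simp [code'])
        simp only [code', List.cons_append, List.getElem?_cons_succ,
          List.getElem?_cons_zero] at p1 p2
        simp only [code'] at hP
        rw [placed_append, placed_append] at hP
        obtain ⟨-, hP2, hP3⟩ := hP
        have q1 := hP3 0 (by simp)
        have q2 := hP3 1 (by simp)
        have q3 := hP3 2 (by simp)
        simp only [List.length_cons, List.length_nil, zero_add, hlen, add_zero,
          List.getElem?_cons_succ, List.getElem?_cons_zero] at hP2 q1 q2 q3
        have s1 : (step P (inp x))^[2] ⟨b + 1, reg⟩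
            = ⟨b + 3, Function.update reg u (bd x - i)⟩ := by
          rw [Function.iterate_succ_apply, Function.iterate_one, step_of_getElem? p1]
          simp only [Instr.exec, Config.write, hrc, hr2]
          rw [step_of_getElem? p2]
          have : bd x - i ≠ 0 := by omega
          simp [Instr.exec, this]
        have s3 : (step P (inp x))^[3] ⟨b + 3 + len, r1⟩
            = ⟨b + 1, Function.update (Function.update r1 u 1) c (i + 1)⟩ := by
          have q1' : P[b + 3 + len]? = some (.const u 1) := q1
          have q2' : P[b + 3 + len + 1]? = some (.add c c u) := q2
          have q3' : P[b + 3 + len + 1 + 1]? = some (.jump (b + 1)) := q3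
          rw [Function.iterate_succ_apply, Function.iterate_succ_apply, Function.iterate_one,
            step_of_getElem? q1']
          simp only [Instr.exec, Config.write]
          rw [step_of_getElem? q2']
          simp only [Instr.exec, Config.write]
          rw [step_of_getElem? q3']
          simp [Instr.exec, Function.update_of_ne hcu, hc1]
        rw [Function.iterate_add_apply, Function.iterate_add_apply _ 3, Function.iterate_add_apply _ t1,
          s1, hr1 P _ hP2, s3, hr2' P b hP0]
  refine ⟨code', len + 6, C + 8, D + 1, fun b => by simp [code', hlen],
    fun x reg ⟨hI, h2⟩ => ?_⟩
  obtain ⟨r, t, ht, hI', h2', hr⟩ := key (bd x) x 0 (Function.update reg c 0) (by simp)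
    (hIc _ _ _ _ hI) (by simp) (by rw [Function.update_of_ne hc.symm, h2])
  refine ⟨r, t + 1, ?_, ⟨hI', h2'⟩, fun P b hP => ?_⟩
  · have e1 : 1 ≤ (bd x + 1) ^ D := Nat.one_le_pow _ _ (by omega)
    calc t + 1 ≤ bd x * (C * (bd x + 1) ^ D + 5) + 3 := by omega
      _ ≤ (bd x + 1) * (C * (bd x + 1) ^ D + 5) + 3 * ((bd x + 1) * (bd x + 1) ^ D) := by
        have : 1 ≤ (bd x + 1) * (bd x + 1) ^ D := Nat.one_le_iff_ne_zero.mpr (by positivity)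
        have := Nat.mul_le_mul_right (C * (bd x + 1) ^ D + 5) (Nat.le_succ (bd x))
        simp only [Nat.succ_eq_add_one] at this
        omega
      _ ≤ (bd x + 1) * (C * (bd x + 1) ^ D + 5 * (bd x + 1) ^ D)
            + 3 * ((bd x + 1) * (bd x + 1) ^ D) := by gcongr; omega
      _ = (C + 8) * (bd x + 1) ^ (D + 1) := by ring
  · have p0 := hP 0 (by simp [code'])
    simp only [code', List.cons_append, List.getElem?_cons_zero, add_zero] at p0
    rw [Function.iterate_succ_apply, step_of_getElem? p0]
    simp only [Instr.exec, Config.write]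
    exact hr P b hP

/-! ### Computable expressions -/

/-- A context for expressions that depend on a logical variable `x : X`: the input array, the contents
of the heap, the bound of all loops, and the values of the local variables. -/
structure Ctx (X : Type) where
  inp : X → List ℕ
  hp : X → ℕ → ℕ
  bd : X → ℕ
  vs : List (X → ℕ)

/-- The registers are as the context prescribes. Register `0` is left for the output, register `2`
holds the loop bound, the further even registers hold the local variables, and the odd ones are
the heap. -/
def St (K : Ctx X) (x : X) (reg : ℕ → ℕ) : Prop :=
  reg 2 = K.bd x ∧ (∀ i f, K.vs[i]? = some f → reg (2 * i + 4) = f x) ∧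
    ∀ j, reg (2 * j + 1) = K.hp x j

/-- `K'` is an extension of `K`, along a map `g` of the logical variables. -/
structure Ext (K : Ctx X) (K' : Ctx Y) (g : Y → X) : Prop where
  inp : ∀ y, K'.inp y = K.inp (g y)
  hp : ∀ y, K'.hp y = K.hp (g y)
  bd : ∀ y, K'.bd y = K.bd (g y)
  vs : ∀ f ∈ K.vs, f ∘ g ∈ K'.vs

/-- Add a local variable. -/
def Ctx.push (K : Ctx X) (f : X → ℕ) : Ctx X := { K with vs := K.vs ++ [f] }

/-- The context of the body of a loop over `i`, where the logical variable is `(x, i)`. -/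
def Ctx.bind (K : Ctx X) (H : X × ℕ → ℕ → ℕ) : Ctx (X × ℕ) where
  inp y := K.inp y.1
  hp := H
  bd y := K.bd y.1
  vs := K.vs.map (fun f y => f y.1) ++ [Prod.snd]

/-- The context of the body of a loop that does not change the heap. -/
abbrev Ctx.inner (K : Ctx X) : Ctx (X × ℕ) := K.bind fun y => K.hp y.1

/-- There is code that computes `f` in polynomial time in exactly the context `K`, and stores the
value behind the local variables. -/
def CmpIn (K : Ctx X) (f : X → ℕ) : Prop :=
  Sim K.inp K.bd (St K) (St (K.push f))

/-- The function `f` is computable in polynomial time in all extensions of the context `K`. -/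
def Cmp (K : Ctx X) (f : X → ℕ) : Prop :=
  ∀ (Y : Type) (K' : Ctx Y) (g : Y → X), Ext K K' g → CmpIn K' (fun y => f (g y))

theorem Ext.refl (K : Ctx X) : Ext K K id :=
  ⟨fun _ => rfl, fun _ => rfl, fun _ => rfl, fun _ h => h⟩

theorem Ext.trans {Z : Type} {K : Ctx X} {K' : Ctx Y} {K'' : Ctx Z} {g : Y → X} {h : Z → Y}
    (h1 : Ext K K' g) (h2 : Ext K' K'' h) : Ext K K'' (g ∘ h) :=
  ⟨fun _ => (h2.inp _).trans (h1.inp _), fun _ => (h2.hp _).trans (h1.hp _),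
    fun _ => (h2.bd _).trans (h1.bd _), fun f hf => h2.vs _ (h1.vs f hf)⟩

theorem Ext.push {K : Ctx X} {K' : Ctx Y} {g : Y → X} (h : Ext K K' g) (f : Y → ℕ) :
    Ext K (K'.push f) g :=
  ⟨h.inp, h.hp, h.bd, fun k hk => List.mem_append_left _ (h.vs k hk)⟩

theorem Ext.inner (K : Ctx X) : Ext K K.inner Prod.fst :=
  ⟨fun _ => rfl, fun _ => rfl, fun _ => rfl, fun f hf =>
    List.mem_append_left _ (List.mem_map.mpr ⟨f, hf, rfl⟩)⟩

variable {K : Ctx X} {a b f : X → ℕ}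

theorem Cmp.cmpIn (h : Cmp K f) : CmpIn K f := h X K id (Ext.refl K)

theorem Cmp.ext {K' : Ctx Y} {g : Y → X} (h : Cmp K f) (e : Ext K K' g) :
    Cmp K' fun y => f (g y) := fun Z K'' k e' => h Z K'' (g ∘ k) (e.trans e')

theorem Cmp.wk (h : Cmp K f) : Cmp K.inner fun y => f y.1 := h.ext (Ext.inner K)

theorem St.push {K : Ctx X} {x : X} {reg : ℕ → ℕ} (h : St K x reg)
    (hf : reg (2 * K.vs.length + 4) = f x) : St (K.push f) x reg := by
  refine ⟨h.1, fun i k hk => ?_, h.2.2⟩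
  rcases lt_or_ge i K.vs.length with h' | h'
  · exact h.2.1 i k (by rwa [Ctx.push, List.getElem?_append_left h'] at hk)
  · rw [Ctx.push, List.getElem?_append_right h', List.getElem?_singleton] at hk
    split_ifs at hk with h0
    cases hk
    rw [show i = K.vs.length by omega, hf]

theorem St.pop {K : Ctx X} {x : X} {reg : ℕ → ℕ} (h : St (K.push f) x reg) :
    St K x reg ∧ reg (2 * K.vs.length + 4) = f x := by
  refine ⟨⟨h.1, fun i k hk => h.2.1 i k ?_, h.2.2⟩, h.2.1 K.vs.length f ?_⟩
  · rw [Ctx.push, List.getElem?_append_left (List.getElem?_eq_some_iff.mp hk).1, hk]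
  · simp [Ctx.push]

theorem St.update {K : Ctx X} {x : X} {reg : ℕ → ℕ} (h : St K x reg) {m : ℕ}
    (hm : K.vs.length ≤ m) (v : ℕ) : St K x (Function.update reg (2 * m + 4) v) := by
  refine ⟨?_, fun i k hk => ?_, fun j => ?_⟩
  · rw [Function.update_of_ne (by omega)]; exact h.1
  · have := (List.getElem?_eq_some_iff.mp hk).1
    rw [Function.update_of_ne (by omega)]; exact h.2.1 i k hk
  · rw [Function.update_of_ne (by omega)]; exact h.2.2 j

theorem St.write {K : Ctx X} {x : X} {reg : ℕ → ℕ} (h : St K x reg) :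
    St (K.push f) x (Function.update reg (2 * K.vs.length + 4) (f x)) :=
  (h.update le_rfl _).push (by simp)

theorem CmpIn.const (c : ℕ) : CmpIn K fun _ => c :=
  Sim.instr (.const (2 * K.vs.length + 4) c) fun _ _ h => ⟨_, fun _ => rfl, h.write (f := fun _ => c)⟩

theorem Cmp.const (c : ℕ) : Cmp K fun _ => c := fun _ _ _ _ => CmpIn.const c

theorem CmpIn.copy {r : ℕ} (h : ∀ x reg, St K x reg → reg r = f x) :
    CmpIn K f := by
  refine Sim.seq (CmpIn.const 0) (Sim.instr (.add (2 * K.vs.length + 4) r (2 * K.vs.length + 4))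
    fun x reg hs => ⟨Function.update reg _ (reg _ + reg _), fun _ => rfl, ?_⟩)
  have h0 := hs.pop
  have := h x reg h0.1
  simp only [h0.2, this, add_zero]
  exact h0.1.write

theorem Cmp.var (h : f ∈ K.vs) : Cmp K f := by
  intro Y K' g e
  obtain ⟨i, hf⟩ := List.getElem?_of_mem (e.vs f h)
  exact CmpIn.copy (r := 2 * i + 4) (fun x reg hs => hs.2.1 i _ hf)

theorem Cmp.last {H : X × ℕ → ℕ → ℕ} : Cmp (K.bind H) fun y => y.2 :=
  Cmp.var (List.mem_append_right _ (List.mem_singleton.mpr rfl))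

theorem Cmp.bound : Cmp K K.bd := by
  intro Y K' g e
  refine CmpIn.copy (r := 2) (fun x reg hs => ?_)
  rw [hs.1, e.bd]

theorem CmpIn.binary {op : ℕ → ℕ → ℕ} (ha : CmpIn K a) (hb : CmpIn (K.push a) b)
    (ins : ℕ → ℕ → ℕ → Instr)
    (hins : ∀ i j k I b reg, (ins i j k).exec I ⟨b, reg⟩
      = ⟨b + 1, Function.update reg i (op (reg j) (reg k))⟩) :
    CmpIn K fun x => op (a x) (b x) := by
  refine ha.seq (hb.seq (Sim.instr
    (ins (2 * K.vs.length + 4) (2 * K.vs.length + 4) (2 * (K.vs.length + 1) + 4))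
    fun x reg h => ⟨_, fun b => hins _ _ _ _ _ _, ?_⟩))
  have h1 := h.pop
  have h2 := h1.1.pop
  have h3 : reg (2 * (K.vs.length + 1) + 4) = b x := by simpa [Ctx.push] using h1.2
  rw [h2.2, h3]
  exact h2.1.write (f := fun x => op (a x) (b x))

theorem Cmp.binary {op : ℕ → ℕ → ℕ} (ha : Cmp K a) (hb : Cmp K b) (ins : ℕ → ℕ → ℕ → Instr)
    (hins : ∀ i j k I b reg, (ins i j k).exec I ⟨b, reg⟩
      = ⟨b + 1, Function.update reg i (op (reg j) (reg k))⟩) :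
    Cmp K fun x => op (a x) (b x) := fun Y K' g e =>
  CmpIn.binary (ha Y K' g e) (hb Y _ g (e.push _)) ins hins

theorem Cmp.add (ha : Cmp K a) (hb : Cmp K b) : Cmp K fun x => a x + b x :=
  Cmp.binary ha hb .add fun _ _ _ _ _ _ => rfl

theorem Cmp.sub (ha : Cmp K a) (hb : Cmp K b) : Cmp K fun x => a x - b x :=
  Cmp.binary ha hb .sub fun _ _ _ _ _ _ => rfl

theorem Cmp.mul (ha : Cmp K a) (hb : Cmp K b) : Cmp K fun x => a x * b x :=
  Cmp.binary ha hb .mul fun _ _ _ _ _ _ => rfl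

theorem Cmp.input (ha : Cmp K a) : Cmp K fun x => (K.inp x).getD (a x) 0 := by
  intro Y K' g e
  refine (ha Y K' g e).seq (Sim.instr (.read (2 * K'.vs.length + 4) (2 * K'.vs.length + 4))
    fun x reg h => ⟨Function.update reg _ ((K'.inp x).getD (reg _) 0), fun b => rfl, ?_⟩)
  have h1 := h.pop
  simp only [h1.2, e.inp]
  exact h1.1.write (f := fun x => (K.inp (g x)).getD (a (g x)) 0)

theorem Cmp.heap (ha : Cmp K a) : Cmp K fun x => K.hp x (a x) := by
  have h2 : Cmp K fun x => 2 * a x + 1 := ((Cmp.const 2).mul ha).add (.const 1)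
  intro Y K' g e
  refine (h2 Y K' g e).seq (Sim.instr (.load (2 * K'.vs.length + 4) (2 * K'.vs.length + 4))
    fun x reg h => ⟨Function.update reg _ (reg (reg _)), fun b => rfl, ?_⟩)
  have h1 := h.pop
  have h3 : reg (2 * a (g x) + 1) = K.hp (g x) (a (g x)) := by rw [h1.1.2.2, e.hp]
  simp only [h1.2, h3]
  exact h1.1.write (f := fun x => K.hp (g x) (a (g x)))

theorem Cmp.sum {F : X → ℕ → ℕ} (hf : Cmp K.inner fun y => F y.1 y.2) :
    Cmp K fun x => ∑ i ∈ Finset.range (K.bd x), F x i := by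
  intro Y K' g e
  set m := K'.vs.length with hm
  let S : Y → ℕ → ℕ := fun y i => ∑ j ∈ Finset.range i, F (g y) j
  let K'' : Ctx (Y × ℕ) :=
    { inp := fun y => K'.inp y.1, hp := fun y => K'.hp y.1, bd := fun y => K'.bd y.1
      vs := K'.vs.map (fun f y => f y.1) ++ [fun y => S y.1 y.2, Prod.snd] }
  have hext : Ext K.inner K'' (Prod.map g id) := by
    refine ⟨fun y => e.inp y.1, fun y => e.hp y.1, fun y => e.bd y.1, fun f hf => ?_⟩
    rcases List.mem_append.mp hf with h | h
    · obtain ⟨f', hf', rfl⟩ := List.mem_map.mp h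
      exact List.mem_append_left _ (List.mem_map.mpr ⟨_, e.vs f' hf', rfl⟩)
    · rw [List.mem_singleton.mp h]
      refine List.mem_append_right _ ?_
      rw [List.mem_cons]
      exact Or.inr (List.mem_singleton.mpr rfl)
  have hlen : K''.vs.length = m + 2 := by simp [K'', hm]
  have hvs : K'' = ((Ctx.mk (X := Y × ℕ) (fun y => K'.inp y.1) (fun y => K'.hp y.1)
      (fun y => K'.bd y.1) (K'.vs.map fun f y => f y.1)).push fun y => S y.1 y.2).push
      Prod.snd := by
    simp [K'', Ctx.push]
  have hpre : ∀ (y : Y × ℕ) reg, (St K' y.1 reg ∧ reg (2 * m + 4) = S y.1 y.2) ∧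
      reg (2 * (m + 1) + 4) = y.2 ∧ reg 2 = K'.bd y.1 ↔ St K'' y reg := by
    rintro ⟨y, i⟩ reg
    rw [hvs]
    constructor
    · rintro ⟨⟨h1, h2⟩, h3, h4⟩
      refine St.push (St.push ⟨h4, fun j k hk => ?_, h1.2.2⟩ (by simpa using h2))
        (by simpa [Ctx.push] using h3)
      rw [List.getElem?_map, Option.map_eq_some_iff] at hk
      obtain ⟨k', hk', rfl⟩ := hk
      exact h1.2.1 j k' hk'
    · intro h
      obtain ⟨h, h3⟩ := h.pop
      obtain ⟨h, h2⟩ := h.pop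
      refine ⟨⟨⟨h.1, fun j k hk => h.2.1 j (fun y => k y.1) ?_, h.2.2⟩, ?_⟩, ?_, h.1⟩
      · rw [List.getElem?_map, hk]; rfl
      · simpa using h2
      · simpa [Ctx.push] using h3
  have hloop := Sim.loop (inp := K'.inp) (bd := K'.bd) (c := 2 * (m + 1) + 4) (u := 2 * (m + 2) + 4)
    (Inv := fun y i reg => St K' y reg ∧ reg (2 * m + 4) = S y i)
    (by omega) (by omega) (by omega)
    (fun y i reg v h => ⟨h.1.update (by omega) v, by rw [Function.update_of_ne (by omega)]; exact h.2⟩)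
    (fun y i reg v h => ⟨h.1.update (by omega) v, by rw [Function.update_of_ne (by omega)]; exact h.2⟩)
    (by
      have hbody := hf _ K'' _ hext
      refine (hbody.conseq (fun y reg h => (hpre y reg).mp h) (fun _ _ h => h)).seq
        (Sim.instr (.add (2 * m + 4) (2 * m + 4) (2 * (m + 2) + 4))
          fun y reg h => ⟨Function.update reg _ (reg _ + reg _), fun b => rfl, ?_⟩)
      have h1 := h.pop
      obtain ⟨⟨h2, h3⟩, h4, h5⟩ := (hpre y reg).mpr h1.1
      rw [hlen] at h1
      refine ⟨⟨h2.update le_rfl _, ?_⟩, ?_, ?_⟩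
      · simp [h1.2, h3, S, Finset.sum_range_succ]
      · rw [Function.update_of_ne (by omega), h4]
      · rw [Function.update_of_ne (by omega), h5])
  refine (CmpIn.const 0).seq (hloop.conseq (fun y reg h => ?_) (fun y reg h => ?_))
  · have h1 := h.pop
    exact ⟨⟨h1.1, by simpa [S] using h1.2⟩, h1.1.1⟩
  · refine h.1.1.push ?_
    rw [h.1.2]
    simp only [S, e.bd]

/-! ### Computable predicates -/

open Classical in
/-- The truth value of a proposition. -/
noncomputable def ind (p : Prop) : ℕ := if p then 1 else 0

theorem ind_of {p : Prop} (h : p) : ind p = 1 := by simp [ind, h]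

theorem ind_of_not {p : Prop} (h : ¬ p) : ind p = 0 := by simp [ind, h]

/-- The predicate `p` is decidable in polynomial time in the context `K`. -/
def CmpP (K : Ctx X) (p : X → Prop) : Prop := Cmp K fun x => ind (p x)

variable {p q : X → Prop}

theorem Cmp.congr (h : Cmp K a) (e : ∀ x, a x = b x) : Cmp K b := (funext e : a = b) ▸ h

theorem CmpP.congr (h : CmpP K p) (e : ∀ x, p x ↔ q x) : CmpP K q :=
  (funext fun x => propext (e x) : p = q) ▸ h

theorem CmpP.wk (h : CmpP K p) : CmpP K.inner fun y => p y.1 := Cmp.wk h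

theorem CmpP.eq_zero (ha : Cmp K a) : CmpP K fun x => a x = 0 :=
  ((Cmp.const 1).sub ha).congr fun x => by
    by_cases h : a x = 0 <;> simp [ind, h]; omega

theorem CmpP.not (hp : CmpP K p) : CmpP K fun x => ¬ p x :=
  (CmpP.eq_zero hp).congr fun x => by by_cases h : p x <;> simp [ind, h]

theorem CmpP.and (hp : CmpP K p) (hq : CmpP K q) : CmpP K fun x => p x ∧ q x :=
  (Cmp.mul hp hq).congr fun x => by by_cases h : p x <;> by_cases h' : q x <;> simp [ind, h, h']

theorem CmpP.or (hp : CmpP K p) (hq : CmpP K q) : CmpP K fun x => p x ∨ q x :=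
  (hp.not.and hq.not).not.congr fun x => by tauto

theorem CmpP.le (ha : Cmp K a) (hb : Cmp K b) : CmpP K fun x => a x ≤ b x :=
  (CmpP.eq_zero (ha.sub hb)).congr fun x => by omega

theorem CmpP.lt (ha : Cmp K a) (hb : Cmp K b) : CmpP K fun x => a x < b x :=
  (CmpP.le hb ha).not.congr fun x => by omega

theorem CmpP.eq (ha : Cmp K a) (hb : Cmp K b) : CmpP K fun x => a x = b x :=
  ((CmpP.le ha hb).and (CmpP.le hb ha)).congr fun x => by omega

theorem CmpP.ne (ha : Cmp K a) (hb : Cmp K b) : CmpP K fun x => a x ≠ b x :=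
  (CmpP.eq ha hb).not

theorem CmpP.ex {p : X → ℕ → Prop} (hp : CmpP K.inner fun y => p y.1 y.2) :
    CmpP K fun x => ∃ i < K.bd x, p x i :=
  (CmpP.eq_zero (Cmp.sum (F := fun x i => ind (p x i)) hp)).not.congr fun x => by
    simp [ind]

theorem Cmp.ite [DecidablePred p] (hp : CmpP K p) (ha : Cmp K a) (hb : Cmp K b) :
    Cmp K fun x => if p x then a x else b x :=
  ((Cmp.mul hp ha).add (Cmp.mul hp.not hb)).congr fun x => by
    by_cases h : p x <;> simp [ind, h]

/-! ### Computable transformations of the heap -/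

/-- The context after the heap has been changed to `F`. -/
def Ctx.setHeap (K : Ctx X) (F : X → ℕ → ℕ) : Ctx X := { K with hp := F }

/-- There is code that changes the heap to `F` in polynomial time. -/
def HCmp (K : Ctx X) (F : X → ℕ → ℕ) : Prop :=
  Sim K.inp K.bd (St K) (St (K.setHeap F))

theorem HCmp.store (ha : Cmp K a) (hb : Cmp K b) :
    HCmp K fun x => Function.update (K.hp x) (a x) (b x) := by
  have h2 : Cmp K fun x => 2 * a x + 1 := ((Cmp.const 2).mul ha).add (.const 1)
  refine h2.cmpIn.seq ((hb X (K.push _) id ((Ext.refl K).push _)).seq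
    (Sim.instr (.store (2 * K.vs.length + 4) (2 * (K.vs.length + 1) + 4))
      fun x reg h => ⟨Function.update reg (reg _) (reg _), fun _ => rfl, ?_⟩))
  have h1 := h.pop
  have h3 := h1.1.pop
  have h4 : reg (2 * (K.vs.length + 1) + 4) = b x := by simpa [Ctx.push] using h1.2
  simp only [h3.2, h4]
  refine ⟨?_, fun i k hk => ?_, fun j => ?_⟩
  · rw [Function.update_of_ne (by omega)]; exact h3.1.1
  · rw [Function.update_of_ne (by omega)]; exact h3.1.2.1 i k hk
  · by_cases hj : j = a x
    · subst hj; simp [Ctx.setHeap]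
    · rw [Function.update_of_ne (by omega), h3.1.2.2]
      simp [Ctx.setHeap, Function.update_of_ne hj]

theorem HCmp.congr {F G : X → ℕ → ℕ} (h : HCmp K F) (e : ∀ x, F x = G x) : HCmp K G :=
  (funext e : F = G) ▸ h

theorem HCmp.seq {F G : X → ℕ → ℕ} (h1 : HCmp K F) (h2 : HCmp (K.setHeap F) G) : HCmp K G :=
  Sim.seq h1 h2

/-- A loop whose body takes the heap from `H x i` to `H x (i + 1)`. -/
theorem HCmp.loop {H : X → ℕ → ℕ → ℕ}
    (hbody : HCmp (K.bind fun y => H y.1 y.2) fun y => H y.1 (y.2 + 1)) :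
    HCmp (K.setHeap fun x => H x 0) fun x => H x (K.bd x) := by
  set m := K.vs.length with hm
  have hvs : ∀ G, K.bind G = (Ctx.mk (X := X × ℕ) (fun y => K.inp y.1) G
      (fun y => K.bd y.1) (K.vs.map fun f y => f y.1)).push Prod.snd := fun _ => rfl
  have hpre : ∀ (G : X × ℕ → ℕ → ℕ) (y : X × ℕ) reg, St (K.setHeap fun _ => G y) y.1 reg ∧
      reg (2 * m + 4) = y.2 ∧ reg 2 = K.bd y.1 ↔ St (K.bind G) y reg := by
    rintro G ⟨x, i⟩ reg
    rw [hvs]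
    constructor
    · rintro ⟨h1, h3, h4⟩
      refine St.push ⟨h4, fun j k hk => ?_, h1.2.2⟩ (by simpa using h3)
      rw [List.getElem?_map, Option.map_eq_some_iff] at hk
      obtain ⟨k', hk', rfl⟩ := hk
      exact h1.2.1 j k' hk'
    · intro h
      obtain ⟨h, h3⟩ := h.pop
      refine ⟨⟨h.1, fun j k hk => h.2.1 j (fun y => k y.1) ?_, h.2.2⟩, by simpa using h3, h.1⟩
      rw [List.getElem?_map]
      exact congrArg _ hk
  have hloop := Sim.loop (inp := K.inp) (bd := K.bd) (c := 2 * m + 4) (u := 2 * (m + 1) + 4)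
    (Inv := fun x i reg => St (K.setHeap fun x => H x i) x reg)
    (by omega) (by omega) (by omega)
    (fun y i reg v h => h.update le_rfl v)
    (fun y i reg v h => h.update (Nat.le_succ m) v)
    (Sim.conseq hbody
      (fun y reg h => (hpre (fun y => H y.1 y.2) y reg).mp h)
      (fun y reg h => (hpre (fun y => H y.1 (y.2 + 1)) y reg).mpr h))
  exact hloop.conseq (fun x reg h => ⟨h, h.1⟩) (fun x reg h => h.1)

/-- Change the loop bound. -/
theorem Sim.setBound (hf : Cmp K f) :
    Sim K.inp K.bd (St K) (St { K with bd := f }) := by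
  refine hf.cmpIn.seq (Sim.seq (Mid := fun x reg => St K x reg ∧ reg (2 * K.vs.length + 4) = f x ∧
      reg (2 * (K.vs.length + 1) + 4) = 0)
    (Sim.instr (.const (2 * (K.vs.length + 1) + 4) 0)
      fun x reg h => ⟨Function.update reg _ 0, fun _ => rfl, ?_⟩)
    (Sim.instr (.add 2 (2 * K.vs.length + 4) (2 * (K.vs.length + 1) + 4))
      fun x reg h => ⟨Function.update reg _ (reg _ + reg _), fun _ => rfl, ?_⟩))
  · have h1 := h.pop
    exact ⟨h1.1.update (by omega) _, by rw [Function.update_of_ne (by omega)]; exact h1.2, by simp⟩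
  · rw [h.2.1, h.2.2, add_zero]
    refine ⟨by simp, fun i k hk => ?_, fun j => ?_⟩
    · rw [Function.update_of_ne (by omega)]; exact h.1.2.1 i k hk
    · rw [Function.update_of_ne (by omega)]; exact h.1.2.2 j

/-- Move a value to the output register. -/
theorem Sim.output (hf : Cmp K f) : Sim K.inp K.bd (St K) fun x reg => reg 0 = f x := by
  refine hf.cmpIn.seq (Sim.seq (Mid := fun x reg => reg (2 * K.vs.length + 4) = f x ∧
      reg (2 * (K.vs.length + 1) + 4) = 0)
    (Sim.instr (.const (2 * (K.vs.length + 1) + 4) 0)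
      fun x reg h => ⟨Function.update reg _ 0, fun _ => rfl, ?_⟩)
    (Sim.instr (.add 0 (2 * K.vs.length + 4) (2 * (K.vs.length + 1) + 4))
      fun x reg h => ⟨Function.update reg _ (reg _ + reg _), fun _ => rfl, ?_⟩))
  · exact ⟨by rw [Function.update_of_ne (by omega)]; exact h.pop.2, by simp⟩
  · simp [h.1, h.2]

end RAM

/-! ### Growth of graded unambiguous grammars -/

/-- A grammar in which every rule replaces a nonterminal by two nonterminals. The nonterminals are
numbers below `NV`. The rule number `l` applies to `σ` if `act σ l`; it then replaces `σ` by
`f1 σ l` and `f2 σ l`, and contributes `dl σ l` to the degree. The nonterminals that satisfy `init`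
also derive the empty word. -/
structure Grammar where
  NV : ℕ
  NL : ℕ
  act : ℕ → ℕ → Prop
  f1 : ℕ → ℕ → ℕ
  f2 : ℕ → ℕ → ℕ
  dl : ℕ → ℕ → ℕ
  init : ℕ → Prop

namespace Grammar

open Classical in
/-- The ways `(l, k1, k2)` to begin a derivation of degree `k` from `σ`: the rule is `l`, and its two
nonterminals yield the degrees `k1` and `k2`. -/
noncomputable def terms (G : Grammar) (σ k : ℕ) : Finset (ℕ × ℕ × ℕ) :=
  (Finset.range G.NL ×ˢ Finset.range (k + 1) ×ˢ Finset.range (k + 1)).filter fun t =>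
    G.act σ t.1 ∧ t.2.1 + t.2.2 + G.dl σ t.1 = k

/-- `N σ k M` is the number of words of length at most `M` and degree `k` that derive from `σ`. What
matters about these numbers: `le` holds since all words are derived, `add_le` since the grammar is
unambiguous. In degree `0`, every nonterminal derives at most one word. -/
structure Counts (G : Grammar) (N : ℕ → ℕ → ℕ → ℕ) : Prop where
  lt : ∀ {σ l}, G.act σ l → σ < G.NV ∧ l < G.NL ∧ G.f1 σ l < G.NV ∧ G.f2 σ l < G.NV
  mono : ∀ σ k, Monotone (N σ k)
  zero_le_one : ∀ σ M, N σ 0 M ≤ 1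
  init_le : ∀ σ, G.init σ → 1 ≤ N σ 0 0
  zero_le : ∀ σ k, N σ k 0 ≤ RAM.ind (k = 0 ∧ G.init σ)
  succ_le : ∀ σ k M, N σ k (M + 1) ≤ RAM.ind (k = 0 ∧ G.init σ) +
    ∑ t ∈ G.terms σ k, N (G.f1 σ t.1) t.2.1 M * N (G.f2 σ t.1) t.2.2 M
  le : ∀ {σ k}, ∀ t ∈ G.terms σ k, ∀ {A B M}, A + B + 2 ≤ M →
    N (G.f1 σ t.1) t.2.1 A * N (G.f2 σ t.1) t.2.2 B ≤ N σ k M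
  add_le : ∀ {σ k}, ∀ t ∈ G.terms σ k, ∀ t' ∈ G.terms σ k, t ≠ t' → ∀ {A B A' B' M},
    A + B + 2 ≤ M → A' + B' + 2 ≤ M →
    N (G.f1 σ t.1) t.2.1 A * N (G.f2 σ t.1) t.2.2 B +
      N (G.f1 σ t'.1) t'.2.1 A' * N (G.f2 σ t'.1) t'.2.2 B' ≤ N σ k M

variable (G : Grammar)

/-- The nonterminal derives a word of degree `0`. -/
inductive Z : ℕ → Prop
  | init {σ : ℕ} : G.init σ → Z σ
  | rule {σ l : ℕ} : G.act σ l → G.dl σ l = 0 → Z (G.f1 σ l) → Z (G.f2 σ l) → Z σ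

/-- The edge with label `e` from `σ` to `τ`: a rule for `σ` one of whose nonterminals is `τ` and the
other one derives a word of degree `0`. The label is even if `τ` is the first one. -/
def Edge (σ e τ : ℕ) : Prop :=
  ∃ l, G.act σ l ∧ G.dl σ l = 0 ∧
    ((e = 2 * l ∧ G.Z (G.f2 σ l) ∧ τ = G.f1 σ l) ∨ (e = 2 * l + 1 ∧ G.Z (G.f1 σ l) ∧ τ = G.f2 σ l))

/-- There is a nonempty path of edges from `σ` to `τ`. -/
def R : ℕ → ℕ → Prop := Relation.TransGen fun σ τ => ∃ e, G.Edge σ e τ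

/-- The edge with label `e` at `σ` lies on a cycle. -/
def Ret (σ e : ℕ) : Prop := ∃ τ, G.Edge σ e τ ∧ G.R τ σ

/-- There are two cycles through `σ` that begin with different edges. -/
def Bad (σ : ℕ) : Prop := ∃ e e', e < e' ∧ G.Ret σ e ∧ G.Ret σ e'

/-- `A V σ k v` says that the number of words of degree `k` that derive from `σ` grows at least with
degree `v`. Every cycle that a derivation passes through contributes `1`, namely at the step by
which it leaves the cycle. The degrees are cut off at `V`, which stands for exponential growth. -/
inductive A (V : ℕ) : ℕ → ℕ → ℕ → Prop
  | zero {σ : ℕ} : G.Z σ → A V σ 0 0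
  | rule {σ l k k1 k2 v1 v2 v : ℕ} : G.act σ l → 0 < k → k1 + k2 + G.dl σ l = k →
      A V (G.f1 σ l) k1 v1 → A V (G.f2 σ l) k2 v2 → v ≤ V →
      (G.Bad σ ∨ v ≤ v1 + v2 ∨ (v ≤ v1 + v2 + 1 ∧ G.R σ σ ∧ ¬ (k1 = k ∧ G.R (G.f1 σ l) σ) ∧
        ¬ (k2 = k ∧ G.R (G.f2 σ l) σ))) → A V σ k v

open Classical in
/-- The number of nonterminals that can be reached from `σ`, including `σ`. -/
noncomputable def height (σ : ℕ) : ℕ := ((Finset.range G.NV).filter fun ρ => ρ = σ ∨ G.R σ ρ).card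

end Grammar

/-- `f` grows at least like a polynomial of degree `v`. -/
def GrowsPoly (f : ℕ → ℕ) (v : ℕ) : Prop := ∃ a, ∀ M, (M + 1) ^ v ≤ f (a * M + a)

/-- `f` grows at least exponentially. -/
def GrowsExp (f : ℕ → ℕ) : Prop := ∃ a, ∀ M, 2 ^ M ≤ f (a * M + a)

/-- `f` grows at most like a polynomial of degree `v`. -/
def BoundedPoly (f : ℕ → ℕ) (v : ℕ) : Prop := ∃ K, ∀ M, f M ≤ K * (M + 1) ^ v

theorem GrowsPoly.exists_one_le {f : ℕ → ℕ} {v : ℕ} (h : GrowsPoly f v) : ∃ M, 1 ≤ f M := by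
  obtain ⟨a, h⟩ := h
  exact ⟨_, (by simp : 1 ≤ (0 + 1) ^ v).trans (h 0)⟩

theorem GrowsPoly.anti {f : ℕ → ℕ} {v w : ℕ} (h : GrowsPoly f v) (hw : w ≤ v) : GrowsPoly f w := by
  obtain ⟨a, h⟩ := h
  exact ⟨a, fun M => (Nat.pow_le_pow_right (by omega) hw).trans (h M)⟩

theorem GrowsExp.exists_one_le {f : ℕ → ℕ} (h : GrowsExp f) : ∃ M, 1 ≤ f M := by
  obtain ⟨a, h⟩ := h
  exact ⟨_, h 0⟩

namespace Grammar

variable {G : Grammar} {N : ℕ → ℕ → ℕ → ℕ}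

theorem mem_terms {σ k l k1 k2 : ℕ} (hN : G.Counts N) :
    (l, k1, k2) ∈ G.terms σ k ↔ G.act σ l ∧ k1 + k2 + G.dl σ l = k := by
  simp only [terms, Finset.mem_filter, Finset.mem_product, Finset.mem_range]
  exact ⟨fun h => h.2, fun h => ⟨⟨(hN.lt h.1).2.1, by omega, by omega⟩, h⟩⟩

theorem A.le_cap {V σ k v : ℕ} (h : G.A V σ k v) : v ≤ V := by
  cases h with
  | zero _ => exact Nat.zero_le _
  | rule _ _ _ _ _ hv _ => exact hv

namespace Counts

variable (hN : G.Counts N)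
include hN

theorem Z_iff {σ : ℕ} : G.Z σ ↔ ∃ M, 1 ≤ N σ 0 M := by
  constructor
  · intro h
    induction h with
    | init h => exact ⟨0, hN.init_le _ h⟩
    | @rule σ l h hd _ _ ih1 ih2 =>
      obtain ⟨M1, h1⟩ := ih1
      obtain ⟨M2, h2⟩ := ih2
      refine ⟨M1 + M2 + 2, le_trans ?_ (hN.le (l, 0, 0) ((mem_terms hN).mpr ⟨h, by simpa⟩) le_rfl)⟩
      exact Nat.mul_le_mul h1 h2
  · rintro ⟨M, h⟩
    induction M generalizing σ with
    | zero =>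
      have := h.trans (hN.zero_le σ 0)
      by_contra hc
      rw [RAM.ind_of_not (fun h => hc (.init h.2))] at this
      omega
    | succ M ih =>
      have := h.trans (hN.succ_le σ 0 M)
      by_cases hi : G.init σ
      · exact .init hi
      rw [RAM.ind_of_not (fun h => hi h.2), zero_add] at this
      obtain ⟨⟨l, k1, k2⟩, ht, hne⟩ := Finset.exists_ne_zero_of_sum_ne_zero
        (Nat.one_le_iff_ne_zero.mp this)
      obtain ⟨ha, hk⟩ := (mem_terms hN).mp ht
      have h1 := Nat.pos_of_ne_zero (left_ne_zero_of_mul hne)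
      have h2 := Nat.pos_of_ne_zero (right_ne_zero_of_mul hne)
      obtain rfl : k1 = 0 := by omega
      obtain rfl : k2 = 0 := by omega
      exact .rule ha (by omega) (ih (by assumption)) (ih (by assumption))

omit hN in
/-- Different edges are followed by different ways to begin a derivation: the edge with label `e` is
followed by the rule `e / 2` with the whole degree `k` at the nonterminal that the edge leads to. -/
theorem edge_terms_injective {k : ℕ} (hk : 0 < k) {e e' : ℕ}
    (h : (if e % 2 = 0 then (e / 2, k, 0) else (e / 2, 0, k)) =
      (if e' % 2 = 0 then (e' / 2, k, 0) else (e' / 2, 0, k))) : e = e' := by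
  split_ifs at h <;> simp only [Prod.mk.injEq] at h <;> omega

theorem edge {σ e τ k : ℕ} (h : G.Edge σ e τ) :
    ∃ t ∈ G.terms σ k, t = (if e % 2 = 0 then (e / 2, k, 0) else (e / 2, 0, k)) ∧
      (t.2.1 = k ∧ G.f1 σ t.1 = τ ∨ t.2.2 = k ∧ G.f2 σ t.1 = τ) ∧
      ∃ c, ∀ M, ∃ A B, A + B + 2 ≤ M + c ∧
        N τ k M ≤ N (G.f1 σ t.1) t.2.1 A * N (G.f2 σ t.1) t.2.2 B := by
  obtain ⟨l, ha, hd, ⟨rfl, hz, rfl⟩ | ⟨rfl, hz, rfl⟩⟩ := h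
  · obtain ⟨c, hc⟩ := hN.Z_iff.mp hz
    refine ⟨(l, k, 0), (mem_terms hN).mpr ⟨ha, by omega⟩, by simp, by simp, c + 2,
      fun M => ⟨M, c, by omega, Nat.le_mul_of_pos_right _ hc⟩⟩
  · obtain ⟨c, hc⟩ := hN.Z_iff.mp hz
    refine ⟨(l, 0, k), (mem_terms hN).mpr ⟨ha, by omega⟩, ?_, by simp, c + 2,
      fun M => ⟨c, M, by omega, Nat.le_mul_of_pos_left _ hc⟩⟩
    rw [if_neg (by omega)]; simp; omega

theorem R_le {σ τ k : ℕ} (h : G.R σ τ) : ∃ c, ∀ M, N τ k M ≤ N σ k (M + c) := by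
  have h1 : ∀ {σ τ}, (∃ e, G.Edge σ e τ) → ∃ c, ∀ M, N τ k M ≤ N σ k (M + c) := by
    rintro σ τ ⟨e, h⟩
    obtain ⟨t, ht, -, -, c, hc⟩ := hN.edge (k := k) h
    refine ⟨c, fun M => ?_⟩
    obtain ⟨A, B, hAB, h⟩ := hc M
    exact h.trans (hN.le t ht hAB)
  induction h with
  | single h => exact h1 h
  | tail _ h ih =>
    obtain ⟨c, hc⟩ := ih
    obtain ⟨c', hc'⟩ := h1 h
    exact ⟨c' + c, fun M => (hc' M).trans ((hc _).trans (by rw [add_assoc]))⟩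

/-- A cycle at `σ` that begins with an edge other than the derivation step `t` can be put in front of
that step. -/
theorem cycle_add {σ e k : ℕ} (hr : G.Ret σ e) {t : ℕ × ℕ × ℕ} (ht : t ∈ G.terms σ k)
    (hne : t ≠ (if e % 2 = 0 then (e / 2, k, 0) else (e / 2, 0, k))) :
    ∃ c, ∀ M A B M', M + c ≤ M' → A + B + 2 ≤ M' →
      N σ k M + N (G.f1 σ t.1) t.2.1 A * N (G.f2 σ t.1) t.2.2 B ≤ N σ k M' := by
  obtain ⟨τ, he, hR⟩ := hr
  obtain ⟨t', ht', rfl, -, c, hc⟩ := hN.edge (k := k) he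
  obtain ⟨c', hc'⟩ := hN.R_le (k := k) hR
  refine ⟨c' + c, fun M A B M' h1 h2 => ?_⟩
  obtain ⟨A', B', hAB, h⟩ := hc (M + c')
  exact (Nat.add_le_add_right ((hc' M).trans h) _).trans
    (hN.add_le _ ht' t ht hne.symm (by omega) h2)

omit hN in
theorem exists_ret {σ : ℕ} (h : G.R σ σ) : ∃ e, G.Ret σ e := by
  rcases Relation.TransGen.head'_iff.mp h with ⟨τ, ⟨e, he⟩, hr⟩
  refine ⟨e, τ, he, ?_⟩
  rcases Relation.reflTransGen_iff_eq_or_transGen.mp hr with h' | h'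
  · subst h'; exact h
  · exact h'

theorem growsPoly_mul {σ k v1 v2 : ℕ} {t : ℕ × ℕ × ℕ} (ht : t ∈ G.terms σ k)
    (h1 : GrowsPoly (N (G.f1 σ t.1) t.2.1) v1) (h2 : GrowsPoly (N (G.f2 σ t.1) t.2.2) v2) :
    GrowsPoly (N σ k) (v1 + v2) := by
  obtain ⟨a, h1⟩ := h1
  obtain ⟨b, h2⟩ := h2
  refine ⟨a + b + 2, fun M => ?_⟩
  rw [pow_add]
  refine (Nat.mul_le_mul (h1 M) (h2 M)).trans (hN.le t ht ?_)
  nlinarith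

theorem growsPoly_cycle {σ e k v1 v2 : ℕ} (hr : G.Ret σ e) {t : ℕ × ℕ × ℕ} (ht : t ∈ G.terms σ k)
    (hne : t ≠ (if e % 2 = 0 then (e / 2, k, 0) else (e / 2, 0, k)))
    (h1 : GrowsPoly (N (G.f1 σ t.1) t.2.1) v1) (h2 : GrowsPoly (N (G.f2 σ t.1) t.2.2) v2) :
    GrowsPoly (N σ k) (v1 + v2 + 1) := by
  obtain ⟨c, hc⟩ := hN.cycle_add hr ht hne
  obtain ⟨a, h1⟩ := h1
  obtain ⟨b, h2⟩ := h2
  refine ⟨c + (a + b + 2), fun M => ?_⟩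
  have key : ∀ j, j * (M + 1) ^ (v1 + v2) ≤
      N σ k (j * c + ((a * M + a) + (b * M + b) + 2)) := by
    intro j
    induction j with
    | zero => simp
    | succ j ih =>
      rw [add_mul, one_mul]
      refine (Nat.add_le_add ih ?_).trans (hc _ (a * M + a) (b * M + b) _ ?_ ?_)
      · rw [pow_add]
        exact Nat.mul_le_mul (h1 M) (h2 M)
      · rw [add_mul]; omega
      · omega
  rw [pow_succ']
  refine (key (M + 1)).trans (hN.mono _ _ ?_)
  nlinarith

theorem growsExp_mul {σ k : ℕ} {t : ℕ × ℕ × ℕ} (ht : t ∈ G.terms σ k)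
    (h : GrowsExp (N (G.f1 σ t.1) t.2.1) ∧ (∃ M, 1 ≤ N (G.f2 σ t.1) t.2.2 M) ∨
      (∃ M, 1 ≤ N (G.f1 σ t.1) t.2.1 M) ∧ GrowsExp (N (G.f2 σ t.1) t.2.2)) :
    GrowsExp (N σ k) := by
  rcases h with ⟨⟨a, h1⟩, b, h2⟩ | ⟨⟨b, h2⟩, a, h1⟩
  · refine ⟨a + b + 2, fun M => ?_⟩
    refine (Nat.le_mul_of_pos_right _ h2).trans ((Nat.mul_le_mul_right _ (h1 M)).trans
      (hN.le t ht ?_))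
    nlinarith
  · refine ⟨a + b + 2, fun M => ?_⟩
    refine (Nat.le_mul_of_pos_left _ h2).trans ((Nat.mul_le_mul_left _ (h1 M)).trans
      (hN.le t ht ?_))
    nlinarith

/-- Two different cycles can be combined to a free monoid of rank two. -/
theorem growsExp_of_bad {σ k : ℕ} (hk : 0 < k) (hb : G.Bad σ) (h : ∃ M, 1 ≤ N σ k M) :
    GrowsExp (N σ k) := by
  obtain ⟨e, e', hlt, hr, τ, he, hR⟩ := hb
  obtain ⟨t, ht, hte, -, c', hc'⟩ := hN.edge (k := k) he
  obtain ⟨c'', hc''⟩ := hN.R_le (k := k) hR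
  obtain ⟨c, hc⟩ := hN.cycle_add hr ht (fun h => by
    rw [hte] at h
    exact absurd (edge_terms_injective hk h) (by omega))
  obtain ⟨M0, h0⟩ := h
  have key : ∀ j, 2 ^ j ≤ N σ k (M0 + j * (c + c' + c'')) := by
    intro j
    induction j with
    | zero => simpa using h0
    | succ j ih =>
      obtain ⟨A, B, hAB, h⟩ := hc' (M0 + j * (c + c' + c'') + c'')
      rw [pow_succ, mul_two]
      refine (Nat.add_le_add ih (ih.trans ((hc'' _).trans h))).trans (hc _ A B _ ?_ ?_)
      · rw [add_mul]; omega
      · rw [add_mul]; omega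
  refine ⟨M0 + (c + c' + c''), fun M => (key M).trans (hN.mono _ _ ?_)⟩
  nlinarith

omit hN in
theorem height_le (G : Grammar) (σ : ℕ) : G.height σ ≤ G.NV := by
  classical
  exact (Finset.card_filter_le _ _).trans (by simp)

theorem height_pos {σ l : ℕ} (h : G.act σ l) : 0 < G.height σ := by
  classical
  exact Finset.card_pos.mpr ⟨σ, by simp [(hN.lt h).1]⟩

omit hN in
theorem height_le_of_edge {σ e τ : ℕ} (h : G.Edge σ e τ) : G.height τ ≤ G.height σ := by
  classical
  refine Finset.card_le_card fun ρ hρ => ?_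
  simp only [Finset.mem_filter, Finset.mem_range] at hρ ⊢
  refine ⟨hρ.1, Or.inr ?_⟩
  rcases hρ.2 with rfl | h'
  · exact .single ⟨e, h⟩
  · exact .head ⟨e, h⟩ h'

theorem height_lt_of_edge {σ e τ : ℕ} (h : G.Edge σ e τ) (hr : ¬ G.R τ σ) :
    G.height τ < G.height σ := by
  classical
  have hσ : σ < G.NV := by
    obtain ⟨l, ha, -⟩ := h
    exact (hN.lt ha).1
  refine Finset.card_lt_card ?_
  rw [Finset.ssubset_iff_of_subset]
  · refine ⟨σ, by simp [hσ], ?_⟩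
    simp only [Finset.mem_filter, not_and, not_or]
    rintro -
    refine ⟨?_, hr⟩
    rintro rfl
    exact hr (.single ⟨e, h⟩)
  · intro ρ hρ
    simp only [Finset.mem_filter, Finset.mem_range] at hρ ⊢
    refine ⟨hρ.1, Or.inr ?_⟩
    rcases hρ.2 with rfl | h'
    · exact .single ⟨e, h⟩
    · exact .head ⟨e, h⟩ h'

omit hN in
theorem edge_of_left {σ l k1 k2 k : ℕ} (ha : G.act σ l) (hk : k1 + k2 + G.dl σ l = k)
    (h1 : k1 = k) (hz : k2 = 0 → G.Z (G.f2 σ l)) : G.Edge σ (2 * l) (G.f1 σ l) :=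
  ⟨l, ha, by omega, Or.inl ⟨rfl, hz (by omega), rfl⟩⟩

omit hN in
theorem edge_of_right {σ l k1 k2 k : ℕ} (ha : G.act σ l) (hk : k1 + k2 + G.dl σ l = k)
    (h2 : k2 = k) (hz : k1 = 0 → G.Z (G.f1 σ l)) : G.Edge σ (2 * l + 1) (G.f2 σ l) :=
  ⟨l, ha, by omega, Or.inr ⟨rfl, hz (by omega), rfl⟩⟩

/-- Lower bounds for the growth. Without exponential growth the degree is bounded a priori, so that
the cut-off has no effect if `V` is large enough. -/
theorem lower {V σ k v : ℕ} (h : G.A V σ k v) :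
    (k = 0 ∧ v = 0 ∧ G.Z σ) ∨ (0 < k ∧ (GrowsExp (N σ k) ∨
      (v ≤ 2 * (k - 1) * (G.NV + 1) + G.height σ ∧ GrowsPoly (N σ k) v))) := by
  induction h with
  | zero h => exact Or.inl ⟨rfl, rfl, h⟩
  | @rule σ l k k1 k2 v1 v2 v ha hk hsum _ _ hv hor ih1 ih2 =>
    refine Or.inr ⟨hk, ?_⟩
    have ht : (l, k1, k2) ∈ G.terms σ k := (mem_terms hN).mpr ⟨ha, hsum⟩
    have hprod : ∀ {σ' k' v' : ℕ}, ((k' = 0 ∧ v' = 0 ∧ G.Z σ') ∨ (0 < k' ∧ (GrowsExp (N σ' k') ∨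
      (v' ≤ 2 * (k' - 1) * (G.NV + 1) + G.height σ' ∧ GrowsPoly (N σ' k') v')))) →
        ∃ M, 1 ≤ N σ' k' M := by
      rintro σ' k' v' (⟨rfl, -, h⟩ | ⟨-, h | h⟩)
      · exact hN.Z_iff.mp h
      · exact h.exists_one_le
      · exact h.2.exists_one_le
    have hpoly : ∀ {σ' k' v' : ℕ}, ((k' = 0 ∧ v' = 0 ∧ G.Z σ') ∨ (0 < k' ∧ (GrowsExp (N σ' k') ∨
      (v' ≤ 2 * (k' - 1) * (G.NV + 1) + G.height σ' ∧ GrowsPoly (N σ' k') v')))) →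
        GrowsExp (N σ' k') ∨ (GrowsPoly (N σ' k') v' ∧ (k' = 0 ∧ v' = 0 ∧ G.Z σ' ∨
          0 < k' ∧ v' ≤ 2 * (k' - 1) * (G.NV + 1) + G.height σ')) := by
      rintro σ' k' v' (⟨rfl, rfl, h⟩ | ⟨h0, h | h⟩)
      · obtain ⟨M, hM⟩ := hN.Z_iff.mp h
        exact Or.inr ⟨⟨M, fun j => by
          rw [pow_zero]; exact hM.trans (hN.mono _ _ (by nlinarith))⟩, Or.inl ⟨rfl, rfl, h⟩⟩
      · exact Or.inl h
      · exact Or.inr ⟨h.2, Or.inr ⟨h0, h.1⟩⟩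
    rcases hpoly ih1 with h1 | ⟨h1, b1⟩
    · exact Or.inl (hN.growsExp_mul ht (Or.inl ⟨h1, hprod ih2⟩))
    rcases hpoly ih2 with h2 | ⟨h2, b2⟩
    · exact Or.inl (hN.growsExp_mul ht (Or.inr ⟨hprod ih1, h2⟩))
    by_cases hb : G.Bad σ
    · exact Or.inl (hN.growsExp_of_bad hk hb (hN.growsPoly_mul ht h1 h2).exists_one_le)
    right
    have hh := hN.height_pos ha
    have hle1 := height_le G (G.f1 σ l)
    have hle2 := height_le G (G.f2 σ l)
    have hz1 : k1 = 0 → G.Z (G.f1 σ l) := fun h => by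
      rcases b1 with h' | h'
      · exact h'.2.2
      · omega
    have hz2 : k2 = 0 → G.Z (G.f2 σ l) := fun h => by
      rcases b2 with h' | h'
      · exact h'.2.2
      · omega
    -- Away from a linear step the degrees of both factors are smaller, which leaves room for `1`.
    have hinner : k1 ≠ k → k2 ≠ k →
        v1 + v2 + 1 ≤ 2 * (k - 1) * (G.NV + 1) + G.height σ := by
      intro hk1 hk2
      rcases b1 with ⟨rfl, rfl, -⟩ | ⟨hp1, b1⟩ <;> rcases b2 with ⟨rfl, rfl, -⟩ | ⟨hp2, b2⟩
      · omega
      · obtain ⟨j, rfl⟩ : ∃ j, k2 = j + 1 := ⟨k2 - 1, by omega⟩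
        obtain ⟨i, rfl⟩ : ∃ i, k = j + 2 + i := ⟨k - (j + 2), by omega⟩
        have e1 : j + 1 - 1 = j := by omega
        have e2 : j + 2 + i - 1 = j + 1 + i := by omega
        rw [e1] at b2; rw [e2]; nlinarith
      · obtain ⟨j, rfl⟩ : ∃ j, k1 = j + 1 := ⟨k1 - 1, by omega⟩
        obtain ⟨i, rfl⟩ : ∃ i, k = j + 2 + i := ⟨k - (j + 2), by omega⟩
        have e1 : j + 1 - 1 = j := by omega
        have e2 : j + 2 + i - 1 = j + 1 + i := by omega
        rw [e1] at b1; rw [e2]; nlinarith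
      · obtain ⟨j, rfl⟩ : ∃ j, k1 = j + 1 := ⟨k1 - 1, by omega⟩
        obtain ⟨j', rfl⟩ : ∃ j', k2 = j' + 1 := ⟨k2 - 1, by omega⟩
        obtain ⟨i, rfl⟩ : ∃ i, k = j + j' + 2 + i := ⟨k - (j + j' + 2), by omega⟩
        have e1 : j + 1 - 1 = j := by omega
        have e2 : j' + 1 - 1 = j' := by omega
        have e3 : j + j' + 2 + i - 1 = j + j' + 1 + i := by omega
        rw [e1] at b1; rw [e2] at b2; rw [e3]; nlinarith
    have hleft : k1 = k → v2 = 0 ∧ v1 ≤ 2 * (k - 1) * (G.NV + 1) + G.height (G.f1 σ l) := by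
      intro h
      rcases b2 with h' | h'
      · rcases b1 with h'' | h''
        · omega
        · exact ⟨h'.2.1, h ▸ h''.2⟩
      · omega
    have hright : k2 = k → v1 = 0 ∧ v2 ≤ 2 * (k - 1) * (G.NV + 1) + G.height (G.f2 σ l) := by
      intro h
      rcases b1 with h' | h'
      · rcases b2 with h'' | h''
        · omega
        · exact ⟨h'.2.1, h ▸ h''.2⟩
      · omega
    rcases hor with h | h | ⟨h, hcyc, hn1, hn2⟩
    · exact absurd h hb
    · refine ⟨?_, (hN.growsPoly_mul ht h1 h2).anti h⟩
      by_cases hk1 : k1 = k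
      · have := height_le_of_edge (edge_of_left ha hsum hk1 hz2)
        have := hleft hk1
        omega
      by_cases hk2 : k2 = k
      · have := height_le_of_edge (edge_of_right ha hsum hk2 hz1)
        have := hright hk2
        omega
      have := hinner hk1 hk2
      omega
    · obtain ⟨e, he⟩ := exists_ret hcyc
      refine ⟨?_, (hN.growsPoly_cycle he ht ?_ h1 h2).anti h⟩
      · by_cases hk1 : k1 = k
        · have := hN.height_lt_of_edge (edge_of_left ha hsum hk1 hz2) (fun h => hn1 ⟨hk1, h⟩)
          have := hleft hk1
          omega
        by_cases hk2 : k2 = k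
        · have := hN.height_lt_of_edge (edge_of_right ha hsum hk2 hz1) (fun h => hn2 ⟨hk2, h⟩)
          have := hright hk2
          omega
        have := hinner hk1 hk2
        omega
      · intro heq
        obtain ⟨τ, hτ, hr⟩ := he
        obtain ⟨t, -, ht', hor, -⟩ := hN.edge (k := k) hτ
        rw [← heq] at ht'
        subst ht'
        rcases hor with ⟨h3, h4⟩ | ⟨h3, h4⟩
        · exact hn1 ⟨h3, h4 ▸ hr⟩
        · exact hn2 ⟨h3, h4 ▸ hr⟩

theorem A_of_one_le {V σ k M : ℕ} (h : 1 ≤ N σ k M) : G.A V σ k 0 := by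
  induction M generalizing σ k with
  | zero =>
    have h1 := h.trans (hN.zero_le σ k)
    by_cases hc : k = 0 ∧ G.init σ
    · obtain ⟨rfl, hi⟩ := hc
      exact .zero (.init hi)
    · rw [RAM.ind_of_not hc] at h1; omega
  | succ M ih =>
    rcases Nat.eq_zero_or_pos k with rfl | hk
    · exact .zero (hN.Z_iff.mpr ⟨_, h⟩)
    have h1 := h.trans (hN.succ_le σ k M)
    rw [RAM.ind_of_not (by omega), zero_add] at h1
    obtain ⟨⟨l, k1, k2⟩, ht, hne⟩ := Finset.exists_ne_zero_of_sum_ne_zero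
      (Nat.one_le_iff_ne_zero.mp h1)
    obtain ⟨ha, hs⟩ := (mem_terms hN).mp ht
    exact .rule ha hk hs (ih (Nat.pos_of_ne_zero (left_ne_zero_of_mul hne)))
      (ih (Nat.pos_of_ne_zero (right_ne_zero_of_mul hne))) (Nat.zero_le _) (by simp)

end Counts

open Classical in
/-- The largest `v` with `A V σ k v`. -/
noncomputable def deg (G : Grammar) (V σ k : ℕ) : ℕ := Nat.findGreatest (G.A V σ k) V

theorem A.le_deg {V σ k v : ℕ} (h : G.A V σ k v) : v ≤ G.deg V σ k := by
  classical
  exact Nat.le_findGreatest h.le_cap h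

theorem A.deg_spec {V σ k : ℕ} (h : G.A V σ k 0) : G.A V σ k (G.deg V σ k) := by
  classical
  exact Nat.findGreatest_spec (P := G.A V σ k) (Nat.zero_le _) h

/-- The degrees in a derivation step, if there is no exponential growth. -/
theorem deg_step {V σ l k k1 k2 : ℕ} (hk : 0 < k) (hA : ¬ G.A V σ k V)
    (ha : G.act σ l) (hs : k1 + k2 + G.dl σ l = k)
    (h1 : G.A V (G.f1 σ l) k1 0) (h2 : G.A V (G.f2 σ l) k2 0) :
    ¬ G.Bad σ ∧ ¬ G.A V (G.f1 σ l) k1 V ∧ ¬ G.A V (G.f2 σ l) k2 V ∧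
      G.deg V (G.f1 σ l) k1 + G.deg V (G.f2 σ l) k2 ≤ G.deg V σ k ∧
      (G.R σ σ → ¬ (k1 = k ∧ G.R (G.f1 σ l) σ) → ¬ (k2 = k ∧ G.R (G.f2 σ l) σ) →
        G.deg V (G.f1 σ l) k1 + G.deg V (G.f2 σ l) k2 + 1 ≤ G.deg V σ k) := by
  have hlt : G.deg V (G.f1 σ l) k1 + G.deg V (G.f2 σ l) k2 < V := by
    by_contra hc
    exact hA (.rule ha hk hs h1.deg_spec h2.deg_spec le_rfl (Or.inr (Or.inl (by omega))))
  refine ⟨fun hb => hA (.rule ha hk hs h1.deg_spec h2.deg_spec le_rfl (Or.inl hb)),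
    fun h => ?_, fun h => ?_, ?_, fun hc hn1 hn2 => ?_⟩
  · have := h.le_deg; omega
  · have := h.le_deg; omega
  · exact (A.rule ha hk hs h1.deg_spec h2.deg_spec hlt.le (Or.inr (Or.inl le_rfl))).le_deg
  · exact (A.rule ha hk hs h1.deg_spec h2.deg_spec hlt
      (Or.inr (Or.inr ⟨le_rfl, hc, hn1, hn2⟩))).le_deg

namespace Counts

variable (hN : G.Counts N)
include hN

/-- The induction step for the upper bound: if the growth in the degrees up to `k` is bounded, then so
is the growth in degree `k + 1`. The constant grows with the height of the nonterminal. On a cycle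
the constant remains the same, and the exponent drops by one when the cycle is left. -/
theorem upper_step {V k K : ℕ} (hK : 1 ≤ K)
    (ih : ∀ k' ≤ k, ∀ σ, ¬ G.A V σ k' V → ∀ M, N σ k' M ≤ K * (M + 1) ^ G.deg V σ k')
    {Q : ℕ} (hQ : Q = (G.NL * ((k + 2) * (k + 2)) + 1) * (K * K)) (M : ℕ) :
    ∀ σ, ¬ G.A V σ (k + 1) V →
      N σ (k + 1) M ≤ Q ^ G.height σ * (M + 1) ^ G.deg V σ (k + 1) := by
  have hQ1 : 1 ≤ Q := by rw [hQ]; exact Nat.one_le_iff_ne_zero.mpr (by positivity)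
  induction M with
  | zero =>
    intro σ _
    have := hN.zero_le σ (k + 1)
    rw [RAM.ind_of_not (by omega)] at this
    omega
  | succ M ihM =>
    intro σ hA
    classical
    have hle := hN.succ_le σ (k + 1) M
    rw [RAM.ind_of_not (by omega), zero_add] at hle
    set c := G.deg V σ (k + 1) with hc
    let stay : ℕ × ℕ × ℕ → Prop := fun t =>
      (t.2.1 = k + 1 ∧ G.R (G.f1 σ t.1) σ) ∨ (t.2.2 = k + 1 ∧ G.R (G.f2 σ t.1) σ)
    let F : ℕ × ℕ × ℕ → ℕ := fun t => N (G.f1 σ t.1) t.2.1 M * N (G.f2 σ t.1) t.2.2 M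
    have hpos : ∀ t ∈ G.terms σ (k + 1), F t ≠ 0 →
        1 ≤ N (G.f1 σ t.1) t.2.1 M ∧ 1 ≤ N (G.f2 σ t.1) t.2.2 M := fun t _ hne =>
      ⟨Nat.pos_of_ne_zero (left_ne_zero_of_mul hne),
        Nat.pos_of_ne_zero (right_ne_zero_of_mul hne)⟩
    have hN1 : ∀ σ M, N σ 0 M ≤ 1 := hN.zero_le_one
    have hstep : ∀ t ∈ G.terms σ (k + 1), F t ≠ 0 → _ := fun t ht hne =>
      deg_step (show 0 < k + 1 from Nat.succ_pos k) hA ((mem_terms hN).mp ht).1 ((mem_terms hN).mp ht).2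
        (hN.A_of_one_le (hpos t ht hne).1) (hN.A_of_one_le (hpos t ht hne).2)
    have hzero : ∀ {σ' k'}, 1 ≤ N σ' k' M → k' = 0 → G.Z σ' := by
      rintro σ' k' h rfl
      exact hN.Z_iff.mpr ⟨M, h⟩
    have hedge : ∀ t ∈ G.terms σ (k + 1), F t ≠ 0 →
        (t.2.1 = k + 1 → G.Edge σ (2 * t.1) (G.f1 σ t.1)) ∧
        (t.2.2 = k + 1 → G.Edge σ (2 * t.1 + 1) (G.f2 σ t.1)) := fun t ht hne =>
      ⟨fun h => edge_of_left ((mem_terms hN).mp ht).1 ((mem_terms hN).mp ht).2 h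
        (hzero (hpos t ht hne).2), fun h => edge_of_right ((mem_terms hN).mp ht).1
          ((mem_terms hN).mp ht).2 h (hzero (hpos t ht hne).1)⟩
    -- The terms that leave the cycle (if there is one).
    have hleave : ∀ t ∈ G.terms σ (k + 1), F t ≠ 0 → ¬ stay t → ∀ w,
        G.deg V (G.f1 σ t.1) t.2.1 + G.deg V (G.f2 σ t.1) t.2.2 ≤ w →
        F t ≤ K * K * Q ^ (G.height σ - 1) * (M + 1) ^ w := by
      rintro ⟨l, k1, k2⟩ ht hne hst w hw
      obtain ⟨ha, hs⟩ := (mem_terms hN).mp ht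
      obtain ⟨-, hA1, hA2, -, -⟩ := hstep _ ht hne
      have hp := hpos _ ht hne
      have he := hedge _ ht hne
      simp only [stay, not_or, not_and] at hst
      simp only [F] at hst hp he hw ⊢
      have hM1 : 1 ≤ M + 1 := by omega
      have hQh : 1 ≤ Q ^ (G.height σ - 1) := Nat.one_le_pow _ _ hQ1
      by_cases hk1 : k1 = k + 1
      · have hk2 : k2 = 0 := by omega
        have hh := hN.height_lt_of_edge (he.1 hk1) (hst.1 hk1)
        subst hk1 hk2
        calc _ ≤ Q ^ G.height (G.f1 σ l) * (M + 1) ^ G.deg V (G.f1 σ l) (k + 1) * 1 :=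
              Nat.mul_le_mul (ihM _ hA1) (hN1 _ _)
          _ ≤ Q ^ (G.height σ - 1) * (M + 1) ^ w * 1 := by
              gcongr
              · omega
              · omega
          _ ≤ K * K * Q ^ (G.height σ - 1) * (M + 1) ^ w := by
              rw [mul_one, mul_assoc (K * K)]
              exact Nat.le_mul_of_pos_left _ (by positivity)
      by_cases hk2 : k2 = k + 1
      · have hk1 : k1 = 0 := by omega
        have hh := hN.height_lt_of_edge (he.2 hk2) (hst.2 hk2)
        subst hk1 hk2
        calc _ ≤ 1 * (Q ^ G.height (G.f2 σ l) * (M + 1) ^ G.deg V (G.f2 σ l) (k + 1)) :=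
              Nat.mul_le_mul (hN1 _ _) (ihM _ hA2)
          _ ≤ 1 * (Q ^ (G.height σ - 1) * (M + 1) ^ w) := by
              gcongr
              · omega
              · omega
          _ ≤ K * K * Q ^ (G.height σ - 1) * (M + 1) ^ w := by
              rw [one_mul, mul_assoc (K * K)]
              exact Nat.le_mul_of_pos_left _ (by positivity)
      calc _ ≤ (K * (M + 1) ^ G.deg V (G.f1 σ l) k1) * (K * (M + 1) ^ G.deg V (G.f2 σ l) k2) :=
            Nat.mul_le_mul (ih k1 (by omega) _ hA1 M) (ih k2 (by omega) _ hA2 M)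
        _ = K * K * 1 * (M + 1) ^ (G.deg V (G.f1 σ l) k1 + G.deg V (G.f2 σ l) k2) := by ring
        _ ≤ K * K * Q ^ (G.height σ - 1) * (M + 1) ^ w := by gcongr
    -- At most one term stays on the cycle.
    have hcyc : ∀ t ∈ G.terms σ (k + 1), F t ≠ 0 → stay t → G.R σ σ := by
      rintro t ht hne (⟨h1, h2⟩ | ⟨h1, h2⟩)
      · exact .head ⟨_, (hedge t ht hne).1 h1⟩ h2
      · exact .head ⟨_, (hedge t ht hne).2 h1⟩ h2
    have hstay : ∀ t ∈ G.terms σ (k + 1), F t ≠ 0 → stay t →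
        F t ≤ Q ^ G.height σ * (M + 1) ^ c := by
      rintro ⟨l, k1, k2⟩ ht hne hst
      obtain ⟨ha, hs⟩ := (mem_terms hN).mp ht
      obtain ⟨-, hA1, hA2, hd, -⟩ := hstep _ ht hne
      have he := hedge _ ht hne
      simp only [stay, F] at hst he hd ⊢
      rcases hst with ⟨hk1, hr⟩ | ⟨hk2, hr⟩
      · have hk2 : k2 = 0 := by omega
        have hh := height_le_of_edge (he.1 hk1)
        subst hk1 hk2
        calc _ ≤ Q ^ G.height (G.f1 σ l) * (M + 1) ^ G.deg V (G.f1 σ l) (k + 1) * 1 :=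
              Nat.mul_le_mul (ihM _ hA1) (hN1 _ _)
          _ ≤ Q ^ (G.height σ) * (M + 1) ^ c * 1 := by
              gcongr
              · omega
              · omega
          _ = _ := mul_one _
      · have hk1 : k1 = 0 := by omega
        have hh := height_le_of_edge (he.2 hk2)
        subst hk1 hk2
        calc _ ≤ 1 * (Q ^ G.height (G.f2 σ l) * (M + 1) ^ G.deg V (G.f2 σ l) (k + 1)) :=
              Nat.mul_le_mul (hN1 _ _) (ihM _ hA2)
          _ ≤ 1 * (Q ^ (G.height σ) * (M + 1) ^ c) := by
              gcongr
              · omega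
              · omega
          _ = _ := one_mul _
    have huniq : ∀ t ∈ G.terms σ (k + 1), F t ≠ 0 → stay t →
        ∀ t' ∈ G.terms σ (k + 1), F t' ≠ 0 → stay t' → t = t' := by
      have hret : ∀ t ∈ G.terms σ (k + 1), F t ≠ 0 → stay t → ∃ e, G.Ret σ e ∧
          t = (if e % 2 = 0 then (e / 2, k + 1, 0) else (e / 2, 0, k + 1)) := by
        rintro ⟨l, k1, k2⟩ ht hne hst
        obtain ⟨ha, hs⟩ := (mem_terms hN).mp ht
        have he := hedge _ ht hne
        simp only [stay] at hst he
        rcases hst with ⟨hk1, hr⟩ | ⟨hk2, hr⟩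
        · refine ⟨2 * l, ⟨_, he.1 hk1, hr⟩, ?_⟩
          rw [if_pos (by omega)]
          simp only [Prod.mk.injEq]; omega
        · refine ⟨2 * l + 1, ⟨_, he.2 hk2, hr⟩, ?_⟩
          rw [if_neg (by omega)]
          simp only [Prod.mk.injEq]; omega
      intro t ht hne hst t' ht' hne' hst'
      obtain ⟨e, he, rfl⟩ := hret t ht hne hst
      obtain ⟨e', he', rfl⟩ := hret t' ht' hne' hst'
      have hnb := (hstep _ ht hne).1
      rcases lt_trichotomy e e' with h | rfl | h
      · exact absurd ⟨e, e', h, he, he'⟩ hnb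
      · rfl
      · exact absurd ⟨e', e, h, he', he⟩ hnb
    have hsplit : ∑ t ∈ G.terms σ (k + 1), F t =
        ∑ t ∈ (G.terms σ (k + 1)).filter (fun t => F t ≠ 0 ∧ stay t), F t +
        ∑ t ∈ (G.terms σ (k + 1)).filter (fun t => F t ≠ 0 ∧ ¬ stay t), F t := by
      rw [Finset.sum_filter, Finset.sum_filter, ← Finset.sum_add_distrib]
      refine Finset.sum_congr rfl fun t _ => ?_
      by_cases h1 : F t = 0 <;> by_cases h2 : stay t <;> simp [h1, h2]
    have hcard : ((G.terms σ (k + 1)).filter (fun t => F t ≠ 0 ∧ ¬ stay t)).card ≤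
        G.NL * ((k + 2) * (k + 2)) + 1 := by
      refine (Finset.card_filter_le _ _).trans ((Finset.card_filter_le _ _).trans ?_)
      simp only [Finset.card_product, Finset.card_range]
      exact Nat.le_succ _
    have hS : ∑ t ∈ (G.terms σ (k + 1)).filter (fun t => F t ≠ 0 ∧ stay t), F t ≤
        Q ^ G.height σ * (M + 1) ^ c := by
      have hc1 : ((G.terms σ (k + 1)).filter (fun t => F t ≠ 0 ∧ stay t)).card ≤ 1 := by
        rw [Finset.card_le_one]
        intro t ht t' ht'
        rw [Finset.mem_filter] at ht ht'
        exact huniq t ht.1 ht.2.1 ht.2.2 t' ht'.1 ht'.2.1 ht'.2.2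
      calc _ ≤ ((G.terms σ (k + 1)).filter (fun t => F t ≠ 0 ∧ stay t)).card •
            (Q ^ G.height σ * (M + 1) ^ c) := Finset.sum_le_card_nsmul _ _ _ fun t ht => by
              rw [Finset.mem_filter] at ht
              exact hstay t ht.1 ht.2.1 ht.2.2
        _ ≤ _ := by
          rw [smul_eq_mul]
          exact (Nat.mul_le_mul_right _ hc1).trans (by rw [one_mul])
    have hL : ∀ w, (∀ t ∈ G.terms σ (k + 1), F t ≠ 0 → ¬ stay t →
        G.deg V (G.f1 σ t.1) t.2.1 + G.deg V (G.f2 σ t.1) t.2.2 ≤ w) →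
        ∑ t ∈ (G.terms σ (k + 1)).filter (fun t => F t ≠ 0 ∧ ¬ stay t), F t ≤
          Q ^ G.height σ * (M + 1) ^ w := by
      intro w hw
      rcases Finset.eq_empty_or_nonempty
        ((G.terms σ (k + 1)).filter (fun t => F t ≠ 0 ∧ ¬ stay t)) with he | ⟨t0, ht0⟩
      · rw [he]; simp
      have hh : 0 < G.height σ := by
        rw [Finset.mem_filter] at ht0
        exact hN.height_pos ((mem_terms hN).mp ht0.1).1
      calc _ ≤ ((G.terms σ (k + 1)).filter (fun t => F t ≠ 0 ∧ ¬ stay t)).card •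
            (K * K * Q ^ (G.height σ - 1) * (M + 1) ^ w) :=
              Finset.sum_le_card_nsmul _ _ _ fun t ht => by
                rw [Finset.mem_filter] at ht
                exact hleave t ht.1 ht.2.1 ht.2.2 w (hw t ht.1 ht.2.1 ht.2.2)
        _ ≤ (G.NL * ((k + 2) * (k + 2)) + 1) * (K * K * Q ^ (G.height σ - 1) * (M + 1) ^ w) := by
          rw [smul_eq_mul]
          exact Nat.mul_le_mul_right _ hcard
        _ = Q * Q ^ (G.height σ - 1) * (M + 1) ^ w := by rw [hQ]; ring
        _ = Q ^ G.height σ * (M + 1) ^ w := by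
          rw [← pow_succ', Nat.sub_add_cancel hh]
    refine hle.trans ?_
    change ∑ t ∈ G.terms σ (k + 1), F t ≤ _
    rw [hsplit]
    by_cases hR : G.R σ σ
    · by_cases hall : ∀ t ∈ G.terms σ (k + 1), F t ≠ 0 → stay t
      · rw [Finset.filter_false_of_mem (s := G.terms σ (k + 1)) (p := fun t => F t ≠ 0 ∧ ¬ stay t)
          fun t ht h => h.2 (hall t ht h.1), Finset.sum_empty, add_zero]
        exact hS.trans (by gcongr; omega)
      · push Not at hall
        obtain ⟨t0, ht0, hne0, hst0⟩ := hall
        have hbon : ∀ t ∈ G.terms σ (k + 1), F t ≠ 0 → ¬ stay t →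
            G.deg V (G.f1 σ t.1) t.2.1 + G.deg V (G.f2 σ t.1) t.2.2 + 1 ≤ c := by
          intro t ht hne hst
          simp only [stay, not_or] at hst
          exact (hstep t ht hne).2.2.2.2 hR hst.1 hst.2
        have hc1 := hbon t0 ht0 hne0 hst0
        obtain ⟨w, hw⟩ : ∃ w, c = w + 1 := ⟨c - 1, by omega⟩
        have hL' := hL w fun t ht hne hst => by have := hbon t ht hne hst; omega
        rw [hw] at hS ⊢
        calc _ ≤ Q ^ G.height σ * (M + 1) ^ (w + 1) + Q ^ G.height σ * (M + 1) ^ w :=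
              Nat.add_le_add hS hL'
          _ = Q ^ G.height σ * ((M + 1) ^ w * (M + 1 + 1)) := by ring
          _ ≤ Q ^ G.height σ * ((M + 1 + 1) ^ w * (M + 1 + 1)) := by gcongr; omega
          _ = _ := by rw [← pow_succ]
    · rw [Finset.filter_false_of_mem (s := G.terms σ (k + 1)) (p := fun t => F t ≠ 0 ∧ stay t)
          fun t ht h => hR (hcyc t ht h.1 h.2), Finset.sum_empty, zero_add]
      refine (hL c fun t ht hne hst => (hstep t ht hne).2.2.2.1).trans ?_
      gcongr; omega

theorem upper {V : ℕ} (k : ℕ) : ∃ K, 1 ≤ K ∧ ∀ k' ≤ k, ∀ σ, ¬ G.A V σ k' V →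
    ∀ M, N σ k' M ≤ K * (M + 1) ^ G.deg V σ k' := by
  induction k with
  | zero =>
    refine ⟨1, le_rfl, fun k' hk' σ _ M => ?_⟩
    obtain rfl : k' = 0 := by omega
    rw [one_mul]
    exact (hN.zero_le_one σ M).trans (Nat.one_le_pow _ _ (by omega))
  | succ k ih =>
    obtain ⟨K, hK, ih⟩ := ih
    set Q := (G.NL * ((k + 2) * (k + 2)) + 1) * (K * K) with hQ
    have hQ1 : 1 ≤ Q := Nat.one_le_iff_ne_zero.mpr (by positivity)
    refine ⟨K + Q ^ G.NV, by omega, fun k' hk' σ hA M => ?_⟩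
    rcases Nat.lt_or_ge k k' with h | h
    · obtain rfl : k' = k + 1 := by omega
      refine (hN.upper_step hK ih hQ M σ hA).trans (Nat.mul_le_mul_right _ ?_)
      exact (Nat.pow_le_pow_right hQ1 (height_le G σ)).trans (Nat.le_add_left _ _)
    · exact (ih k' h σ hA M).trans (Nat.mul_le_mul_right _ (Nat.le_add_right _ _))

theorem eq_zero {V σ k : ℕ} (h : ∀ v, ¬ G.A V σ k v) (M : ℕ) : N σ k M = 0 := by
  by_contra hc
  exact h 0 (hN.A_of_one_le (Nat.one_le_iff_ne_zero.mpr hc))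

theorem growsExp {V σ k : ℕ} (hk : 0 < k) (hV : 2 * k * (G.NV + 1) < V) (h : G.A V σ k V) :
    GrowsExp (N σ k) := by
  rcases hN.lower h with h | ⟨-, h | ⟨h, -⟩⟩
  · omega
  · exact h
  · have h1 := height_le G σ
    obtain ⟨j, rfl⟩ : ∃ j, k = j + 1 := ⟨k - 1, by omega⟩
    simp only [Nat.add_sub_cancel] at h
    nlinarith

theorem growsPoly {V σ k v : ℕ} (hk : 0 < k) (h : G.A V σ k v) :
    GrowsExp (N σ k) ∨ GrowsPoly (N σ k) v := by
  rcases hN.lower h with h | ⟨-, h | ⟨-, h⟩⟩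
  · omega
  · exact Or.inl h
  · exact Or.inr h

theorem boundedPoly {V σ k v : ℕ} (h : ¬ G.A V σ k V)
    (hv : ∀ w, G.A V σ k w → w ≤ v) : BoundedPoly (N σ k) v := by
  by_cases h0 : G.A V σ k 0
  · obtain ⟨K, -, hK⟩ := hN.upper k
    refine ⟨K, fun M => (hK k le_rfl σ h M).trans ?_⟩
    gcongr
    · omega
    · exact hv _ h0.deg_spec
  · refine ⟨0, fun M => ?_⟩
    by_contra hc
    exact h0 (hN.A_of_one_le (M := M) (by omega))

end Counts

end Grammar

/-! ### Tables of least fixed points -/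

namespace RAM

/-- The heap `h` with its table `t` replaced by the characteristic function of `S`. The cell `c` of
table `t` is the cell `4 * c + t` of the heap, so that there are four infinite tables. -/
noncomputable def setTab (h : ℕ → ℕ) (t : ℕ) (S : ℕ → Prop) : ℕ → ℕ := fun j =>
  if j % 4 = t then ind (S (j / 4)) else h j

theorem setTab_self {h : ℕ → ℕ} {t : ℕ} (ht : t < 4) {S : ℕ → Prop} (c : ℕ) :
    setTab h t S (4 * c + t) ≠ 0 ↔ S c := by
  have h1 : (4 * c + t) % 4 = t := by omega
  have h2 : (4 * c + t) / 4 = c := by omega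
  simp [setTab, h1, h2, ind]

theorem setTab_of_ne {h : ℕ → ℕ} {t t' : ℕ} (ht : t' < 4) (hne : t' ≠ t) {S : ℕ → Prop} (c : ℕ) :
    setTab h t S (4 * c + t') = h (4 * c + t') := by
  have h1 : (4 * c + t') % 4 = t' := by omega
  simp [setTab, h1, hne]

/-- The least set of numbers below `B` that is closed under the rule `Ψ`. -/
def Lfp (B : ℕ) (Ψ : (ℕ → Prop) → ℕ → Prop) (c : ℕ) : Prop :=
  ∀ Q : ℕ → Prop, (∀ c < B, Ψ Q c → Q c) → Q c

/-- Apply the rule to the numbers below `i` one after the other. -/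
def sweep (Ψ : (ℕ → Prop) → ℕ → Prop) (S : ℕ → Prop) : ℕ → ℕ → Prop
  | 0 => S
  | c + 1 => fun j => sweep Ψ S c j ∨ (j = c ∧ Ψ (sweep Ψ S c) c)

/-- The result of `i` sweeps over the numbers below `B`, starting from the empty set. -/
def sweeps (Ψ : (ℕ → Prop) → ℕ → Prop) (B : ℕ) : ℕ → ℕ → Prop
  | 0 => fun _ => False
  | i + 1 => sweep Ψ (sweeps Ψ B i) B

section
variable {Ψ : (ℕ → Prop) → ℕ → Prop}

theorem le_sweep (S : ℕ → Prop) (i : ℕ) : ∀ c, S c → sweep Ψ S i c := by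
  induction i with
  | zero => exact fun _ h => h
  | succ i ih => exact fun c h => Or.inl (ih c h)

theorem sweep_mono (S : ℕ → Prop) {i j : ℕ} (h : i ≤ j) : ∀ c, sweep Ψ S i c → sweep Ψ S j c := by
  induction h with
  | refl => exact fun _ h => h
  | step _ ih => exact fun c h => Or.inl (ih c h)

theorem sweep_le (hΨ : ∀ S T : ℕ → Prop, (∀ c, S c → T c) → ∀ c, Ψ S c → Ψ T c) {B : ℕ}
    {S Q : ℕ → Prop} (hQ : ∀ c < B, Ψ Q c → Q c) (hS : ∀ c, S c → Q c) {i : ℕ} (hi : i ≤ B) :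
    ∀ c, sweep Ψ S i c → Q c := by
  induction i with
  | zero => exact hS
  | succ i ih =>
    rintro c (h | ⟨rfl, h⟩)
    · exact ih (by omega) c h
    · exact hQ c (by omega) (hΨ _ _ (ih (by omega)) _ h)

/-- After `B` sweeps the set is closed: every sweep before adds an element, and there are only `B`
numbers below `B`. -/
theorem sweeps_eq_Lfp (hΨ : ∀ S T : ℕ → Prop, (∀ c, S c → T c) → ∀ c, Ψ S c → Ψ T c) (B : ℕ) :
    sweeps Ψ B B = Lfp B Ψ := by
  classical
  have hle : ∀ (Q : ℕ → Prop), (∀ c < B, Ψ Q c → Q c) → ∀ i c, sweeps Ψ B i c → Q c := by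
    intro Q hQ i
    induction i with
    | zero => exact fun _ h => h.elim
    | succ i ih => exact sweep_le hΨ hQ ih le_rfl
  have key : ∀ i, (∀ c < B, Ψ (sweeps Ψ B i) c → sweeps Ψ B i c) ∨
      i ≤ ((Finset.range B).filter (sweeps Ψ B i)).card := by
    intro i
    induction i with
    | zero => exact Or.inr (Nat.zero_le _)
    | succ i ih =>
      by_cases hc : ∀ c < B, Ψ (sweeps Ψ B i) c → sweeps Ψ B i c
      · left
        have : sweeps Ψ B (i + 1) = sweeps Ψ B i := funext fun c => propext
          ⟨sweep_le hΨ hc (fun _ h => h) le_rfl c, le_sweep _ _ c⟩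
        rwa [this]
      · right
        have h1 := ih.resolve_left hc
        push Not at hc
        obtain ⟨c, hcB, h2, h3⟩ := hc
        refine Nat.succ_le_of_lt (h1.trans_lt (Finset.card_lt_card ?_))
        rw [Finset.ssubset_iff_of_subset]
        · refine ⟨c, ?_, by simp [h3]⟩
          simp only [Finset.mem_filter, Finset.mem_range]
          exact ⟨hcB, sweep_mono _ (Nat.succ_le_of_lt hcB) c
            (Or.inr ⟨rfl, hΨ _ _ (le_sweep _ _) _ h2⟩)⟩
        · intro c hc
          simp only [Finset.mem_filter, Finset.mem_range] at hc ⊢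
          exact ⟨hc.1, le_sweep _ _ c hc.2⟩
  have hcl : ∀ c < B, Ψ (sweeps Ψ B B) c → sweeps Ψ B B c := by
    rcases key B with h | h
    · exact h
    · intro c hc _
      have h2 : (Finset.range B).filter (sweeps Ψ B B) = Finset.range B :=
        Finset.eq_of_subset_of_card_le (Finset.filter_subset _ _) (by simpa using h)
      have h3 : c ∈ (Finset.range B).filter (sweeps Ψ B B) := by rw [h2]; simpa using hc
      exact (Finset.mem_filter.mp h3).2
  funext c
  exact propext ⟨fun h Q hQ => hle Q hQ B c h, fun h => h _ hcl⟩

theorem Lfp.closed (hΨ : ∀ S T : ℕ → Prop, (∀ c, S c → T c) → ∀ c, Ψ S c → Ψ T c) {B c : ℕ}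
    (hc : c < B) (h : Ψ (Lfp B Ψ) c) : Lfp B Ψ c := fun Q hQ =>
  hQ c hc (hΨ _ _ (fun _ h => h Q hQ) c h)

end

/-- A rule for the generation of table `t`: whether it yields the number `c` may depend on the
input, on a bound `B` and on the heap. -/
abbrev Rule := List ℕ → ℕ → (ℕ → ℕ) → ℕ → Prop

/-- A rule that can be evaluated in polynomial time. -/
def Rule.Computable (Φ : Rule) : Prop :=
  ∀ (Y : Type) (K : Ctx Y) (c : Y → ℕ), Cmp K c →
    CmpP K fun y => Φ (K.inp y) (K.bd y) (K.hp y) (c y)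

/-- The rule on sets that is induced by a rule for table `t` when the rest of the heap is `h`. -/
def Rule.on (Φ : Rule) (I : List ℕ) (B : ℕ) (h : ℕ → ℕ) (t : ℕ) (S : ℕ → Prop) (c : ℕ) : Prop :=
  Φ I B (setTab h t S) c

theorem update_setTab {h : ℕ → ℕ} {t : ℕ} (ht : t < 4) (S : ℕ → Prop) (c : ℕ) (p : Prop) :
    Function.update (setTab h t S) (4 * c + t) (ind (setTab h t S (4 * c + t) ≠ 0 ∨ p))
      = setTab h t fun j => S j ∨ (j = c ∧ p) := by
  funext j
  rw [setTab_self ht]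
  by_cases hj : j = 4 * c + t
  · subst hj
    have h1 : (4 * c + t) % 4 = t := by omega
    have h2 : (4 * c + t) / 4 = c := by omega
    simp [setTab, h1, h2]
  · rw [Function.update_of_ne hj]
    simp only [setTab]
    split_ifs with h1
    · have : j / 4 ≠ c := by omega
      simp [this]
    · rfl

/-- Tables of least fixed points are computable in polynomial time. -/
theorem HCmp.lfp {X : Type} {K : Ctx X} {Φ : Rule} (hΦ : Φ.Computable) {t : ℕ} (ht : t < 4)
    (h0 : ∀ x c, K.hp x (4 * c + t) = 0)
    (hmono : ∀ x (S T : ℕ → Prop), (∀ c, S c → T c) → ∀ c,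
      Φ.on (K.inp x) (K.bd x) (K.hp x) t S c → Φ.on (K.inp x) (K.bd x) (K.hp x) t T c) :
    HCmp K fun x => setTab (K.hp x) t (Lfp (K.bd x) (Φ.on (K.inp x) (K.bd x) (K.hp x) t)) := by
  have hz : ∀ x, setTab (K.hp x) t (fun _ => False) = K.hp x := by
    intro x
    funext j
    simp only [setTab]
    split_ifs with h
    · have := h0 x (j / 4)
      rw [show 4 * (j / 4) + t = j by omega] at this
      simp [ind, this]
    · rfl
  let Ψ : X → (ℕ → Prop) → ℕ → Prop := fun x => Φ.on (K.inp x) (K.bd x) (K.hp x) t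
  let H : X → ℕ → ℕ → ℕ := fun x i => setTab (K.hp x) t (sweeps (Ψ x) (K.bd x) i)
  have houter : HCmp (K.bind fun y => H y.1 y.2) fun y => H y.1 (y.2 + 1) := by
    set K1 := K.bind fun y => H y.1 y.2 with hK1
    let H' : X × ℕ → ℕ → ℕ → ℕ := fun y c =>
      setTab (K.hp y.1) t (sweep (Ψ y.1) (sweeps (Ψ y.1) (K.bd y.1) y.2) c)
    have hinner : HCmp (K1.bind fun y => H' y.1 y.2) fun y => H' y.1 (y.2 + 1) := by
      set K2 := K1.bind fun y => H' y.1 y.2 with hK2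
      have hc : Cmp K2 fun y => 4 * y.2 + t := ((Cmp.const 4).mul .last).add (.const t)
      have hv : CmpP K2 fun y => K2.hp y (4 * y.2 + t) ≠ 0 ∨
          Φ (K2.inp y) (K2.bd y) (K2.hp y) y.2 :=
        (CmpP.eq_zero (Cmp.heap hc)).not.or (hΦ _ K2 _ .last)
      exact (HCmp.store hc hv).congr fun y => update_setTab ht _ _ _
    exact HCmp.loop hinner
  have hfin := HCmp.loop houter
  have e1 : (K.setHeap fun x => H x 0) = K := by
    have : (fun x => H x 0) = K.hp := funext hz
    rw [this]; rfl
  rw [e1] at hfin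
  exact hfin.congr fun x => by
    simp only [H]
    rw [sweeps_eq_Lfp (hmono x)]

end RAM

/-! ### First returns in free groups -/

/-- The letters of the free group on `Fin n` as numbers: `n + 1 + i` stands for the generator `i`,
`n - 1 - i` for its inverse, and `n` (as well as every number beyond `2 * n`) for the empty word. -/
def codeWord (n c : ℕ) : List (Fin n × Bool) :=
  if h : n < c ∧ c ≤ 2 * n then [(⟨c - n - 1, by omega⟩, true)]
  else if h : c < n then [(⟨n - 1 - c, by omega⟩, false)]
  else []

/-- The element of the free group that a code represents. -/
def codeVal (n c : ℕ) : FreeGroup (Fin n) := FreeGroup.mk (codeWord n c)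

/-- The element of the free group that is spelled by `π` under the labelling `f` by codes. -/
def pathVal (n : ℕ) (f : ℕ → ℕ) (π : List ℕ) : FreeGroup (Fin n) :=
  (π.map fun s => codeVal n (f s)).prod

section
variable {n : ℕ} {f : ℕ → ℕ}

theorem codeVal_self : codeVal n n = 1 := by
  simp [codeVal, codeWord, FreeGroup.one_eq_mk]

theorem toWord_codeVal (c : ℕ) : (codeVal n c).toWord = codeWord n c := by
  rw [codeVal, FreeGroup.toWord_mk]
  unfold codeWord
  split_ifs <;> simp

theorem codeVal_inv {c : ℕ} (hc : c ≤ 2 * n) : codeVal n (2 * n - c) = (codeVal n c)⁻¹ := by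
  simp only [codeVal, FreeGroup.inv_mk, codeWord]
  rcases lt_trichotomy c n with h | rfl | h
  · rw [dif_pos (by omega), dif_neg (by omega), dif_pos h]
    simp only [FreeGroup.invRev, List.map_cons, List.map_nil, List.reverse_singleton, Bool.not_false]
    congr 4; omega
  · rw [dif_neg (by omega), dif_neg (by omega), dif_neg (by omega), dif_neg (by omega)]
    rfl
  · rw [dif_neg (by omega), dif_pos (by omega), dif_pos (by omega)]
    simp only [FreeGroup.invRev, List.map_cons, List.map_nil, List.reverse_singleton, Bool.not_true]
    congr 4; omega

theorem codeVal_injective {c d : ℕ} (hc : c ≤ 2 * n) (hd : d ≤ 2 * n)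
    (h : codeVal n c = codeVal n d) : c = d := by
  have h' := congrArg FreeGroup.toWord h
  rw [toWord_codeVal, toWord_codeVal] at h'
  unfold codeWord at h'
  split_ifs at h' <;> simp at h' <;> omega

theorem exists_codeWord {c : ℕ} (hc : c ≤ 2 * n) (hn : c ≠ n) : ∃ z, codeWord n c = [z] := by
  unfold codeWord
  split_ifs with h1 h2
  · exact ⟨_, rfl⟩
  · exact ⟨_, rfl⟩
  · omega

theorem codeWord_eq_of_append {c : ℕ} {w : List (Fin n × Bool)} {z : Fin n × Bool}
    (h : codeWord n c = w ++ [z]) : codeWord n c = [z] := by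
  have hlen : (codeWord n c).length ≤ 1 := by
    unfold codeWord; split_ifs <;> simp
  rw [h] at hlen ⊢
  have : w = [] := by simpa using hlen
  rw [this]; rfl

theorem toWord_letter_mul {x : FreeGroup (Fin n)} {w : List (Fin n × Bool)} {y z : Fin n × Bool}
    (hx : x.toWord = w ++ [z]) :
    FreeGroup.mk [y] * x = 1 ∨ ∃ w', (FreeGroup.mk [y] * x).toWord = w' ++ [z] := by
  have h1 : (FreeGroup.mk [y] * x).toWord = FreeGroup.reduce (y :: x.toWord) := by
    conv_lhs => rw [← FreeGroup.mk_toWord (x := x)]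
    rw [FreeGroup.mul_mk, FreeGroup.toWord_mk]; rfl
  rw [FreeGroup.reduce.cons, FreeGroup.reduce_toWord, hx] at h1
  cases w with
  | nil =>
    simp only [List.nil_append] at h1
    split_ifs at h1
    · left
      exact FreeGroup.toWord_eq_nil_iff.mp h1
    · exact Or.inr ⟨[y], h1⟩
  | cons a w =>
    simp only [List.cons_append] at h1
    split_ifs at h1
    · exact Or.inr ⟨w, h1⟩
    · exact Or.inr ⟨y :: a :: w, h1⟩

theorem pathVal_nil : pathVal n f [] = 1 := rfl

theorem pathVal_cons (s : ℕ) (π : List ℕ) :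
    pathVal n f (s :: π) = codeVal n (f s) * pathVal n f π := by
  simp [pathVal]

theorem pathVal_append (u v : List ℕ) :
    pathVal n f (u ++ v) = pathVal n f u * pathVal n f v := by
  simp [pathVal]

/-- In the Cayley tree: a path that starts with the edge `a` and does not return to its origin stays in
the branch behind this edge. -/
theorem toWord_branch {a : ℕ} (ha : a ≤ 2 * n) {z : Fin n × Bool}
    (hz : codeWord n (2 * n - a) = [z]) (u : List ℕ) (hu : ∀ s ∈ u, f s ≤ 2 * n)
    (hav : ∀ u', u' <+: u → pathVal n f u' ≠ (codeVal n a)⁻¹) :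
    ∃ w, (codeVal n a * pathVal n f u)⁻¹.toWord = w ++ [z] := by
  induction u using List.reverseRecOn with
  | nil =>
    refine ⟨[], ?_⟩
    rw [pathVal_nil, mul_one, ← codeVal_inv ha, toWord_codeVal, hz]; rfl
  | append_singleton u s ih =>
    obtain ⟨w, hw⟩ := ih (fun s hs => hu s (List.mem_append_left _ hs))
      (fun u' h => hav u' (h.trans (List.prefix_append _ _)))
    have hs : f s ≤ 2 * n := hu s (by simp)
    have hne := hav _ (List.prefix_refl _)
    have e : (codeVal n a * pathVal n f (u ++ [s]))⁻¹ =
        codeVal n (2 * n - f s) * (codeVal n a * pathVal n f u)⁻¹ := by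
      rw [codeVal_inv hs, pathVal_append, pathVal_cons, pathVal_nil]
      group
    rw [e]
    by_cases hfn : f s = n
    · rw [hfn, show 2 * n - n = n by omega, codeVal_self, one_mul]
      exact ⟨w, hw⟩
    · obtain ⟨y, hy⟩ := exists_codeWord (n := n) (c := 2 * n - f s) (by omega) (by omega)
      rw [codeVal, hy]
      refine (toWord_letter_mul hw).resolve_left fun h => hne ?_
      rw [← hy, ← codeVal, ← e] at h
      exact (eq_inv_of_mul_eq_one_right (inv_eq_one.mp h))

/-- A path that starts with the edge `a` and represents `1` returns to its origin for the first time
through the edge `a`. -/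
theorem exists_first_return {a : ℕ} (ha : a ≤ 2 * n) (han : a ≠ n) (π : List ℕ)
    (hπ : ∀ s ∈ π, f s ≤ 2 * n) (h1 : codeVal n a * pathVal n f π = 1) :
    ∃ u s v, π = u ++ s :: v ∧ f s + a = 2 * n ∧ pathVal n f u = 1 ∧
      ∀ u', u' <+: u → pathVal n f u' ≠ (codeVal n a)⁻¹ := by
  classical
  have hex : ∃ j, pathVal n f (π.take j) = (codeVal n a)⁻¹ :=
    ⟨π.length, by rw [List.take_length]; exact eq_inv_of_mul_eq_one_right h1⟩
  have hj := Nat.find_spec hex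
  have hmin := fun i => Nat.find_min (m := i) hex
  set j := Nat.find hex with hjdef
  have hne1 : codeVal n a ≠ 1 := fun h => han (codeVal_injective ha (by omega) (h.trans codeVal_self.symm))
  have hj0 : j ≠ 0 := by
    intro h0
    rw [h0, List.take_zero, pathVal_nil] at hj
    exact hne1 (inv_eq_one.mp hj.symm)
  have hjl : j - 1 < π.length := by
    by_contra hc
    refine hmin (j - 1) (by omega) ?_
    rw [← hj, List.take_of_length_le (by omega), List.take_of_length_le (by omega)]
  have htake : π.take j = π.take (j - 1) ++ [π[j - 1]] := by
    rw [← List.take_succ_eq_append_getElem hjl]; congr 1; omega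
  have hav : ∀ u', u' <+: π.take (j - 1) → pathVal n f u' ≠ (codeVal n a)⁻¹ := by
    intro u' hu' he
    have h2 : u' = π.take u'.length := by
      have := (hu'.trans (List.take_prefix _ _))
      exact List.prefix_iff_eq_take.mp this
    have h3 : u'.length ≤ j - 1 := hu'.length_le.trans (by simp)
    exact hmin u'.length (by omega) (h2 ▸ he)
  have hs : f π[j - 1] ≤ 2 * n := hπ _ (List.getElem_mem _)
  obtain ⟨z, hz⟩ := exists_codeWord (n := n) (c := 2 * n - a) (by omega) (by omega)
  obtain ⟨w, hw⟩ := toWord_branch ha hz (π.take (j - 1))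
    (fun s hs => hπ s (List.mem_of_mem_take hs)) hav
  rw [htake, pathVal_append, pathVal_cons, pathVal_nil, mul_one] at hj
  have h4 : (codeVal n a * pathVal n f (π.take (j - 1)))⁻¹ = codeVal n (f π[j - 1]) := by
    have : codeVal n a * pathVal n f (π.take (j - 1)) * codeVal n (f π[j - 1]) = 1 := by
      rw [mul_assoc, hj, mul_inv_cancel]
    exact inv_eq_of_mul_eq_one_right this
  have h5 : f π[j - 1] = 2 * n - a := by
    refine codeVal_injective hs (by omega) ?_
    rw [h4, toWord_codeVal] at hw
    rw [codeVal, codeVal, hz, codeWord_eq_of_append hw]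
  refine ⟨π.take (j - 1), π[j - 1], π.drop j, ?_, by omega, ?_, hav⟩
  · calc π = π.take j ++ π.drop j := (List.take_append_drop j π).symm
      _ = (π.take (j - 1) ++ [π[j - 1]]) ++ π.drop j := by rw [← htake]
      _ = _ := by rw [List.append_assoc]; rfl
  · rw [h5, codeVal_inv ha] at hj
    simpa using hj

end

/-! ### The grammar of the trivial paths of an automaton -/

/-- An automaton on the states `0, …, P - 1` whose transitions are labelled by their source. A state
`p` with `lt p ≠ n` has exactly one transition, to `p + 1`. A state with `lt p = n` has transitions
with the empty label to the states `l` with `ok p l`; these contribute `dg p` to the degree. -/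
structure Auto where
  n : ℕ
  P : ℕ
  lt : ℕ → ℕ
  ok : ℕ → ℕ → Prop
  dg : ℕ → ℕ

namespace Auto

/-- The conditions on an automaton. -/
structure Valid (𝒜 : Auto) : Prop where
  lt_le : ∀ {p}, p < 𝒜.P → 𝒜.lt p ≤ 2 * 𝒜.n
  next_lt : ∀ {p}, p < 𝒜.P → 𝒜.lt p ≠ 𝒜.n → p + 1 < 𝒜.P
  ok_lt : ∀ {p l}, p < 𝒜.P → 𝒜.ok p l → l < 𝒜.P
  dg_eq : ∀ {p}, p < 𝒜.P → 𝒜.lt p ≠ 𝒜.n → 𝒜.dg p = 0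

variable (𝒜 : Auto)

/-- There is a transition from `p` to `l`. -/
def Step (p l : ℕ) : Prop :=
  p < 𝒜.P ∧ ((𝒜.lt p = 𝒜.n ∧ 𝒜.ok p l) ∨ (𝒜.lt p ≠ 𝒜.n ∧ l = p + 1))

/-- `π` is the list of the sources of the transitions of a path from `p` to `q`. -/
def Path : ℕ → List ℕ → ℕ → Prop
  | p, [], q => p = q
  | p, s :: π, q => s = p ∧ ∃ p', 𝒜.Step p p' ∧ Path p' π q

/-- The element of the free group spelled by a path. -/
abbrev val (π : List ℕ) : FreeGroup (Fin 𝒜.n) := pathVal 𝒜.n 𝒜.lt π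

/-- The degree of a path. -/
def deg (π : List ℕ) : ℕ := (π.map 𝒜.dg).sum

/-- The paths of degree `k` from `p` to `q` that spell `1` and that do not pass through the letter
`b` of the Cayley tree. For `b = n` there is no such restriction. -/
def X (b p q k : ℕ) : Set (List ℕ) :=
  {π | 𝒜.Path p π q ∧ 𝒜.val π = 1 ∧ 𝒜.deg π = k ∧
    ∀ u, u <+: π → 𝒜.val u = codeVal 𝒜.n b → b = 𝒜.n}

/-- The number of the nonterminal for the paths in `X b p q`. -/
def enc (P b p q : ℕ) : ℕ := (b * (P + 1) + p) * (P + 1) + q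

/-- The grammar of the paths that spell `1`. A path that begins with an empty label is decomposed into
this transition and the rest, a path that begins with a letter is cut at its first return. There is
no transition from the state `P`, so that `enc n P P` derives the empty path only. -/
def grammar : Grammar where
  NV := (2 * 𝒜.n + 1) * (𝒜.P + 1) * (𝒜.P + 1)
  NL := 𝒜.P
  act σ l := σ < (2 * 𝒜.n + 1) * (𝒜.P + 1) * (𝒜.P + 1) ∧ l < 𝒜.P ∧
    σ / (𝒜.P + 1) % (𝒜.P + 1) < 𝒜.P ∧
    ((𝒜.lt (σ / (𝒜.P + 1) % (𝒜.P + 1)) = 𝒜.n ∧ 𝒜.ok (σ / (𝒜.P + 1) % (𝒜.P + 1)) l) ∨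
    (𝒜.lt (σ / (𝒜.P + 1) % (𝒜.P + 1)) ≠ 𝒜.n ∧
      𝒜.lt (σ / (𝒜.P + 1) % (𝒜.P + 1)) ≠ σ / (𝒜.P + 1) / (𝒜.P + 1) ∧
      𝒜.lt l + 𝒜.lt (σ / (𝒜.P + 1) % (𝒜.P + 1)) = 2 * 𝒜.n))
  f1 σ l := if 𝒜.lt (σ / (𝒜.P + 1) % (𝒜.P + 1)) = 𝒜.n then enc 𝒜.P 𝒜.n 𝒜.P 𝒜.P
    else enc 𝒜.P (𝒜.lt l) (σ / (𝒜.P + 1) % (𝒜.P + 1) + 1) l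
  f2 σ l := if 𝒜.lt (σ / (𝒜.P + 1) % (𝒜.P + 1)) = 𝒜.n
    then enc 𝒜.P (σ / (𝒜.P + 1) / (𝒜.P + 1)) l (σ % (𝒜.P + 1))
    else enc 𝒜.P (σ / (𝒜.P + 1) / (𝒜.P + 1)) (l + 1) (σ % (𝒜.P + 1))
  dl σ _ := if 𝒜.lt (σ / (𝒜.P + 1) % (𝒜.P + 1)) = 𝒜.n then 𝒜.dg (σ / (𝒜.P + 1) % (𝒜.P + 1)) else 0
  init σ := σ < (2 * 𝒜.n + 1) * (𝒜.P + 1) * (𝒜.P + 1) ∧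
    σ / (𝒜.P + 1) % (𝒜.P + 1) = σ % (𝒜.P + 1)

/-- The paths of length at most `M` that the nonterminal `σ` stands for. -/
def pathSet (σ k M : ℕ) : Set (List ℕ) :=
  {π | σ < 𝒜.grammar.NV ∧
    π ∈ 𝒜.X (σ / (𝒜.P + 1) / (𝒜.P + 1)) (σ / (𝒜.P + 1) % (𝒜.P + 1)) (σ % (𝒜.P + 1)) k ∧ π.length ≤ M}

/-- The number of these paths. -/
noncomputable def count (σ k M : ℕ) : ℕ := (𝒜.pathSet σ k M).ncard

theorem enc_lt {n P b p q : ℕ} (hb : b ≤ 2 * n) (hp : p ≤ P) (hq : q ≤ P) :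
    enc P b p q < (2 * n + 1) * (P + 1) * (P + 1) := by
  have h1 : b * (P + 1) + p < (2 * n + 1) * (P + 1) := by nlinarith
  unfold enc
  nlinarith

theorem enc_mod {P b p q : ℕ} (hq : q ≤ P) : enc P b p q % (P + 1) = q := by
  unfold enc
  rw [Nat.add_comm, Nat.add_mul_mod_self_right, Nat.mod_eq_of_lt (by omega)]

theorem enc_div {P b p q : ℕ} (hq : q ≤ P) : enc P b p q / (P + 1) = b * (P + 1) + p := by
  unfold enc
  rw [Nat.add_comm, Nat.add_mul_div_right _ _ (Nat.succ_pos P), Nat.div_eq_of_lt (by omega), zero_add]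

theorem enc_div_mod {P b p q : ℕ} (hp : p ≤ P) (hq : q ≤ P) :
    enc P b p q / (P + 1) % (P + 1) = p := by
  rw [enc_div hq, Nat.add_comm, Nat.add_mul_mod_self_right, Nat.mod_eq_of_lt (by omega)]

theorem enc_div_div {P b p q : ℕ} (hp : p ≤ P) (hq : q ≤ P) :
    enc P b p q / (P + 1) / (P + 1) = b := by
  rw [enc_div hq, Nat.add_comm, Nat.add_mul_div_right _ _ (Nat.succ_pos P),
    Nat.div_eq_of_lt (by omega), zero_add]

theorem exists_enc {n P σ : ℕ} (h : σ < (2 * n + 1) * (P + 1) * (P + 1)) :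
    ∃ b p q, b ≤ 2 * n ∧ p ≤ P ∧ q ≤ P ∧ σ = enc P b p q := by
  refine ⟨σ / (P + 1) / (P + 1), σ / (P + 1) % (P + 1), σ % (P + 1), ?_,
    Nat.le_of_lt_succ (Nat.mod_lt _ (Nat.succ_pos P)),
    Nat.le_of_lt_succ (Nat.mod_lt _ (Nat.succ_pos P)), ?_⟩
  · rw [Nat.div_div_eq_div_mul]
    have := Nat.div_lt_of_lt_mul (m := σ) (n := (P + 1) * (P + 1)) (k := 2 * n + 1) (by linarith)
    omega
  · unfold enc
    rw [Nat.div_add_mod' , Nat.div_add_mod']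

variable {𝒜}

theorem path_append {p q : ℕ} {u v : List ℕ} :
    𝒜.Path p (u ++ v) q ↔ ∃ m, 𝒜.Path p u m ∧ 𝒜.Path m v q := by
  induction u generalizing p with
  | nil => simp [Path]
  | cons s u ih =>
    simp only [List.cons_append, Path, ih]
    constructor
    · rintro ⟨rfl, p', h1, m, h2, h3⟩
      exact ⟨m, ⟨rfl, p', h1, h2⟩, h3⟩
    · rintro ⟨m, ⟨rfl, p', h1, h2⟩, h3⟩
      exact ⟨rfl, p', h1, m, h2, h3⟩

theorem Path.lt {p q : ℕ} {π : List ℕ} (h : 𝒜.Path p π q) : ∀ s ∈ π, s < 𝒜.P := by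
  induction π generalizing p with
  | nil => simp
  | cons s π ih =>
    obtain ⟨rfl, p', h1, h2⟩ := h
    intro t ht
    rcases List.mem_cons.mp ht with rfl | ht
    · exact h1.1
    · exact ih h2 t ht

theorem Path.eq_nil {q : ℕ} {π : List ℕ} (h : 𝒜.Path 𝒜.P π q) : π = [] := by
  cases π with
  | nil => rfl
  | cons s π =>
    obtain ⟨-, p', h1, -⟩ := h
    exact absurd h1.1 (lt_irrefl _)

theorem deg_append (u v : List ℕ) : 𝒜.deg (u ++ v) = 𝒜.deg u + 𝒜.deg v := by simp [deg]

theorem deg_cons (s : ℕ) (v : List ℕ) : 𝒜.deg (s :: v) = 𝒜.dg s + 𝒜.deg v := by simp [deg]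

theorem nil_mem_X {b p : ℕ} (hb : b ≤ 2 * 𝒜.n) : [] ∈ 𝒜.X b p p 0 := by
  refine ⟨rfl, pathVal_nil, rfl, fun u hu he => ?_⟩
  rw [List.prefix_nil.mp hu, val, pathVal_nil] at he
  exact codeVal_injective hb (by omega) (he.symm.trans codeVal_self.symm)

theorem X_subset (b p q k : ℕ) : 𝒜.X b p q k ⊆ 𝒜.X 𝒜.n p q k :=
  fun _ h => ⟨h.1, h.2.1, h.2.2.1, fun _ _ _ => rfl⟩

/-- The path that is composed of its first transition, the loop `u` up to the first return and the
rest `v`. -/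
def glue (𝒜 : Auto) (p l : ℕ) (u v : List ℕ) : List ℕ :=
  p :: if 𝒜.lt p = 𝒜.n then v else u ++ l :: v

theorem glue_of_eq {p l : ℕ} {u v : List ℕ} (h : 𝒜.lt p = 𝒜.n) : 𝒜.glue p l u v = p :: v := by
  simp [glue, h]

theorem glue_of_ne {p l : ℕ} {u v : List ℕ} (h : 𝒜.lt p ≠ 𝒜.n) :
    𝒜.glue p l u v = p :: (u ++ l :: v) := by
  simp [glue, h]

theorem length_glue_le (p l : ℕ) (u v : List ℕ) :
    (𝒜.glue p l u v).length ≤ u.length + v.length + 2 := by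
  unfold glue
  split_ifs <;> simp <;> omega

section
variable (h𝒜 : 𝒜.Valid)
include h𝒜

omit h𝒜 in
theorem glue_empty_mem {b p q l k : ℕ} {v : List ℕ} (hb : b ≤ 2 * 𝒜.n) (hp : p < 𝒜.P)
    (hn : 𝒜.lt p = 𝒜.n) (hok : 𝒜.ok p l) (hv : v ∈ 𝒜.X b l q k) :
    p :: v ∈ 𝒜.X b p q (k + 𝒜.dg p) := by
  obtain ⟨h1, h2, h3, h4⟩ := hv
  refine ⟨⟨rfl, l, ⟨hp, Or.inl ⟨hn, hok⟩⟩, h1⟩, ?_, ?_, fun u hu he => ?_⟩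
  · rw [val, pathVal_cons, hn, codeVal_self, one_mul]; exact h2
  · rw [deg_cons, h3, add_comm]
  · rcases List.prefix_cons_iff.mp hu with rfl | ⟨u', rfl, hu'⟩
    · rw [val, pathVal_nil] at he
      exact codeVal_injective hb (by omega) (he.symm.trans codeVal_self.symm)
    · rw [val, pathVal_cons, hn, codeVal_self, one_mul] at he
      exact h4 u' hu' he

theorem glue_letter_mem {b p q l k1 k2 : ℕ} {u v : List ℕ} (hb : b ≤ 2 * 𝒜.n) (hp : p < 𝒜.P)
    (hn : 𝒜.lt p ≠ 𝒜.n) (hpb : 𝒜.lt p ≠ b) (hl : l < 𝒜.P) (hlp : 𝒜.lt l + 𝒜.lt p = 2 * 𝒜.n)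
    (hu : u ∈ 𝒜.X (𝒜.lt l) (p + 1) l k1) (hv : v ∈ 𝒜.X b (l + 1) q k2) :
    p :: (u ++ l :: v) ∈ 𝒜.X b p q (k1 + k2) := by
  obtain ⟨h1, h2, h3, h4⟩ := hu
  obtain ⟨h1', h2', h3', h4'⟩ := hv
  have hln : 𝒜.lt l ≠ 𝒜.n := by omega
  have hinv : codeVal 𝒜.n (𝒜.lt l) = (codeVal 𝒜.n (𝒜.lt p))⁻¹ := by
    rw [← codeVal_inv (h𝒜.lt_le hp)]; congr 1; omega
  have hpl : ∀ w, 𝒜.val (p :: (u ++ l :: w)) = 𝒜.val w := fun w => by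
    simp only [val] at h2 ⊢
    rw [pathVal_cons, pathVal_append, h2, one_mul, pathVal_cons, hinv, mul_inv_cancel_left]
  refine ⟨⟨rfl, p + 1, ⟨hp, Or.inr ⟨hn, rfl⟩⟩, path_append.mpr ⟨l, h1, rfl, l + 1,
    ⟨hl, Or.inr ⟨hln, rfl⟩⟩, h1'⟩⟩, by rw [hpl, h2'], ?_, fun w hw he => ?_⟩
  · rw [deg_cons, deg_append, deg_cons, h3, h3', h𝒜.dg_eq hp hn, h𝒜.dg_eq hl hln]; omega
  · rcases List.prefix_cons_iff.mp hw with rfl | ⟨w', rfl, hw'⟩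
    · rw [val, pathVal_nil] at he
      exact codeVal_injective hb (by omega) (he.symm.trans codeVal_self.symm)
    · rcases List.prefix_or_prefix_of_prefix hw' (List.prefix_append u (l :: v)) with h | h
      · exfalso
        obtain ⟨z, hz⟩ := exists_codeWord (n := 𝒜.n) (c := 2 * 𝒜.n - 𝒜.lt p) (by omega)
          (by have := h𝒜.lt_le hp; omega)
        obtain ⟨y, hy⟩ := toWord_branch (f := 𝒜.lt) (h𝒜.lt_le hp) hz w'
          (fun s hs => h𝒜.lt_le (h1.lt s (h.subset hs)))
          (fun u' hu' he' => hln (h4 u' (hu'.trans h) (he'.trans hinv.symm)))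
        rw [val, pathVal_cons] at he
        rw [he, ← codeVal_inv hb, toWord_codeVal] at hy
        have : codeVal 𝒜.n (2 * 𝒜.n - b) = codeVal 𝒜.n (2 * 𝒜.n - 𝒜.lt p) := by
          rw [codeVal, codeVal, hz, codeWord_eq_of_append hy]
        have := codeVal_injective (by omega) (by omega) this
        have := h𝒜.lt_le hp
        omega
      · obtain ⟨t, rfl⟩ := h
        rw [List.prefix_append_right_inj] at hw'
        rcases List.prefix_cons_iff.mp hw' with rfl | ⟨t', rfl, ht'⟩
        · exfalso
          rw [List.append_nil, val, pathVal_cons, show pathVal 𝒜.n 𝒜.lt u = 1 from h2, mul_one] at he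
          exact hpb (codeVal_injective (h𝒜.lt_le hp) hb he)
        · exact h4' t' ht' (by rw [← hpl]; exact he)

theorem exists_glue {b p q k : ℕ} {π : List ℕ} (hπ : π ∈ 𝒜.X b p q k) :
    (π = [] ∧ p = q ∧ k = 0) ∨
    (∃ v l, π = p :: v ∧ p < 𝒜.P ∧ 𝒜.lt p = 𝒜.n ∧ 𝒜.ok p l ∧ ∃ k', k' + 𝒜.dg p = k ∧
      v ∈ 𝒜.X b l q k') ∨
    (∃ u l v k1 k2, π = p :: (u ++ l :: v) ∧ p < 𝒜.P ∧ 𝒜.lt p ≠ 𝒜.n ∧ 𝒜.lt p ≠ b ∧ l < 𝒜.P ∧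
      𝒜.lt l + 𝒜.lt p = 2 * 𝒜.n ∧ k1 + k2 = k ∧ u ∈ 𝒜.X (𝒜.lt l) (p + 1) l k1 ∧
      v ∈ 𝒜.X b (l + 1) q k2) := by
  obtain ⟨h1, h2, h3, h4⟩ := hπ
  cases π with
  | nil => exact Or.inl ⟨rfl, h1, h3.symm⟩
  | cons s π =>
    obtain ⟨rfl, p', ⟨hp, hs⟩, hpath⟩ := h1
    right
    rcases hs with ⟨hn, hok⟩ | ⟨hn, rfl⟩
    · left
      refine ⟨π, p', rfl, hp, hn, hok, 𝒜.deg π, by rw [deg_cons] at h3; omega, hpath, ?_, rfl, ?_⟩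
      · rwa [val, pathVal_cons, hn, codeVal_self, one_mul] at h2
      · intro u hu he
        refine h4 (s :: u) ((List.prefix_cons_inj s).mpr hu) ?_
        rwa [val, pathVal_cons, hn, codeVal_self, one_mul]
    · right
      have hle := h𝒜.lt_le hp
      rw [val, pathVal_cons] at h2
      obtain ⟨u, l, v, rfl, hl, hu1, hav⟩ := exists_first_return hle hn π
        (fun t ht => h𝒜.lt_le (hpath.lt t ht)) h2
      obtain ⟨m, hm1, rfl, m', ⟨hlP, hst⟩, hm2⟩ := path_append.mp hpath
      have hln : 𝒜.lt l ≠ 𝒜.n := by omega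
      rcases hst with ⟨h, -⟩ | ⟨-, rfl⟩
      · exact absurd h hln
      have hinv : codeVal 𝒜.n (𝒜.lt l) = (codeVal 𝒜.n (𝒜.lt s))⁻¹ := by
        rw [← codeVal_inv hle]; congr 1; omega
      have hpl : ∀ w, 𝒜.val (s :: (u ++ l :: w)) = 𝒜.val w := fun w => by
        simp only [val]
        rw [pathVal_cons, pathVal_append, hu1, one_mul, pathVal_cons, hinv, mul_inv_cancel_left]
      refine ⟨u, l, v, 𝒜.deg u, 𝒜.deg v, rfl, hp, hn, ?_, hlP, hl, ?_,
        ⟨hm1, hu1, rfl, fun u' hu' he => ?_⟩, ⟨hm2, ?_, rfl, fun v' hv' he => ?_⟩⟩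
      · rintro rfl
        refine hn (h4 [s] (by simp) ?_)
        rw [val, pathVal_cons, pathVal_nil, mul_one]
      · rw [deg_cons, deg_append, deg_cons, h𝒜.dg_eq hp hn, h𝒜.dg_eq hlP hln] at h3
        omega
      · exact absurd (he.trans hinv) (hav u' hu')
      · rw [← hpl v, val, pathVal_cons]; exact h2
      · refine h4 (s :: (u ++ l :: v')) ?_ ((hpl v').trans he)
        rw [List.prefix_cons_inj, List.prefix_append_right_inj, List.prefix_cons_inj]
        exact hv'

omit h𝒜 in
/-- The first return is unique. -/
theorem glue_letter_injective {p l l' k k' : ℕ} {u v u' v' : List ℕ}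
    (hn : 𝒜.lt p ≠ 𝒜.n) (hlp : 𝒜.lt l + 𝒜.lt p = 2 * 𝒜.n) (hlp' : 𝒜.lt l' + 𝒜.lt p = 2 * 𝒜.n)
    (hu : u ∈ 𝒜.X (𝒜.lt l) (p + 1) l k) (hu' : u' ∈ 𝒜.X (𝒜.lt l') (p + 1) l' k')
    (h : u ++ l :: v = u' ++ l' :: v') : u = u' ∧ l = l' ∧ v = v' := by
  have key : ∀ {l l' k k' : ℕ} {u v u' v' : List ℕ}, 𝒜.lt l + 𝒜.lt p = 2 * 𝒜.n →
      𝒜.lt l' + 𝒜.lt p = 2 * 𝒜.n → u ∈ 𝒜.X (𝒜.lt l) (p + 1) l k →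
      u' ∈ 𝒜.X (𝒜.lt l') (p + 1) l' k' → u ++ l :: v = u' ++ l' :: v' → ¬ u.length < u'.length := by
    intro l l' k k' u v u' v' hlp hlp' hu hu' h hlt
    have h1 : u ++ [l] <+: u' := by
      refine List.prefix_of_prefix_length_le (l₃ := u ++ l :: v) ?_ ?_ (by simp; omega)
      · simp
      · rw [h]; simp
    have h2 := hu'.2.2.2 _ h1 (by
      rw [val, pathVal_append, show pathVal 𝒜.n 𝒜.lt u = 1 from hu.2.1, one_mul, pathVal_cons,
        pathVal_nil, mul_one]
      congr 1; omega)
    omega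
  have hlen : u.length = u'.length :=
    le_antisymm (not_lt.mp (key hlp' hlp hu' hu h.symm)) (not_lt.mp (key hlp hlp' hu hu' h))
  obtain ⟨h1, h2⟩ := List.append_inj h hlen
  simp only [List.cons.injEq] at h2
  exact ⟨h1, h2.1, h2.2⟩

end

theorem mem_pathSet_enc {b p q k M : ℕ} {π : List ℕ} (hb : b ≤ 2 * 𝒜.n) (hp : p ≤ 𝒜.P)
    (hq : q ≤ 𝒜.P) :
    π ∈ 𝒜.pathSet (enc 𝒜.P b p q) k M ↔ π ∈ 𝒜.X b p q k ∧ π.length ≤ M := by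
  simp only [pathSet, Set.mem_ofPred_eq, enc_mod hq, enc_div_mod hp hq, enc_div_div hp hq]
  exact and_iff_right (enc_lt hb hp hq)

theorem act_enc {b p q l : ℕ} (hb : b ≤ 2 * 𝒜.n) (hp : p ≤ 𝒜.P) (hq : q ≤ 𝒜.P) :
    𝒜.grammar.act (enc 𝒜.P b p q) l ↔ l < 𝒜.P ∧ p < 𝒜.P ∧ ((𝒜.lt p = 𝒜.n ∧ 𝒜.ok p l) ∨
      (𝒜.lt p ≠ 𝒜.n ∧ 𝒜.lt p ≠ b ∧ 𝒜.lt l + 𝒜.lt p = 2 * 𝒜.n)) := by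
  simp only [grammar, enc_div_mod hp hq, enc_div_div hp hq]
  exact and_iff_right (enc_lt hb hp hq)

theorem f1_enc {b p q l : ℕ} (hp : p ≤ 𝒜.P) (hq : q ≤ 𝒜.P) :
    𝒜.grammar.f1 (enc 𝒜.P b p q) l = if 𝒜.lt p = 𝒜.n then enc 𝒜.P 𝒜.n 𝒜.P 𝒜.P
      else enc 𝒜.P (𝒜.lt l) (p + 1) l := by
  simp only [grammar, enc_div_mod hp hq]

theorem f2_enc {b p q l : ℕ} (hp : p ≤ 𝒜.P) (hq : q ≤ 𝒜.P) :
    𝒜.grammar.f2 (enc 𝒜.P b p q) l = if 𝒜.lt p = 𝒜.n then enc 𝒜.P b l q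
      else enc 𝒜.P b (l + 1) q := by
  simp only [grammar, enc_div_mod hp hq, enc_div_div hp hq, enc_mod hq]

theorem dl_enc {b p q l : ℕ} (hp : p ≤ 𝒜.P) (hq : q ≤ 𝒜.P) :
    𝒜.grammar.dl (enc 𝒜.P b p q) l = if 𝒜.lt p = 𝒜.n then 𝒜.dg p else 0 := by
  simp only [grammar, enc_div_mod hp hq]

theorem init_enc {b p q : ℕ} (hb : b ≤ 2 * 𝒜.n) (hp : p ≤ 𝒜.P) (hq : q ≤ 𝒜.P) :
    𝒜.grammar.init (enc 𝒜.P b p q) ↔ p = q := by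
  simp only [grammar, enc_div_mod hp hq, enc_mod hq]
  exact and_iff_right (enc_lt hb hp hq)

/-- For all states there is at most one path of degree `0` between them that spells `1`. -/
def Rigid (𝒜 : Auto) : Prop :=
  ∀ p q π π', π ∈ 𝒜.X 𝒜.n p q 0 → π' ∈ 𝒜.X 𝒜.n p q 0 → π = π'

theorem finite_pathSet (σ k M : ℕ) : (𝒜.pathSet σ k M).Finite := by
  have h1 : {l : List (Fin 𝒜.P) | l.length ≤ M}.Finite := List.finite_length_le _ _
  refine (h1.image (List.map Fin.val)).subset ?_
  rintro π ⟨-, hπ, hM⟩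
  have hlt := hπ.1.lt
  refine ⟨π.pmap (fun s hs => ⟨s, hs⟩) hlt, by simpa using hM, ?_⟩
  rw [List.map_pmap]; simp

theorem act_bounds (h𝒜 : 𝒜.Valid) {σ l : ℕ} (h : 𝒜.grammar.act σ l) :
    σ < 𝒜.grammar.NV ∧ l < 𝒜.grammar.NL ∧ 𝒜.grammar.f1 σ l < 𝒜.grammar.NV ∧
      𝒜.grammar.f2 σ l < 𝒜.grammar.NV := by
  have h0 := h.1
  obtain ⟨b, p, q, hb, hp, hq, rfl⟩ := exists_enc h0
  obtain ⟨hl, hpP, -⟩ := (act_enc hb hp hq).mp h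
  rw [f1_enc hp hq, f2_enc hp hq]
  have := h𝒜.lt_le hl
  refine ⟨h0, hl, ?_, ?_⟩
  · split_ifs
    · exact enc_lt (by omega) le_rfl le_rfl
    · exact enc_lt this (by omega) hl.le
  · split_ifs
    · exact enc_lt hb hl.le hq
    · exact enc_lt hb hl hq

/-- Every way to begin a derivation, together with derivations of both nonterminals, yields a path. -/
theorem glue_mem (h𝒜 : 𝒜.Valid) {σ l k k1 k2 A B M : ℕ} {u v : List ℕ}
    (ha : 𝒜.grammar.act σ l) (hk : k1 + k2 + 𝒜.grammar.dl σ l = k)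
    (hu : u ∈ 𝒜.pathSet (𝒜.grammar.f1 σ l) k1 A) (hv : v ∈ 𝒜.pathSet (𝒜.grammar.f2 σ l) k2 B)
    (hM : A + B + 2 ≤ M) :
    𝒜.glue (σ / (𝒜.P + 1) % (𝒜.P + 1)) l u v ∈ 𝒜.pathSet σ k M := by
  obtain ⟨b, p, q, hb, hp, hq, rfl⟩ := exists_enc ha.1
  have hlen := length_glue_le (𝒜 := 𝒜) p l u v
  have huA := hu.2.2
  have hvB := hv.2.2
  rw [enc_div_mod hp hq, mem_pathSet_enc hb hp hq]
  refine ⟨?_, by omega⟩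
  obtain ⟨hl, hpP, ⟨hn, hok⟩ | ⟨hn, hpb, hlp⟩⟩ := (act_enc hb hp hq).mp ha
  · rw [f1_enc hp hq, if_pos hn, mem_pathSet_enc (by omega) le_rfl le_rfl] at hu
    rw [f2_enc hp hq, if_pos hn, mem_pathSet_enc hb hl.le hq] at hv
    rw [dl_enc hp hq, if_pos hn] at hk
    have h1 := hu.1.1.eq_nil
    have h2 : k1 = 0 := by rw [← hu.1.2.2.1, h1]; rfl
    rw [glue_of_eq hn, show k = k2 + 𝒜.dg p by omega]
    exact glue_empty_mem hb hpP hn hok hv.1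
  · have hln : 𝒜.lt l ≠ 𝒜.n := by omega
    rw [f1_enc hp hq, if_neg hn, mem_pathSet_enc (h𝒜.lt_le hl) (by omega) hl.le] at hu
    rw [f2_enc hp hq, if_neg hn, mem_pathSet_enc hb (by omega) hq] at hv
    rw [dl_enc hp hq, if_neg hn] at hk
    obtain rfl : k = k1 + k2 := by omega
    rw [glue_of_ne hn]
    exact glue_letter_mem h𝒜 hb hpP hn hpb hl hlp hu.1 hv.1

/-- The grammar is unambiguous. -/
theorem glue_injective (h𝒜 : 𝒜.Valid) {σ l l' k1 k2 k1' k2' A B A' B' : ℕ} {u v u' v' : List ℕ}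
    (ha : 𝒜.grammar.act σ l) (ha' : 𝒜.grammar.act σ l')
    (hu : u ∈ 𝒜.pathSet (𝒜.grammar.f1 σ l) k1 A) (hv : v ∈ 𝒜.pathSet (𝒜.grammar.f2 σ l) k2 B)
    (hu' : u' ∈ 𝒜.pathSet (𝒜.grammar.f1 σ l') k1' A')
    (hv' : v' ∈ 𝒜.pathSet (𝒜.grammar.f2 σ l') k2' B')
    (h : 𝒜.glue (σ / (𝒜.P + 1) % (𝒜.P + 1)) l u v = 𝒜.glue (σ / (𝒜.P + 1) % (𝒜.P + 1)) l' u' v') :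
    (l, k1, k2) = (l', k1', k2') ∧ u = u' ∧ v = v' := by
  obtain ⟨b, p, q, hb, hp, hq, rfl⟩ := exists_enc ha.1
  rw [enc_div_mod hp hq] at h
  have hcl : l = l' ∧ u = u' ∧ v = v' := by
    obtain ⟨hl, hpP, ⟨hn, hok⟩ | ⟨hn, hpb, hlp⟩⟩ := (act_enc hb hp hq).mp ha
    · obtain ⟨hl', -, -⟩ := (act_enc hb hp hq).mp ha'
      rw [f1_enc hp hq, if_pos hn, mem_pathSet_enc (by omega) le_rfl le_rfl] at hu hu'
      rw [f2_enc hp hq, if_pos hn, mem_pathSet_enc hb hl.le hq] at hv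
      rw [f2_enc hp hq, if_pos hn, mem_pathSet_enc hb hl'.le hq] at hv'
      rw [glue_of_eq hn, glue_of_eq hn] at h
      simp only [List.cons.injEq, true_and] at h
      subst h
      refine ⟨?_, hu.1.1.eq_nil.trans hu'.1.1.eq_nil.symm, rfl⟩
      have h1 := hv.1.1
      have h2 := hv'.1.1
      cases v with
      | nil => exact Eq.trans h1 (Eq.symm h2)
      | cons s v => exact h1.1.symm.trans h2.1
    · obtain ⟨hl', -, ⟨hn', -⟩ | ⟨-, -, hlp'⟩⟩ := (act_enc hb hp hq).mp ha'
      · exact absurd hn' hn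
      rw [f1_enc hp hq, if_neg hn, mem_pathSet_enc (h𝒜.lt_le hl) (by omega) hl.le] at hu
      rw [f1_enc hp hq, if_neg hn, mem_pathSet_enc (h𝒜.lt_le hl') (by omega) hl'.le] at hu'
      rw [glue_of_ne hn, glue_of_ne hn] at h
      simp only [List.cons.injEq, true_and] at h
      obtain ⟨h1, h2, h3⟩ := glue_letter_injective hn hlp hlp' hu.1 hu'.1 h
      exact ⟨h2, h1, h3⟩
  obtain ⟨rfl, rfl, rfl⟩ := hcl
  rw [← hu.2.1.2.2.1, ← hu'.2.1.2.2.1, ← hv.2.1.2.2.1, ← hv'.2.1.2.2.1]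
  simp

/-- The paths that begin with the derivation step `t`. -/
def glueSet (𝒜 : Auto) (σ : ℕ) (t : ℕ × ℕ × ℕ) (A B : ℕ) : Set (List ℕ) :=
  (fun w : List ℕ × List ℕ => 𝒜.glue (σ / (𝒜.P + 1) % (𝒜.P + 1)) t.1 w.1 w.2) ''
    (𝒜.pathSet (𝒜.grammar.f1 σ t.1) t.2.1 A ×ˢ 𝒜.pathSet (𝒜.grammar.f2 σ t.1) t.2.2 B)

theorem finite_glueSet (σ : ℕ) (t : ℕ × ℕ × ℕ) (A B : ℕ) : (𝒜.glueSet σ t A B).Finite :=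
  ((finite_pathSet _ _ _).prod (finite_pathSet _ _ _)).image _

theorem ncard_glueSet (h𝒜 : 𝒜.Valid) {σ : ℕ} {t : ℕ × ℕ × ℕ} (ha : 𝒜.grammar.act σ t.1) (A B : ℕ) :
    (𝒜.glueSet σ t A B).ncard =
      𝒜.count (𝒜.grammar.f1 σ t.1) t.2.1 A * 𝒜.count (𝒜.grammar.f2 σ t.1) t.2.2 B := by
  rw [glueSet, Set.InjOn.ncard_image, Set.ncard_prod]
  · rfl
  rintro ⟨u, v⟩ ⟨hu, hv⟩ ⟨u', v'⟩ ⟨hu', hv'⟩ h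
  obtain ⟨-, h1, h2⟩ := glue_injective h𝒜 ha ha hu hv hu' hv' h
  exact Prod.ext h1 h2

/-- The grammar derives every path that spells `1` exactly once, because the first return is unique. -/
theorem counts (h𝒜 : 𝒜.Valid) (hr : 𝒜.Rigid) : 𝒜.grammar.Counts 𝒜.count where
  lt := act_bounds h𝒜
  mono σ k M M' h := Set.ncard_le_ncard (fun π hπ => ⟨hπ.1, hπ.2.1, hπ.2.2.trans h⟩)
    (finite_pathSet _ _ _)
  zero_le_one σ M := by
    refine (Set.ncard_le_one (finite_pathSet _ _ _)).mpr fun π hπ π' hπ' => ?_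
    exact hr _ _ _ _ (X_subset _ _ _ _ hπ.2.1) (X_subset _ _ _ _ hπ'.2.1)
  init_le σ h := by
    have h0 := h.1
    obtain ⟨b, p, q, hb, hp, hq, rfl⟩ := exists_enc h0
    obtain rfl := (init_enc hb hp hq).mp h
    refine (Set.ncard_pos (finite_pathSet _ _ _)).mpr
      ⟨[], (mem_pathSet_enc hb hp hq).mpr ⟨nil_mem_X hb, le_rfl⟩⟩
  zero_le σ k := by
    by_cases h : k = 0 ∧ 𝒜.grammar.init σ
    · rw [RAM.ind_of h, count, Set.ncard_le_one (finite_pathSet _ _ _)]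
      intro π hπ π' hπ'
      rw [List.length_eq_zero_iff.mp (Nat.le_zero.mp hπ.2.2),
        List.length_eq_zero_iff.mp (Nat.le_zero.mp hπ'.2.2)]
    · rw [RAM.ind_of_not h, Nat.le_zero, count, Set.ncard_eq_zero (finite_pathSet _ _ _)]
      rw [Set.eq_empty_iff_forall_notMem]
      rintro π ⟨hσ, hπ, hl⟩
      rw [List.length_eq_zero_iff.mp (Nat.le_zero.mp hl)] at hπ
      exact h ⟨hπ.2.2.1.symm, hσ, hπ.1⟩
  succ_le σ k M := by
    classical
    have hsub : 𝒜.pathSet σ k (M + 1) ⊆ {π | π = [] ∧ k = 0 ∧ 𝒜.grammar.init σ} ∪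
        ⋃ t ∈ 𝒜.grammar.terms σ k, 𝒜.glueSet σ t M M := by
      rintro π ⟨hσ, hπ, hM⟩
      obtain ⟨b, p, q, hb, hp, hq, rfl⟩ := exists_enc hσ
      rw [enc_div_div hp hq, enc_div_mod hp hq, enc_mod hq] at hπ
      have hmem : ∀ l k1 k2, 𝒜.grammar.act (enc 𝒜.P b p q) l →
          k1 + k2 + 𝒜.grammar.dl (enc 𝒜.P b p q) l = k →
          (l, k1, k2) ∈ 𝒜.grammar.terms (enc 𝒜.P b p q) k := fun l k1 k2 h1 h2 => by
        simp only [Grammar.terms, Finset.mem_filter, Finset.mem_product, Finset.mem_range]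
        exact ⟨⟨(act_bounds h𝒜 h1).2.1, by omega, by omega⟩, h1, h2⟩
      rcases exists_glue h𝒜 hπ with ⟨rfl, rfl, rfl⟩ | ⟨v, l, rfl, hpP, hn, hok, k', hk', hv⟩ |
        ⟨u, l, v, k1, k2, rfl, hpP, hn, hpb, hl, hlp, hk', hu, hv⟩
      · exact Or.inl ⟨rfl, rfl, (init_enc hb hp hq).mpr rfl⟩
      · right
        have hl := h𝒜.ok_lt hpP hok
        have ha := (act_enc (l := l) hb hp hq).mpr ⟨hl, hpP, Or.inl ⟨hn, hok⟩⟩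
        refine Set.mem_biUnion (x := (l, 0, k')) (hmem l 0 k' ha
          (by rw [dl_enc hp hq, if_pos hn]; omega)) ⟨([], v), ⟨?_, ?_⟩, ?_⟩
        · simp only
          rw [f1_enc hp hq, if_pos hn, mem_pathSet_enc (by omega) le_rfl le_rfl]
          exact ⟨nil_mem_X (by omega), Nat.zero_le _⟩
        · simp only
          rw [f2_enc hp hq, if_pos hn, mem_pathSet_enc hb hl.le hq]
          exact ⟨hv, by simpa using hM⟩
        · simp only
          rw [enc_div_mod hp hq, glue_of_eq hn]
      · right
        have ha := (act_enc (l := l) hb hp hq).mpr ⟨hl, hpP, Or.inr ⟨hn, hpb, hlp⟩⟩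
        simp only [List.length_cons, List.length_append] at hM
        refine Set.mem_biUnion (x := (l, k1, k2)) (hmem l k1 k2 ha
          (by rw [dl_enc hp hq, if_neg hn]; omega)) ⟨(u, v), ⟨?_, ?_⟩, ?_⟩
        · simp only
          rw [f1_enc hp hq, if_neg hn, mem_pathSet_enc (h𝒜.lt_le hl) (by omega) hl.le]
          exact ⟨hu, by omega⟩
        · simp only
          rw [f2_enc hp hq, if_neg hn, mem_pathSet_enc hb (by omega) hq]
          exact ⟨hv, by omega⟩
        · simp only
          rw [enc_div_mod hp hq, glue_of_ne hn]
    have hfin1 : {π : List ℕ | π = [] ∧ k = 0 ∧ 𝒜.grammar.init σ}.Finite :=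
      (Set.finite_singleton []).subset fun π h => h.1
    have hfin2 : (⋃ t ∈ 𝒜.grammar.terms σ k, 𝒜.glueSet σ t M M).Finite :=
      (Finset.finite_toSet _).biUnion fun t _ => finite_glueSet _ _ _ _
    refine (Set.ncard_le_ncard hsub (hfin1.union hfin2)).trans
      ((Set.ncard_union_le _ _).trans (Nat.add_le_add ?_ ?_))
    · by_cases h : k = 0 ∧ 𝒜.grammar.init σ
      · rw [RAM.ind_of h, Set.ncard_le_one hfin1]
        intro π hπ π' hπ'
        rw [hπ.1, hπ'.1]
      · rw [RAM.ind_of_not h, Nat.le_zero, Set.ncard_eq_zero hfin1,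
          Set.eq_empty_iff_forall_notMem]
        exact fun π hπ => h hπ.2
    · refine (Finset.set_ncard_biUnion_le _ _).trans (Finset.sum_le_sum fun t ht => ?_)
      simp only [Grammar.terms, Finset.mem_filter] at ht
      rw [ncard_glueSet h𝒜 ht.2.1]
  le := by
    intro σ k t ht A B M hM
    simp only [Grammar.terms, Finset.mem_filter] at ht
    rw [← ncard_glueSet h𝒜 ht.2.1]
    refine Set.ncard_le_ncard ?_ (finite_pathSet _ _ _)
    rintro _ ⟨⟨u, v⟩, ⟨hu, hv⟩, rfl⟩
    exact glue_mem h𝒜 ht.2.1 ht.2.2 hu hv hM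
  add_le := by
    intro σ k t ht t' ht' hne A B A' B' M hM hM'
    simp only [Grammar.terms, Finset.mem_filter] at ht ht'
    rw [← ncard_glueSet h𝒜 ht.2.1, ← ncard_glueSet h𝒜 ht'.2.1, ← Set.ncard_union_eq ?_
      (finite_glueSet _ _ _ _) (finite_glueSet _ _ _ _)]
    · refine Set.ncard_le_ncard ?_ (finite_pathSet _ _ _)
      rintro _ (⟨⟨u, v⟩, ⟨hu, hv⟩, rfl⟩ | ⟨⟨u, v⟩, ⟨hu, hv⟩, rfl⟩)
      · exact glue_mem h𝒜 ht.2.1 ht.2.2 hu hv hM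
      · exact glue_mem h𝒜 ht'.2.1 ht'.2.2 hu hv hM'
    · rw [Set.disjoint_left]
      rintro _ ⟨⟨u, v⟩, ⟨hu, hv⟩, rfl⟩ ⟨⟨u', v'⟩, ⟨hu', hv'⟩, h⟩
      exact hne (glue_injective h𝒜 ht'.2.1 ht.2.1 hu' hv' hu hv h).1.symm

end Auto

/-! ### The rose automaton of a list of words -/

/-- The automaton that reads, with free cancellation, products of the words `blk 0, …, blk (2 r + 1)`.
The state `s * W + i` is position `i` in the word `s`; at the end of a word every word may follow
except for the inverse, which has number `2 * r + 1 - s`. The degree counts the words `r` and `r + 1`,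
which stand for the variable and its inverse. -/
def rose (n r W : ℕ) (blk : ℕ → List ℕ) : Auto where
  n := n
  P := (2 * r + 2) * W
  lt p := (blk (p / W)).getD (p % W) n
  ok p l := ∃ s < 2 * r + 2, l = s * W ∧ s + p / W ≠ 2 * r + 1
  dg p := if (blk (p / W)).getD (p % W) n = n ∧ (p / W = r ∨ p / W = r + 1) then 1 else 0

/-- The words `blk s` have length less than `W` and consist of codes of letters. -/
structure Blocks (n r W : ℕ) (blk : ℕ → List ℕ) : Prop where
  length_lt : ∀ {s}, s < 2 * r + 2 → (blk s).length < W
  letter : ∀ {s c}, s < 2 * r + 2 → c ∈ blk s → c ≤ 2 * n ∧ c ≠ n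

namespace Rose

/-- The element of the free group that is spelled by a list of codes. -/
def spell (n : ℕ) (w : List ℕ) : FreeGroup (Fin n) := (w.map (codeVal n)).prod

/-- The numbers of the words that a path of the rose automaton completes. -/
def heads (n r W : ℕ) (blk : ℕ → List ℕ) (π : List ℕ) : List ℕ :=
  (π.filter fun p => (rose n r W blk).lt p = n).map (· / W)

variable {n r W : ℕ} {blk : ℕ → List ℕ}

theorem heads_cons_of_eq {p : ℕ} {π : List ℕ} (h : (rose n r W blk).lt p = n) :
    heads n r W blk (p :: π) = p / W :: heads n r W blk π := by
  simp [heads, h]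

theorem heads_cons_of_ne {p : ℕ} {π : List ℕ} (h : (rose n r W blk).lt p ≠ n) :
    heads n r W blk (p :: π) = heads n r W blk π := by
  simp [heads, h]

theorem heads_append {u v : List ℕ} :
    heads n r W blk (u ++ v) = heads n r W blk u ++ heads n r W blk v := by
  simp [heads]

theorem length_heads_le (π : List ℕ) : (heads n r W blk π).length ≤ π.length := by
  simpa [heads] using List.length_filter_le _ π

theorem deg_eq_countP (π : List ℕ) : (rose n r W blk).deg π =
    (heads n r W blk π).countP fun s => s = r ∨ s = r + 1 := by
  induction π with
  | nil => rfl
  | cons p π ih =>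
    rw [Auto.deg_cons, ih]
    by_cases h : (rose n r W blk).lt p = n
    · have h' : (blk (p / W)).getD (p % W) n = n := h
      rw [heads_cons_of_eq h, List.countP_cons, add_comm]
      congr 1
      simp only [rose, h', true_and, decide_eq_true_eq]
    · have h' : (blk (p / W)).getD (p % W) n ≠ n := h
      have h2 : (rose n r W blk).dg p = 0 := if_neg fun h2 => h' h2.1
      rw [heads_cons_of_ne h, h2, zero_add]

section
variable (hb : Blocks n r W blk)
include hb

theorem W_pos : 0 < W := (Nat.zero_le _).trans_lt (hb.length_lt (show 0 < 2 * r + 2 by omega))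

omit hb in
theorem div_lt {p : ℕ} (hp : p < (2 * r + 2) * W) : p / W < 2 * r + 2 :=
  Nat.div_lt_of_lt_mul (by linarith)

omit hb in
theorem lt_of_ne {p : ℕ} (h : (rose n r W blk).lt p ≠ n) :
    p % W < (blk (p / W)).length := by
  by_contra hlt
  exact h (List.getD_eq_default _ _ (by omega))

theorem le_of_eq {p : ℕ} (hp : p < (2 * r + 2) * W) (h : (rose n r W blk).lt p = n) :
    (blk (p / W)).length ≤ p % W := by
  by_contra hlt
  push Not at hlt
  change (blk (p / W)).getD (p % W) n = n at h
  rw [List.getD_eq_getElem _ _ hlt] at h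
  exact (hb.letter (div_lt hp) (List.getElem_mem hlt)).2 h

theorem succ_div_mod {p : ℕ} (hp : p < (2 * r + 2) * W) (h : (rose n r W blk).lt p ≠ n) :
    (p + 1) / W = p / W ∧ (p + 1) % W = p % W + 1 := by
  have h1 := lt_of_ne h
  have h2 := hb.length_lt (div_lt hp)
  have h3 := Nat.div_add_mod p W
  have h4 : p + 1 = (p % W + 1) + W * (p / W) := by omega
  rw [h4, Nat.add_mul_div_left _ _ (W_pos hb), Nat.add_mul_mod_self_left,
    Nat.div_eq_of_lt (by omega), Nat.mod_eq_of_lt (by omega)]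
  omega

theorem start_lt {s : ℕ} (hs : s < 2 * r + 2) : s * W < (2 * r + 2) * W :=
  Nat.mul_lt_mul_of_pos_right hs (W_pos hb)

theorem valid : (rose n r W blk).Valid where
  lt_le {p} hp := by
    by_cases h : (rose n r W blk).lt p = n
    · rw [h]; change n ≤ 2 * n; omega
    · have h1 := lt_of_ne h
      change (blk (p / W)).getD (p % W) n ≤ 2 * n
      rw [List.getD_eq_getElem _ _ h1]
      exact (hb.letter (div_lt hp) (List.getElem_mem h1)).1
  next_lt {p} hp h := by
    have h1 := (succ_div_mod hb hp h).1
    have h2 := div_lt hp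
    change p + 1 < (2 * r + 2) * W
    rw [← h1] at h2
    exact (Nat.div_lt_iff_lt_mul (W_pos hb)).mp h2
  ok_lt := by
    rintro p l - ⟨s, hs, rfl, -⟩
    exact start_lt hb hs
  dg_eq {p} _ h := if_neg fun h' => h h'.1

/-- The transitions of the rose automaton. -/
theorem step_iff {p l : ℕ} (hs : (rose n r W blk).Step p l) :
    p < (2 * r + 2) * W ∧ l < (2 * r + 2) * W ∧
    (((rose n r W blk).lt p = n ∧ l % W = 0 ∧ l = l / W * W ∧ l / W + p / W ≠ 2 * r + 1) ∨
      ((rose n r W blk).lt p ≠ n ∧ l = p + 1 ∧ l / W = p / W ∧ l % W = p % W + 1)) := by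
  obtain ⟨hp, ⟨h1, s, hs, rfl, h2⟩ | ⟨h1, rfl⟩⟩ := hs
  · refine ⟨hp, start_lt hb hs, Or.inl ⟨h1, ?_, ?_, ?_⟩⟩
    · exact Nat.mul_mod_left s W
    · rw [Nat.mul_div_cancel _ (W_pos hb)]
    · rwa [Nat.mul_div_cancel _ (W_pos hb)]
  · exact ⟨hp, (valid hb).next_lt hp h1, Or.inr ⟨h1, rfl, succ_div_mod hb hp h1⟩⟩

/-- Up to the initial pieces of words before its two ends, a path spells the product of the words that it
completes. -/
theorem spell_val {p q : ℕ} {π : List ℕ} (hp : p < (2 * r + 2) * W)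
    (h : (rose n r W blk).Path p π q) :
    spell n ((blk (p / W)).take (p % W)) * pathVal n (rose n r W blk).lt π =
      ((heads n r W blk π).map fun s => spell n (blk s)).prod *
        spell n ((blk (q / W)).take (q % W)) := by
  induction π generalizing p with
  | nil =>
    obtain rfl : p = q := h
    simp [heads, pathVal_nil]
  | cons s π ih =>
    obtain ⟨rfl, l, hs, h⟩ := h
    obtain ⟨-, hl, ⟨h1, h2, -, -⟩ | ⟨h1, rfl, h2, h3⟩⟩ := step_iff hb hs
    · have h4 := ih hl h
      rw [h2, List.take_zero, show spell n [] = 1 from rfl, one_mul] at h4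
      rw [heads_cons_of_eq h1, List.map_cons, List.prod_cons, pathVal_cons, h1, mul_assoc,
        ← h4, List.take_of_length_le (le_of_eq hb hp h1)]
      change _ * (codeVal n n * _) = _
      rw [codeVal_self, one_mul]
    · have h4 := ih hl h
      have h5 := lt_of_ne h1
      rw [h2, h3, List.take_add_one, List.getElem?_eq_getElem h5] at h4
      rw [heads_cons_of_ne h1, pathVal_cons, ← h4, ← mul_assoc]
      congr 1
      have h6 : (rose n r W blk).lt s = (blk (s / W))[s % W] := List.getD_eq_getElem _ _ h5
      rw [h6]
      simp only [spell, List.map_append, List.prod_append, Option.toList_some, List.map_cons,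
        List.map_nil, List.prod_singleton]

theorem head_heads {p q : ℕ} {π : List ℕ} (h : (rose n r W blk).Path p π q) :
    (heads n r W blk π ++ [q / W]).head? = some (p / W) := by
  induction π generalizing p with
  | nil =>
    obtain rfl : p = q := h
    rfl
  | cons s π ih =>
    obtain ⟨rfl, l, hs, h⟩ := h
    obtain ⟨-, hl, ⟨h1, -⟩ | ⟨h1, rfl, h2, h3⟩⟩ := step_iff hb hs
    · rw [heads_cons_of_eq h1]; rfl
    · rw [heads_cons_of_ne h1, ih h, h2]

theorem isChain_heads {p q : ℕ} {π : List ℕ} (h : (rose n r W blk).Path p π q) :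
    (heads n r W blk π ++ [q / W]).IsChain fun s s' => s + s' ≠ 2 * r + 1 := by
  induction π generalizing p with
  | nil => simp [heads]
  | cons s π ih =>
    obtain ⟨rfl, l, hs, h⟩ := h
    obtain ⟨-, hl, ⟨h1, -, -, h2⟩ | ⟨h1, rfl, h2, h3⟩⟩ := step_iff hb hs
    · rw [heads_cons_of_eq h1, List.cons_append, List.isChain_cons]
      refine ⟨fun y hy => ?_, ih h⟩
      rw [head_heads hb h] at hy
      obtain rfl := Option.some.inj hy
      omega
    · rw [heads_cons_of_ne h1]
      exact ih h

omit hb in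
theorem heads_lt {p q : ℕ} {π : List ℕ} (h : (rose n r W blk).Path p π q) :
    ∀ s ∈ heads n r W blk π, s < 2 * r + 2 := by
  intro s hs
  obtain ⟨p, hp, rfl⟩ := List.mem_map.mp hs
  exact div_lt (h.lt p (List.mem_of_mem_filter hp))

theorem eq_add_of_heads_nil {p q : ℕ} {π : List ℕ} (h : (rose n r W blk).Path p π q)
    (h0 : heads n r W blk π = []) : q = p + π.length := by
  induction π generalizing p with
  | nil =>
    obtain rfl : p = q := h
    rfl
  | cons s π ih =>
    obtain ⟨rfl, l, hs, h⟩ := h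
    obtain ⟨-, hl, ⟨h1, -⟩ | ⟨h1, rfl, -⟩⟩ := step_iff hb hs
    · rw [heads_cons_of_eq h1] at h0
      cases h0
    · rw [heads_cons_of_ne h1] at h0
      rw [ih h h0, List.length_cons]
      omega

/-- A path is determined by its end points and the words that it completes. -/
theorem heads_injective {p q : ℕ} {π π' : List ℕ} (h : (rose n r W blk).Path p π q)
    (h' : (rose n r W blk).Path p π' q) (he : heads n r W blk π = heads n r W blk π') :
    π = π' := by
  induction π generalizing p π' with
  | nil =>
    have h1 := eq_add_of_heads_nil hb h' he.symm
    obtain rfl : p = q := h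
    exact (List.length_eq_zero_iff.mp (by omega)).symm
  | cons s π ih =>
    cases π' with
    | nil =>
      have h1 := eq_add_of_heads_nil hb h he
      obtain rfl : p = q := h'
      rw [List.length_cons] at h1
      omega
    | cons s' π' =>
      obtain ⟨rfl, l, hs, h⟩ := h
      obtain ⟨rfl, l', hs', h'⟩ := h'
      have hh : ∀ l l', (rose n r W blk).Step s' l → (rose n r W blk).Step s' l' →
          l / W = l' / W → l = l' := by
        intro l l' hs hs' e
        obtain ⟨-, -, ⟨h1, -, h2, -⟩ | ⟨h1, h2, -⟩⟩ := step_iff hb hs <;>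
        obtain ⟨-, -, ⟨h1', -, h2', -⟩ | ⟨h1', h2', -⟩⟩ := step_iff hb hs'
        · rw [h2, h2', e]
        · exact absurd h1 h1'
        · exact absurd h1' h1
        · rw [h2, h2']
      have he' : heads n r W blk π = heads n r W blk π' := by
        by_cases h1 : (rose n r W blk).lt s' = n
        · rw [heads_cons_of_eq h1, heads_cons_of_eq h1] at he
          exact List.tail_eq_of_cons_eq he
        · rwa [heads_cons_of_ne h1, heads_cons_of_ne h1] at he
      have h2 := head_heads hb h
      rw [he', head_heads hb h'] at h2
      obtain rfl := hh l l' hs hs' (Option.some.inj h2).symm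
      rw [ih h h' he']

/-- The path through the word `s`. -/
theorem path_block {s l : ℕ} (hs : s < 2 * r + 2) (hl : l < 2 * r + 2) (hsl : s + l ≠ 2 * r + 1) :
    (rose n r W blk).Path (s * W) (List.range' (s * W) ((blk s).length + 1)) (l * W) ∧
      heads n r W blk (List.range' (s * W) ((blk s).length + 1)) = [s] := by
  have hW := W_pos hb
  have hlen := hb.length_lt hs
  have key : ∀ j i, i + j = (blk s).length →
      (rose n r W blk).Path (s * W + i) (List.range' (s * W + i) (j + 1)) (l * W) ∧
      heads n r W blk (List.range' (s * W + i) (j + 1)) = [s] := by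
    intro j
    induction j with
    | zero =>
      intro i hi
      have hd : (s * W + i) / W = s := by
        rw [mul_comm, Nat.mul_add_div hW, Nat.div_eq_of_lt (by omega), add_zero]
      have hm : (s * W + i) % W = i := by
        rw [mul_comm, Nat.mul_add_mod, Nat.mod_eq_of_lt (by omega)]
      have h1 : (rose n r W blk).lt (s * W + i) = n := by
        change (blk ((s * W + i) / W)).getD ((s * W + i) % W) n = n
        rw [hd, hm]
        exact List.getD_eq_default _ _ (by omega)
      refine ⟨⟨rfl, l * W, ⟨?_, Or.inl ⟨h1, l, hl, rfl, ?_⟩⟩, rfl⟩, ?_⟩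
      · change s * W + i < (2 * r + 2) * W
        rw [← Nat.div_lt_iff_lt_mul hW, hd]
        exact hs
      · rw [hd]; omega
      · simp only [zero_add, List.range'_one]
        rw [heads_cons_of_eq h1, hd]; rfl
    | succ j ih =>
      intro i hi
      obtain ⟨h1, h2⟩ := ih (i + 1) (by omega)
      have hd : (s * W + i) / W = s := by
        rw [mul_comm, Nat.mul_add_div hW, Nat.div_eq_of_lt (by omega), add_zero]
      have hm : (s * W + i) % W = i := by
        rw [mul_comm, Nat.mul_add_mod, Nat.mod_eq_of_lt (by omega)]
      have hi' : i < (blk s).length := by omega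
      have h3 : (rose n r W blk).lt (s * W + i) ≠ n := by
        change (blk ((s * W + i) / W)).getD ((s * W + i) % W) n ≠ n
        rw [hd, hm, List.getD_eq_getElem _ _ hi']
        exact (hb.letter hs (List.getElem_mem hi')).2
      rw [List.range'_succ]
      refine ⟨⟨rfl, s * W + i + 1, ⟨?_, Or.inr ⟨h3, rfl⟩⟩, h1⟩, ?_⟩
      · change s * W + i < (2 * r + 2) * W
        rw [← Nat.div_lt_iff_lt_mul hW, hd]
        exact hs
      · rw [heads_cons_of_ne h3]
        exact h2
  simpa using key (blk s).length 0 (by omega)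

/-- Every sequence of words without formal cancellation is read by the rose automaton. -/
theorem exists_path {w : List ℕ} {s t : ℕ} (hw : ∀ a ∈ w ++ [t], a < 2 * r + 2)
    (hc : (w ++ [t]).IsChain fun a a' => a + a' ≠ 2 * r + 1) (hs : (w ++ [t]).head? = some s) :
    ∃ π, (rose n r W blk).Path (s * W) π (t * W) ∧ heads n r W blk π = w ∧
      π.length ≤ W * w.length := by
  induction w generalizing s with
  | nil =>
    obtain rfl : t = s := by simpa using hs
    exact ⟨[], rfl, rfl, le_rfl⟩
  | cons a w ih =>
    obtain rfl : a = s := by simpa using hs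
    obtain ⟨s', hs'⟩ : ∃ s', (w ++ [t]).head? = some s' := by
      cases w <;> simp
    rw [List.cons_append, List.isChain_cons] at hc
    obtain ⟨π, h1, h2, h3⟩ := ih (fun a ha => hw a (List.mem_cons_of_mem _ ha)) hc.2 hs'
    have ha : a < 2 * r + 2 := hw a (by simp)
    have hs2 : s' < 2 * r + 2 := hw s' (List.mem_cons_of_mem _ (List.mem_of_mem_head? hs'))
    obtain ⟨h4, h5⟩ := path_block hb ha hs2 (hc.1 s' hs')
    refine ⟨_, Auto.path_append.mpr ⟨_, h4, h1⟩, ?_, ?_⟩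
    · rw [heads_append, h5, h2]; rfl
    · have := hb.length_lt ha
      rw [List.length_append, List.length_range', List.length_cons, Nat.mul_succ]
      omega

/-- If products of words other than `r` and `r + 1` determine the factors, then there is at most one
path of degree `0` between two states that spells `1`. -/
theorem rigid (h0 : ∀ u v : List ℕ, (∀ s ∈ u, s < 2 * r + 2 ∧ s ≠ r ∧ s ≠ r + 1) →
      (∀ s ∈ v, s < 2 * r + 2 ∧ s ≠ r ∧ s ≠ r + 1) →
      (u.IsChain fun s s' => s + s' ≠ 2 * r + 1) → (v.IsChain fun s s' => s + s' ≠ 2 * r + 1) →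
      (u.map fun s => spell n (blk s)).prod = (v.map fun s => spell n (blk s)).prod → u = v) :
    (rose n r W blk).Rigid := by
  rintro p q π π' ⟨hp, hv, hd, -⟩ ⟨hp', hv', hd', -⟩
  by_cases hpP : p < (2 * r + 2) * W
  · refine heads_injective hb hp hp' (h0 _ _ ?_ ?_ ?_ ?_ ?_)
    · intro s hs
      rw [deg_eq_countP, List.countP_eq_zero] at hd
      have := hd s hs
      simp only [decide_eq_true_eq, not_or] at this
      exact ⟨heads_lt hp s hs, this⟩
    · intro s hs
      rw [deg_eq_countP, List.countP_eq_zero] at hd'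
      have := hd' s hs
      simp only [decide_eq_true_eq, not_or] at this
      exact ⟨heads_lt hp' s hs, this⟩
    · exact (List.isChain_append.mp (isChain_heads hb hp)).1
    · exact (List.isChain_append.mp (isChain_heads hb hp')).1
    · have h1 := spell_val hb hpP hp
      have h2 := spell_val hb hpP hp'
      rw [show pathVal n (rose n r W blk).lt π = 1 from hv, mul_one] at h1
      rw [show pathVal n (rose n r W blk).lt π' = 1 from hv', mul_one] at h2
      exact mul_right_cancel (h1.symm.trans h2)
  · have h1 : ∀ π, (rose n r W blk).Path p π q → π = [] := by
      intro π h
      cases π with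
      | nil => rfl
      | cons s π =>
        obtain ⟨-, l, h1, -⟩ := h
        exact absurd h1.1 hpP
    rw [h1 π hp, h1 π' hp']

end

end Rose

/-! ### Words over a subgroup of a free group as paths -/

namespace FreeEq

/-- The letters `h i`, `x` and their inverses as numbers: `i` for `h i`, `r` for `x`, and
`2 * r + 1 - s` for the inverse of `s`. This is the letter with number `s`. -/
def letter (r s : ℕ) : Gen r × Bool :=
  if h : s < r then (some ⟨s, h⟩, true)
  else if s = r then (none, true)
  else if h : r + 1 < s ∧ s < 2 * r + 2 then (some ⟨2 * r + 1 - s, by omega⟩, false)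
  else (none, false)

/-- The number of a letter. -/
def letterNum (r : ℕ) (z : Gen r × Bool) : ℕ :=
  if z.2 then z.1.elim r Fin.val else 2 * r + 1 - z.1.elim r Fin.val

variable {n r : ℕ} {H : Subgroup (FreeGroup (Fin n))}

theorem letterNum_lt (z : Gen r × Bool) : letterNum r z < 2 * r + 2 := by
  rcases z with ⟨_ | i, _ | _⟩ <;> simp [letterNum] <;> omega

theorem letter_letterNum (z : Gen r × Bool) : letter r (letterNum r z) = z := by
  rcases z with ⟨_ | i, _ | _⟩
  · have h1 : ¬ (2 * r + 1 - r < r) := by omega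
    have h2 : ¬ (2 * r + 1 - r = r) := by omega
    have h3 : ¬ (r + 1 < 2 * r + 1 - r ∧ 2 * r + 1 - r < 2 * r + 2) := by omega
    simp [letterNum, letter, h1, h2, h3]
  · simp [letterNum, letter]
  · have hi := i.2
    have h1 : ¬ (2 * r + 1 - i < r) := by omega
    have h2 : ¬ (2 * r + 1 - i = r) := by omega
    have h3 : r + 1 < 2 * r + 1 - i ∧ 2 * r + 1 - i < 2 * r + 2 := by omega
    simp only [letterNum, letter, Bool.false_eq_true, if_false, Option.elim_some, dif_neg h1,
      if_neg h2, dif_pos h3]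
    congr 2
    ext
    simp only
    omega
  · simp [letterNum, letter]

theorem letterNum_letter {s : ℕ} (hs : s < 2 * r + 2) : letterNum r (letter r s) = s := by
  unfold letter
  split_ifs with h1 h2 h3
  · simp [letterNum]
  · simp [letterNum, h2]
  · simp [letterNum]; omega
  · simp [letterNum]; omega

theorem letter_cancel_iff {s t : ℕ} (hs : s < 2 * r + 2) (ht : t < 2 * r + 2) :
    ((letter r s).1 = (letter r t).1 → (letter r s).2 = (letter r t).2) ↔ s + t ≠ 2 * r + 1 := by
  unfold letter
  split_ifs <;> simp <;> omega

theorem letter_isNone {s : ℕ} (hs : s < 2 * r + 2) :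
    (letter r s).1.isNone = decide (s = r ∨ s = r + 1) := by
  unfold letter
  split_ifs <;> simp <;> omega

theorem letter_inv {s : ℕ} (hs : s ≤ r) :
    letter r (2 * r + 1 - s) = ((letter r s).1, !(letter r s).2) := by
  unfold letter
  rcases Nat.lt_or_eq_of_le hs with h | rfl
  · rw [dif_neg (by omega), if_neg (by omega), dif_pos (by omega), dif_pos h]
    simp; omega
  · rw [dif_neg (by omega), if_neg (by omega), dif_neg (by omega), dif_neg (by omega), if_pos rfl]
    rfl

theorem isReduced_map_letter {w : List ℕ} (hw : ∀ s ∈ w, s < 2 * r + 2) :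
    FreeGroup.IsReduced (w.map (letter r)) ↔ w.IsChain fun s t => s + t ≠ 2 * r + 1 := by
  rw [FreeGroup.IsReduced, List.isChain_map]
  induction w with
  | nil => simp
  | cons s w ih =>
    rw [List.isChain_cons, List.isChain_cons, ih fun t ht => hw t (List.mem_cons_of_mem _ ht)]
    refine and_congr_left fun _ => forall₂_congr fun t ht => ?_
    exact letter_cancel_iff (hw s (by simp)) (hw t (List.mem_cons_of_mem _ (List.mem_of_mem_head? ht)))

theorem isCyclicallyReduced_map_letter {s : ℕ} {w : List ℕ} (hw : ∀ a ∈ s :: w, a < 2 * r + 2) :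
    FreeGroup.IsCyclicallyReduced ((s :: w).map (letter r)) ↔
      (s :: w ++ [s]).IsChain fun s t => s + t ≠ 2 * r + 1 := by
  rw [FreeGroup.IsCyclicallyReduced, isReduced_map_letter hw, List.isChain_append]
  refine and_congr_right fun _ => ?_
  rw [List.getLast?_map, List.map_cons]
  simp only [List.isChain_singleton, true_and, List.head?_cons, Option.mem_def, Option.some.injEq,
    forall_eq', Option.map_eq_some_iff, forall_exists_index, and_imp, forall_apply_eq_imp_iff₂]
  refine forall₂_congr fun t ht => ?_
  exact letter_cancel_iff (hw t (List.mem_of_getLast? ht)) (hw s (by simp))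

/-- The evaluation at `g` as a homomorphism from the free group on `h 1, …, h r, x`. -/
def evalFree (b : FreeGroupBasis (Fin r) H) (g : FreeGroup (Fin n)) :
    FreeGroup (Gen r) →* FreeGroup (Fin n) :=
  (evalHom H g).comp (genEquiv b).toMonoidHom

theorem genEquiv_of_some (b : FreeGroupBasis (Fin r) H) (i : Fin r) :
    genEquiv b (FreeGroup.of (some i)) = Monoid.Coprod.inl (b i) := by
  simp [genEquiv]

theorem genEquiv_of_none (b : FreeGroupBasis (Fin r) H) :
    genEquiv b (FreeGroup.of none) = x H := by
  simp [genEquiv]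

theorem evalFree_of_some (b : FreeGroupBasis (Fin r) H) (g : FreeGroup (Fin n)) (i : Fin r) :
    evalFree b g (FreeGroup.of (some i)) = (b i : FreeGroup (Fin n)) := by
  change evalHom H g (genEquiv b (FreeGroup.of (some i))) = _
  rw [genEquiv_of_some, evalHom, Monoid.Coprod.lift_apply_inl]; rfl

theorem evalFree_of_none (b : FreeGroupBasis (Fin r) H) (g : FreeGroup (Fin n)) :
    evalFree b g (FreeGroup.of none) = g := by
  change evalHom H g (genEquiv b (FreeGroup.of none)) = _
  rw [genEquiv_of_none, evalHom, x, Monoid.Coprod.lift_apply_inr]; simp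

theorem evalFree_map_some (b : FreeGroupBasis (Fin r) H) (g : FreeGroup (Fin n))
    (y : FreeGroup (Fin r)) :
    evalFree b g (FreeGroup.map some y) = (b.repr.symm y : FreeGroup (Fin n)) := by
  have h : (evalFree b g).comp (FreeGroup.map some) =
      H.subtype.comp b.repr.symm.toMonoidHom := by
    ext i : 1
    simp only [MonoidHom.comp_apply, FreeGroup.map.of, evalFree_of_some]
    rfl
  exact DFunLike.congr_fun h y

/-- A reduced word without the letter `x` is determined by the element that it represents, because the
`h i` are a basis. -/
theorem eq_of_evalFree_eq (b : FreeGroupBasis (Fin r) H) (g : FreeGroup (Fin n))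
    {u v : List (Gen r × Bool)} (hu : FreeGroup.IsReduced u) (hv : FreeGroup.IsReduced v)
    (hu0 : ∀ z ∈ u, z.1.isSome) (hv0 : ∀ z ∈ v, z.1.isSome)
    (h : evalFree b g (FreeGroup.mk u) = evalFree b g (FreeGroup.mk v)) : u = v := by
  have key : ∀ u : List (Gen r × Bool), (∀ z ∈ u, z.1.isSome) →
      ∃ u' : List (Fin r × Bool), u'.map (fun z => (some z.1, z.2)) = u := by
    intro u hu
    induction u with
    | nil => exact ⟨[], rfl⟩
    | cons z u ih =>
      obtain ⟨u', rfl⟩ := ih fun z hz => hu z (List.mem_cons_of_mem _ hz)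
      obtain ⟨i, hi⟩ := Option.isSome_iff_exists.mp (hu z (by simp))
      exact ⟨(i, z.2) :: u', by rw [List.map_cons, ← hi]⟩
  obtain ⟨u', rfl⟩ := key u hu0
  obtain ⟨v', rfl⟩ := key v hv0
  rw [← FreeGroup.map.mk, ← FreeGroup.map.mk, evalFree_map_some, evalFree_map_some] at h
  have h1 := congrArg (FreeGroup.map (some : Fin r → Gen r))
    (b.repr.symm.injective (Subtype.ext h))
  rw [FreeGroup.map.mk, FreeGroup.map.mk] at h1
  rw [← hu.reduce_eq, ← hv.reduce_eq]
  exact FreeGroup.reduce.sound h1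

theorem reduceCyclically_eq_self {α : Type*} [DecidableEq α] {w : List (α × Bool)}
    (hw : FreeGroup.IsCyclicallyReduced w) : FreeGroup.reduceCyclically w = w := by
  rcases List.eq_nil_or_concat' w with rfl | ⟨u, c, rfl⟩
  · simp
  rcases u with _ | ⟨a, u⟩
  · simp
  · rw [FreeGroup.isCyclicallyReduced_cons_append_iff (L := u)] at hw
    rw [List.cons_append, FreeGroup.reduceCyclically.cons_append, if_neg]
    · rfl
    · rintro ⟨h1, h2⟩
      rw [← hw.2 h1] at h2
      simp at h2

/-- The words counted by `rho`. -/
theorem mem_cyclicLanguage (b : FreeGroupBasis (Fin r) H) (g : FreeGroup (Fin n)) (d : ℕ)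
    (w : List (Gen r × Bool)) : w ∈ cyclicLanguage b (idealDeg b g d) ↔
      FreeGroup.IsCyclicallyReduced w ∧ evalFree b g (FreeGroup.mk w) = 1 ∧ xCount w = d := by
  refine and_congr_right fun hw => ?_
  refine (and_congr_right fun _ => ?_)
  rw [degree, wordElement, MulEquiv.symm_apply_apply, FreeGroup.toWord_mk, hw.1.reduce_eq,
    reduceCyclically_eq_self hw]

theorem cyclicLanguage_nonempty (b : FreeGroupBasis (Fin r) H) (g : FreeGroup (Fin n)) (d : ℕ) :
    (idealDeg b g d).Nonempty ↔ ∃ w, w ∈ cyclicLanguage b (idealDeg b g d) := by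
  constructor
  · rintro ⟨y, hy, hd⟩
    set w := ((genEquiv b).symm y).toWord with hw
    refine ⟨FreeGroup.reduceCyclically w, (mem_cyclicLanguage b g d _).mpr
      ⟨FreeGroup.reduceCyclically.isCyclicallyReduced FreeGroup.isReduced_toWord, ?_, hd⟩⟩
    have h1 : evalFree b g (FreeGroup.mk w) = 1 := by
      rw [hw, FreeGroup.mk_toWord]
      change evalHom H g (genEquiv b _) = 1
      rw [MulEquiv.apply_symm_apply]
      exact hy
    have h2 := FreeGroup.reduceCyclically.conj_conjugator_reduceCyclically w
    rw [← h2, ← FreeGroup.mul_mk, ← FreeGroup.mul_mk, ← FreeGroup.inv_mk, map_mul, map_mul, map_inv]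
      at h1
    exact conj_eq_one_iff.mp h1
  · rintro ⟨w, -, hw⟩
    exact ⟨_, hw⟩

/-- The reduced words of `h 0, …, h (r - 1)`, and then of `g`. -/
def baseWord (b : FreeGroupBasis (Fin r) H) (g : FreeGroup (Fin n)) (j : ℕ) : List (Fin n × Bool) :=
  if h : j < r then (b ⟨j, h⟩ : FreeGroup (Fin n)).toWord else g.toWord

/-- The code of a letter of `FreeGroup (Fin n)`. -/
def codeOf (z : Fin n × Bool) : ℕ := if z.2 then n + 1 + z.1 else n - 1 - z.1

/-- The word that is substituted for the letter with number `s`, as a list of codes. -/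
def block (b : FreeGroupBasis (Fin r) H) (g : FreeGroup (Fin n)) (s : ℕ) : List ℕ :=
  if s ≤ r then (baseWord b g s).map codeOf
  else ((baseWord b g (2 * r + 1 - s)).map fun z => 2 * n - codeOf z).reverse

theorem codeOf_le (z : Fin n × Bool) : codeOf z ≤ 2 * n ∧ codeOf z ≠ n := by
  have := z.1.2
  unfold codeOf
  split_ifs <;> omega

theorem codeVal_codeOf (z : Fin n × Bool) : codeVal n (codeOf z) = FreeGroup.mk [z] := by
  obtain ⟨i, b⟩ := z
  have := i.2
  cases b
  · simp only [codeVal, codeOf, codeWord, Bool.false_eq_true, if_false]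
    rw [dif_neg (by omega), dif_pos (by omega)]
    congr 3
    ext
    simp only
    omega
  · simp only [codeVal, codeOf, codeWord, if_true]
    rw [dif_pos (by omega)]
    congr 3
    ext
    simp only
    omega

theorem spell_map_codeOf (w : List (Fin n × Bool)) : Rose.spell n (w.map codeOf) = FreeGroup.mk w := by
  induction w with
  | nil => rfl
  | cons z w ih =>
    rw [Rose.spell] at ih ⊢
    rw [List.map_cons, List.map_cons, List.prod_cons, ih, codeVal_codeOf, FreeGroup.mul_mk]
    rfl

theorem spell_reverse {w : List ℕ} (hw : ∀ c ∈ w, c ≤ 2 * n) :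
    Rose.spell n (w.map (2 * n - ·)).reverse = (Rose.spell n w)⁻¹ := by
  induction w with
  | nil => simp [Rose.spell]
  | cons c w ih =>
    have h := ih fun c hc => hw c (List.mem_cons_of_mem _ hc)
    rw [Rose.spell] at h ⊢
    rw [List.map_cons, List.reverse_cons, List.map_append, List.prod_append, h, List.map_singleton,
      List.prod_singleton, codeVal_inv (hw c (by simp)), Rose.spell, Rose.spell, List.map_cons,
      List.prod_cons, mul_inv_rev]

variable (b : FreeGroupBasis (Fin r) H) (g : FreeGroup (Fin n))

theorem spell_block_of_le {s : ℕ} (hs : s ≤ r) :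
    Rose.spell n (block b g s) = evalFree b g (FreeGroup.mk [letter r s]) := by
  rw [block, if_pos hs, spell_map_codeOf]
  rcases Nat.lt_or_eq_of_le hs with h | rfl
  · rw [baseWord, dif_pos h, FreeGroup.mk_toWord, letter, dif_pos h]
    exact (evalFree_of_some b g ⟨s, h⟩).symm
  · rw [baseWord, dif_neg (lt_irrefl _), FreeGroup.mk_toWord, letter, dif_neg (lt_irrefl _), if_pos rfl]
    exact (evalFree_of_none b g).symm

theorem spell_block {s : ℕ} (hs : s < 2 * r + 2) :
    Rose.spell n (block b g s) = evalFree b g (FreeGroup.mk [letter r s]) := by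
  by_cases h : s ≤ r
  · exact spell_block_of_le b g h
  · have h1 := spell_block_of_le b g (s := 2 * r + 1 - s) (by omega)
    have h2 := letter_inv (r := r) (s := 2 * r + 1 - s) (by omega)
    rw [show 2 * r + 1 - (2 * r + 1 - s) = s by omega] at h2
    rw [block, if_pos (by omega)] at h1
    rw [block, if_neg h, h2, show (fun z : Fin n × Bool => 2 * n - codeOf z) = (2 * n - ·) ∘ codeOf from rfl,
      ← List.map_map, spell_reverse, h1, ← map_inv, FreeGroup.inv_mk]
    · rfl
    · intro c hc
      obtain ⟨z, -, rfl⟩ := List.mem_map.mp hc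
      exact (codeOf_le z).1

theorem spell_blocks {w : List ℕ} (hw : ∀ s ∈ w, s < 2 * r + 2) :
    (w.map fun s => Rose.spell n (block b g s)).prod =
      evalFree b g (FreeGroup.mk (w.map (letter r))) := by
  induction w with
  | nil => exact (map_one _).symm
  | cons s w ih =>
    rw [List.map_cons, List.prod_cons, ih fun s hs => hw s (List.mem_cons_of_mem _ hs),
      spell_block b g (hw s (by simp)), ← map_mul, FreeGroup.mul_mk]
    rfl

theorem blocks {W : ℕ} (hW : ∀ j ≤ r, (baseWord b g j).length < W) :
    Blocks n r W (block b g) where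
  length_lt {s} hs := by
    rw [block]
    split_ifs with h
    · rw [List.length_map]; exact hW s h
    · rw [List.length_reverse, List.length_map]; exact hW _ (by omega)
  letter {s c} hs hc := by
    rw [block] at hc
    split_ifs at hc with h
    · obtain ⟨z, -, rfl⟩ := List.mem_map.mp hc
      exact codeOf_le z
    · obtain ⟨z, -, rfl⟩ := List.mem_map.mp (List.mem_reverse.mp hc)
      have := codeOf_le z
      omega

variable {b g}

theorem xCount_map_letter {w : List ℕ} (hw : ∀ s ∈ w, s < 2 * r + 2) :
    xCount (w.map (letter r)) = w.countP fun s => s = r ∨ s = r + 1 := by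
  rw [xCount, List.countP_map]
  refine List.countP_congr fun s hs => ?_
  rw [Function.comp_apply, letter_isNone (hw s hs)]

section
variable {W : ℕ} (hW : ∀ j ≤ r, (baseWord b g j).length < W)
include hW

theorem rose_rigid : (rose n r W (block b g)).Rigid := by
  have hb := blocks b g hW
  refine Rose.rigid hb fun u v hu hv hu' hv' h => ?_
  have key : ∀ u : List ℕ, (∀ s ∈ u, s < 2 * r + 2 ∧ s ≠ r ∧ s ≠ r + 1) →
      ∀ z ∈ u.map (letter r), z.1.isSome := by
    intro u hu z hz
    obtain ⟨s, hs, rfl⟩ := List.mem_map.mp hz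
    obtain ⟨h1, h2, h3⟩ := hu s hs
    have := letter_isNone h1
    rw [← Option.not_isNone, this]
    simp [h2, h3]
  rw [spell_blocks b g fun s hs => (hu s hs).1, spell_blocks b g fun s hs => (hv s hs).1] at h
  have h1 := eq_of_evalFree_eq b g ((isReduced_map_letter fun s hs => (hu s hs).1).mpr hu')
    ((isReduced_map_letter fun s hs => (hv s hs).1).mpr hv') (key u hu) (key v hv) h
  have h2 := congrArg (List.map (letterNum r)) h1
  rw [List.map_map, List.map_map] at h2
  have h3 : ∀ u : List ℕ, (∀ s ∈ u, s < 2 * r + 2 ∧ s ≠ r ∧ s ≠ r + 1) →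
      u.map (letterNum r ∘ letter r) = u := fun u hu =>
    (List.map_congr_left fun s hs => letterNum_letter (hu s hs).1).trans (List.map_id u)
  rwa [h3 u hu, h3 v hv] at h2

/-- A closed path at the beginning of a word that spells `1` and has positive degree reads a
cyclically reduced word in the ideal. -/
theorem map_letter_mem {s d : ℕ} (hs : s < 2 * r + 2) (hd : 0 < d) {π : List ℕ}
    (hπ : π ∈ (rose n r W (block b g)).X n (s * W) (s * W) d) :
    (Rose.heads n r W (block b g) π).map (letter r) ∈ cyclicLanguage b (idealDeg b g d) := by
  have hb := blocks b g hW
  obtain ⟨h1, h2, h3, -⟩ := hπ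
  have hlt := Rose.heads_lt h1
  have hW0 := Rose.W_pos hb
  have h4 := Rose.isChain_heads hb h1
  have h5 := Rose.head_heads hb h1
  have h6 := Rose.spell_val hb (Rose.start_lt hb hs) h1
  rw [show pathVal n (rose n r W (block b g)).lt π = 1 from h2] at h6
  rw [Nat.mul_div_cancel _ hW0] at h4 h5
  rw [Nat.mul_mod_left, List.take_zero, mul_one, show Rose.spell n [] = 1 from rfl, mul_one,
    spell_blocks b g hlt] at h6
  rw [Rose.deg_eq_countP] at h3
  rw [mem_cyclicLanguage]
  refine ⟨?_, h6.symm, (xCount_map_letter hlt).trans h3⟩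
  generalize Rose.heads n r W (block b g) π = w at *
  cases w with
  | nil => simp at h3; omega
  | cons a w =>
    obtain rfl : a = s := by simpa using h5
    exact (isCyclicallyReduced_map_letter hlt).mpr h4

/-- Every cyclically reduced word of positive degree in the ideal is read by a closed path. -/
theorem exists_mem_X {d M : ℕ} (hd : 0 < d) {w : List (Gen r × Bool)}
    (hw : w ∈ cyclicLanguage b (idealDeg b g d)) (hM : w.length ≤ M) :
    ∃ s < 2 * r + 2, ∃ π ∈ (rose n r W (block b g)).X n (s * W) (s * W) d,
      π.length ≤ W * M ∧ (Rose.heads n r W (block b g) π).map (letter r) = w := by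
  have hb := blocks b g hW
  obtain ⟨h1, h2, h3⟩ := (mem_cyclicLanguage b g d w).mp hw
  have hlt : ∀ s ∈ w.map (letterNum r), s < 2 * r + 2 := by
    intro s hs
    obtain ⟨z, -, rfl⟩ := List.mem_map.mp hs
    exact letterNum_lt z
  have hw' : (w.map (letterNum r)).map (letter r) = w := by
    rw [List.map_map]
    exact (List.map_congr_left fun z _ => letter_letterNum z).trans (List.map_id w)
  rw [← hw', xCount_map_letter hlt] at h3
  rw [← hw'] at h1 h2
  rw [← List.length_map (letterNum r)] at hM
  rw [← hw']
  generalize w.map (letterNum r) = u at *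
  cases u with
  | nil => simp at h3; omega
  | cons s u =>
    have hs := hlt s (by simp)
    have hW0 := Rose.W_pos hb
    obtain ⟨π, h4, h5, h6⟩ := Rose.exists_path hb (w := s :: u) (t := s) (s := s)
      (fun a ha => by
        rcases List.mem_append.mp ha with h | h
        · exact hlt a h
        · rw [List.mem_singleton.mp h]; exact hs)
      ((isCyclicallyReduced_map_letter hlt).mp h1) rfl
    refine ⟨s, hs, π, ⟨h4, ?_, ?_, fun _ _ _ => rfl⟩, h6.trans (Nat.mul_le_mul_left _ hM), by rw [h5]⟩
    · have h7 := Rose.spell_val hb (Rose.start_lt hb hs) h4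
      rwa [Nat.mul_mod_left, List.take_zero, show Rose.spell n [] = 1 from rfl, one_mul, mul_one, h5,
        spell_blocks b g hlt, h2] at h7
    · rw [Rose.deg_eq_countP, h5, h3]

end

/-- The number of words of length at most `M` that `rho` counts. -/
noncomputable def wordCount (b : FreeGroupBasis (Fin r) H) (g : FreeGroup (Fin n)) (d M : ℕ) : ℕ :=
  {w : List (Gen r × Bool) | w ∈ cyclicLanguage b (idealDeg b g d) ∧ w.length ≤ M}.ncard

theorem rho_eq_wordCount (b : FreeGroupBasis (Fin r) H) (g : FreeGroup (Fin n)) (d : ℕ) {M : ℝ}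
    (hM : 0 ≤ M) : rho b g d M = wordCount b g d ⌊M⌋₊ := by
  rw [rho, languageGrowth, wordCount]
  simp only [Nat.le_floor_iff hM]

theorem finite_words (b : FreeGroupBasis (Fin r) H) (g : FreeGroup (Fin n)) (d M : ℕ) :
    {w : List (Gen r × Bool) | w ∈ cyclicLanguage b (idealDeg b g d) ∧ w.length ≤ M}.Finite :=
  (List.finite_length_le _ M).subset fun _ h => h.2

/-- The nonterminal for the closed paths at the beginning of the word `s`. -/
def startSym (n r W s : ℕ) : ℕ := Auto.enc ((2 * r + 2) * W) n (s * W) (s * W)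

section
variable {W : ℕ} (hW : ∀ j ≤ r, (baseWord b g j).length < W)
include hW

theorem mem_pathSet_startSym {s d M : ℕ} (hs : s < 2 * r + 2) {π : List ℕ} :
    π ∈ (rose n r W (block b g)).pathSet (startSym n r W s) d M ↔
      π ∈ (rose n r W (block b g)).X n (s * W) (s * W) d ∧ π.length ≤ M :=
  have h := (Rose.start_lt (blocks b g hW) hs).le
  Auto.mem_pathSet_enc (𝒜 := rose n r W (block b g)) (by change n ≤ 2 * n; omega) h h

theorem count_le_wordCount {s d : ℕ} (hs : s < 2 * r + 2) (hd : 0 < d) (M : ℕ) :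
    (rose n r W (block b g)).count (startSym n r W s) d M ≤ wordCount b g d M := by
  refine Set.ncard_le_ncard_of_injOn
    (fun π => (Rose.heads n r W (block b g) π).map (letter r)) ?_ ?_ (finite_words b g d M)
  · intro π hπ
    obtain ⟨h1, h2⟩ := (mem_pathSet_startSym hW hs).mp hπ
    refine ⟨map_letter_mem hW hs hd h1, ?_⟩
    rw [List.length_map]
    exact (Rose.length_heads_le π).trans h2
  · intro π hπ π' hπ' he
    obtain ⟨h1, -⟩ := (mem_pathSet_startSym hW hs).mp hπ
    obtain ⟨h2, -⟩ := (mem_pathSet_startSym hW hs).mp hπ'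
    refine Rose.heads_injective (blocks b g hW) h1.1 h2.1 ?_
    have h3 := congrArg (List.map (letterNum r)) he
    simp only [List.map_map] at h3
    have h4 : ∀ u : List ℕ, (∀ s ∈ u, s < 2 * r + 2) → u.map (letterNum r ∘ letter r) = u :=
      fun u hu => (List.map_congr_left fun s hs => letterNum_letter (hu s hs)).trans (List.map_id u)
    rwa [h4 _ (Rose.heads_lt h1.1), h4 _ (Rose.heads_lt h2.1)] at h3

theorem wordCount_le_sum {d : ℕ} (hd : 0 < d) (M : ℕ) : wordCount b g d M ≤
    ∑ s ∈ Finset.range (2 * r + 2), (rose n r W (block b g)).count (startSym n r W s) d (W * M) := by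
  have hsub : {w : List (Gen r × Bool) | w ∈ cyclicLanguage b (idealDeg b g d) ∧ w.length ≤ M} ⊆
      ⋃ s ∈ Finset.range (2 * r + 2), (fun π => (Rose.heads n r W (block b g) π).map (letter r)) ''
        (rose n r W (block b g)).pathSet (startSym n r W s) d (W * M) := by
    rintro w ⟨hw, hM⟩
    obtain ⟨s, hs, π, hπ, h1, h2⟩ := exists_mem_X hW hd hw hM
    simp only [Set.mem_iUnion, Finset.mem_range]
    exact ⟨s, hs, π, (mem_pathSet_startSym hW hs).mpr ⟨hπ, h1⟩, h2⟩
  have hfin : ∀ s ∈ Finset.range (2 * r + 2),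
      ((fun π => (Rose.heads n r W (block b g) π).map (letter r)) ''
        (rose n r W (block b g)).pathSet (startSym n r W s) d (W * M)).Finite :=
    fun s _ => (Auto.finite_pathSet _ _ _).image _
  refine (Set.ncard_le_ncard hsub (Set.Finite.biUnion (Finset.finite_toSet _) hfin)).trans ?_
  refine (Finset.set_ncard_biUnion_le _ _).trans (Finset.sum_le_sum fun s _ => ?_)
  exact Set.ncard_image_le (Auto.finite_pathSet _ _ _)

end

end FreeEq

/-! ### Growth functions of real arguments -/

section
variable {f : ℕ → ℕ} {ρ : ℝ → ℝ}

theorem exists_le_floor {a : ℕ} (ha : 0 < a) {M : ℝ} (hM : 4 * a ≤ M) :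
    ∃ m : ℕ, a * m + a ≤ ⌊M⌋₊ ∧ M / (2 * a) ≤ m := by
  have ha' : (0 : ℝ) < a := by exact_mod_cast ha
  have h0 : 0 ≤ M := by linarith
  have h1 : (4 : ℝ) ≤ M / a := by rwa [le_div_iff₀ ha']
  have h2 : 4 ≤ ⌊M / a⌋₊ := Nat.le_floor (by exact_mod_cast h1)
  have h3 := Nat.floor_le (div_nonneg h0 ha'.le)
  have h4 := Nat.lt_floor_add_one (M / a)
  obtain ⟨m, hm⟩ : ∃ m, ⌊M / a⌋₊ = m + 1 := ⟨⌊M / a⌋₊ - 1, by omega⟩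
  rw [hm] at h2 h3 h4
  refine ⟨m, Nat.le_floor ?_, ?_⟩
  · rw [le_div_iff₀ ha'] at h3
    push_cast at h3 ⊢
    linarith
  · have h5 : M / (2 * a) = M / a / 2 := by field_simp
    have h6 : (3 : ℝ) ≤ m := by exact_mod_cast (show 3 ≤ m by omega)
    push_cast at h4
    rw [h5]
    linarith

theorem eventually_ge_of_growsPoly (hf : Monotone f) (hρ : ∀ M, 0 ≤ M → ρ M = f ⌊M⌋₊) {k : ℕ}
    (h : GrowsPoly f k) : ∃ α : ℝ, 0 < α ∧ ∀ᶠ M in atTop, α * M ^ k ≤ ρ M := by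
  obtain ⟨a, h⟩ := h
  have ha : (0 : ℝ) < (a + 1 : ℕ) := by positivity
  refine ⟨(1 / (2 * (a + 1 : ℕ))) ^ k, by positivity, ?_⟩
  filter_upwards [eventually_ge_atTop (4 * (a + 1 : ℕ) : ℝ)] with M hM
  have h0 : 0 ≤ M := by linarith
  obtain ⟨m, h1, h2⟩ := exists_le_floor (Nat.succ_pos a) hM
  rw [hρ M h0]
  have h3 : (m + 1) ^ k ≤ f ⌊M⌋₊ := (h m).trans (hf (le_trans (by nlinarith) h1))
  have h4 : ((m : ℝ) + 1) ^ k ≤ f ⌊M⌋₊ := by exact_mod_cast h3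
  rw [← mul_pow]
  refine (pow_le_pow_left₀ (by positivity) ?_ k).trans h4
  rw [one_div_mul_eq_div]
  linarith

theorem eventually_le_of_boundedPoly (hρ : ∀ M, 0 ≤ M → ρ M = f ⌊M⌋₊) {k : ℕ}
    (h : BoundedPoly f k) : ∃ β : ℝ, 0 < β ∧ ∀ᶠ M in atTop, ρ M ≤ β * M ^ k := by
  obtain ⟨K, h⟩ := h
  refine ⟨(K + 1) * 2 ^ k, by positivity, ?_⟩
  filter_upwards [eventually_ge_atTop (1 : ℝ)] with M hM
  rw [hρ M (by linarith)]
  have h1 : (f ⌊M⌋₊ : ℝ) ≤ K * (⌊M⌋₊ + 1) ^ k := by exact_mod_cast h ⌊M⌋₊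
  have h2 := Nat.floor_le (show 0 ≤ M by linarith)
  have h3 : ((⌊M⌋₊ : ℝ) + 1) ^ k ≤ (2 * M) ^ k := pow_le_pow_left₀ (by positivity) (by linarith) k
  rw [mul_assoc, ← mul_pow]
  refine h1.trans (mul_le_mul (by linarith) h3 (by positivity) (by positivity))

theorem eventually_ge_of_growsExp (hf : Monotone f) (hρ : ∀ M, 0 ≤ M → ρ M = f ⌊M⌋₊)
    (h : GrowsExp f) : ∃ α : ℝ, 0 < α ∧ ∀ᶠ M in atTop, Real.exp (α * M) ≤ ρ M := by
  obtain ⟨a, h⟩ := h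
  have ha : (0 : ℝ) < (a + 1 : ℕ) := by positivity
  have hl : 0 < Real.log 2 := Real.log_pos (by norm_num)
  refine ⟨Real.log 2 / (2 * (a + 1 : ℕ)), by positivity, ?_⟩
  filter_upwards [eventually_ge_atTop (4 * (a + 1 : ℕ) : ℝ)] with M hM
  have h0 : 0 ≤ M := by linarith
  obtain ⟨m, h1, h2⟩ := exists_le_floor (Nat.succ_pos a) hM
  rw [hρ M h0]
  have h3 : 2 ^ m ≤ f ⌊M⌋₊ := (h m).trans (hf (le_trans (by nlinarith) h1))
  have h4 : (2 : ℝ) ^ m ≤ f ⌊M⌋₊ := by exact_mod_cast h3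
  refine le_trans ?_ h4
  rw [← Real.exp_log (show (0 : ℝ) < 2 ^ m by positivity), Real.log_pow, Real.exp_le_exp]
  calc Real.log 2 / (2 * (a + 1 : ℕ)) * M = M / (2 * (a + 1 : ℕ)) * Real.log 2 := by ring
    _ ≤ m * Real.log 2 := by gcongr

theorem eventually_le_of_le_pow (hρ : ∀ M, 0 ≤ M → ρ M = f ⌊M⌋₊) {Q : ℕ} (hQ : 2 ≤ Q)
    (h : ∀ M, f M ≤ Q ^ M) : ∃ β : ℝ, 0 < β ∧ ∀ᶠ M in atTop, ρ M ≤ Real.exp (β * M) := by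
  have hQ' : (1 : ℝ) < Q := by exact_mod_cast hQ
  have hl : 0 < Real.log Q := Real.log_pos hQ'
  refine ⟨Real.log Q, hl, ?_⟩
  filter_upwards [eventually_ge_atTop (0 : ℝ)] with M hM
  rw [hρ M hM]
  have h1 : (f ⌊M⌋₊ : ℝ) ≤ (Q : ℝ) ^ ⌊M⌋₊ := by exact_mod_cast h ⌊M⌋₊
  refine h1.trans ?_
  rw [← Real.exp_log (show (0 : ℝ) < (Q : ℝ) ^ ⌊M⌋₊ by positivity), Real.log_pow, Real.exp_le_exp,
    mul_comm]
  exact mul_le_mul_of_nonneg_left (Nat.floor_le hM) hl.le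

theorem not_exp_le_of_le_pow {α β : ℝ} (hα : 0 < α) {k : ℕ}
    (h1 : ∀ᶠ M in atTop, Real.exp (α * M) ≤ ρ M) (h2 : ∀ᶠ M in atTop, ρ M ≤ β * M ^ k) : False := by
  have h3 := isLittleO_pow_exp_pos_mul_atTop (k := k) hα
  have hc : (0 : ℝ) < 1 / (2 * (|β| + 1)) := by positivity
  have h4 := h3.def hc
  obtain ⟨M, h1, h2, h4, h5⟩ := (h1.and (h2.and (h4.and (eventually_ge_atTop (0 : ℝ))))).exists
  rw [Real.norm_of_nonneg (by positivity), Real.norm_of_nonneg (Real.exp_pos _).le,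
    one_div_mul_eq_div, le_div_iff₀ (by positivity)] at h4
  have h6 := Real.exp_pos (α * M)
  have h7 : β * M ^ k ≤ |β| * M ^ k := mul_le_mul_of_nonneg_right (le_abs_self β) (by positivity)
  have h8 : 0 ≤ M ^ k := by positivity
  nlinarith [abs_nonneg β]

theorem HasExponentialGrowth.not_polynomial {k : ℕ} (h1 : HasExponentialGrowth ρ)
    (h2 : HasPolynomialGrowth ρ k) : False := by
  obtain ⟨α, _, hα, _, h1⟩ := h1
  obtain ⟨_, β, _, _, h2⟩ := h2
  exact not_exp_le_of_le_pow hα (h1.mono fun _ h => h.1) (h2.mono fun _ h => h.2)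

end

theorem ncard_words_le {α : Type*} [Fintype α] (S : Set (List α)) (M : ℕ) :
    {w | w ∈ S ∧ w.length ≤ M}.ncard ≤ (Fintype.card α + 1) ^ M := by
  have h : ({w : List α | w ∈ S ∧ w.length ≤ M}).ncard ≤
      (Set.univ : Set (Fin M → Option α)).ncard := by
    refine Set.ncard_le_ncard_of_injOn (fun w i => w[(i : ℕ)]?) (fun _ _ => Set.mem_univ _) ?_
      Set.finite_univ
    rintro w ⟨-, hw⟩ w' ⟨-, hw'⟩ h
    refine List.ext_getElem? fun i => ?_
    by_cases hi : i < M
    · exact congrFun h ⟨i, hi⟩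
    · rw [List.getElem?_eq_none (by omega), List.getElem?_eq_none (by omega)]
  rw [Set.ncard_univ, Nat.card_eq_fintype_card, Fintype.card_fun, Fintype.card_option,
    Fintype.card_fin] at h
  exact h

/-! ### The growth of the ideal in a fixed degree -/

theorem Grammar.A.of_le {G : Grammar} {V σ k v w : ℕ} (h : G.A V σ k v) (hw : w ≤ v) :
    G.A V σ k w := by
  cases h with
  | zero h => rw [Nat.le_zero.mp hw]; exact .zero h
  | rule ha hk hs h1 h2 hv h =>
    refine .rule ha hk hs h1 h2 (hw.trans hv) (h.imp id (Or.imp (fun h => hw.trans h) ?_))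
    rintro ⟨h3, h4⟩
    exact ⟨hw.trans h3, h4⟩

namespace FreeEq

variable {n r : ℕ} {H : Subgroup (FreeGroup (Fin n))} {b : FreeGroupBasis (Fin r) H}
  {g : FreeGroup (Fin n)}

theorem wordCount_mono (d : ℕ) : Monotone (wordCount b g d) := fun _ _ h =>
  Set.ncard_le_ncard (fun _ hw => ⟨hw.1, hw.2.trans h⟩) (finite_words _ _ _ _)

/-- In degree `0` there is only the trivial equation, because the `h i` are a basis. -/
theorem hasPolynomialGrowth_zero : HasPolynomialGrowth (rho b g 0) 0 := by
  refine ⟨1, 1, one_pos, one_pos, ?_⟩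
  filter_upwards [eventually_ge_atTop (0 : ℝ)] with M hM
  have h : wordCount b g 0 ⌊M⌋₊ = 1 := by
    rw [wordCount, Set.ncard_eq_one]
    refine ⟨[], Set.eq_singleton_iff_unique_mem.mpr ⟨⟨?_, Nat.zero_le _⟩, ?_⟩⟩
    · exact (mem_cyclicLanguage b g 0 []).mpr ⟨FreeGroup.IsCyclicallyReduced.nil, map_one _, rfl⟩
    · rintro w ⟨hw, -⟩
      obtain ⟨h1, h2, h3⟩ := (mem_cyclicLanguage b g 0 w).mp hw
      refine eq_of_evalFree_eq b g h1.1 FreeGroup.IsReduced.nil ?_ (by simp)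
        (h2.trans (map_one _).symm)
      intro z hz
      have := List.countP_eq_zero.mp h3 z hz
      rw [Option.isSome_iff_ne_none]
      simpa using this
  rw [rho_eq_wordCount b g 0 hM, h]
  simp

section
variable {W : ℕ} (hW : ∀ j ≤ r, (baseWord b g j).length < W) {d : ℕ} (hd : 0 < d) {V : ℕ}
  (hV : 2 * d * ((rose n r W (block b g)).grammar.NV + 1) < V)
include hW hd hV

theorem hasExponentialGrowth {s : ℕ} (hs : s < 2 * r + 2)
    (h : (rose n r W (block b g)).grammar.A V (startSym n r W s) d V) :
    HasExponentialGrowth (rho b g d) := by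
  have hN := Auto.counts (Rose.valid (blocks b g hW)) (rose_rigid hW)
  obtain ⟨a, h1⟩ := hN.growsExp hd hV h
  obtain ⟨α, hα, h2⟩ := eventually_ge_of_growsExp (wordCount_mono d) (fun _ => rho_eq_wordCount b g d)
    ⟨a, fun M => (h1 M).trans (count_le_wordCount hW hs hd _)⟩
  obtain ⟨β, hβ, h3⟩ := eventually_le_of_le_pow (fun _ => rho_eq_wordCount b g d)
    (Nat.succ_le_succ (Fintype.card_pos (α := Gen r × Bool))) fun M => ncard_words_le _ M
  exact ⟨α, β, hα, hβ, h2.and h3⟩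

omit hV in
theorem idealDeg_eq_empty
    (h : ∀ s < 2 * r + 2, ¬ (rose n r W (block b g)).grammar.A V (startSym n r W s) d 0) :
    idealDeg b g d = ∅ := by
  have hN := Auto.counts (Rose.valid (blocks b g hW)) (rose_rigid hW)
  by_contra hne
  obtain ⟨w, hw⟩ := (cyclicLanguage_nonempty b g d).mp (Set.nonempty_iff_ne_empty.mpr hne)
  have h1 := wordCount_le_sum (b := b) (g := g) hW hd w.length
  rw [Finset.sum_eq_zero fun s hs => hN.eq_zero
    (fun v hv => h s (Finset.mem_range.mp hs) (hv.of_le (Nat.zero_le v))) _] at h1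
  rw [Nat.le_zero, wordCount, Set.ncard_eq_zero (finite_words b g d w.length)] at h1
  exact (Set.ext_iff.mp h1 w).mp ⟨hw, le_rfl⟩

omit hV in
theorem hasPolynomialGrowth
    (h : ∀ s < 2 * r + 2, ¬ (rose n r W (block b g)).grammar.A V (startSym n r W s) d V)
    {v : ℕ} {s : ℕ} (hs : s < 2 * r + 2)
    (h1 : (rose n r W (block b g)).grammar.A V (startSym n r W s) d v)
    (h2 : ∀ s < 2 * r + 2, ∀ w,
      (rose n r W (block b g)).grammar.A V (startSym n r W s) d w → w ≤ v) :
    HasPolynomialGrowth (rho b g d) v := by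
  have hN := Auto.counts (Rose.valid (blocks b g hW)) (rose_rigid hW)
  have hup : BoundedPoly (wordCount b g d) v := by
    have h3 : ∀ s : ℕ, ∃ K, s < 2 * r + 2 → ∀ M,
        (rose n r W (block b g)).count (startSym n r W s) d M ≤ K * (M + 1) ^ v := by
      intro s
      by_cases hs : s < 2 * r + 2
      · obtain ⟨K, hK⟩ := hN.boundedPoly (h s hs) (h2 s hs)
        exact ⟨K, fun _ => hK⟩
      · exact ⟨0, fun h => absurd h hs⟩
    choose K hK using h3
    refine ⟨(∑ s ∈ Finset.range (2 * r + 2), K s) * (W + 1) ^ v, fun M => ?_⟩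
    refine (wordCount_le_sum hW hd M).trans ?_
    rw [mul_assoc, Finset.sum_mul]
    refine Finset.sum_le_sum fun s hs => (hK s (Finset.mem_range.mp hs) _).trans ?_
    rw [← mul_pow]
    gcongr
    nlinarith
  obtain ⟨β, hβ, h4⟩ := eventually_le_of_boundedPoly (fun _ => rho_eq_wordCount b g d) hup
  rcases hN.growsPoly hd h1 with ⟨a, h3⟩ | ⟨a, h3⟩
  · obtain ⟨α, hα, h5⟩ := eventually_ge_of_growsExp (wordCount_mono d)
      (fun _ => rho_eq_wordCount b g d) ⟨a, fun M => (h3 M).trans (count_le_wordCount hW hs hd _)⟩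
    exact (not_exp_le_of_le_pow hα h5 h4).elim
  · obtain ⟨α, hα, h5⟩ := eventually_ge_of_growsPoly (wordCount_mono d)
      (fun _ => rho_eq_wordCount b g d) ⟨a, fun M => (h3 M).trans (count_le_wordCount hW hs hd _)⟩
    exact ⟨α, β, hα, hβ, h5.and h4⟩

end

end FreeEq

/-! ### Division on the machine -/

namespace RAM

variable {X : Type} {K : Ctx X} {a b : X → ℕ}

theorem Cmp.min (ha : Cmp K a) (hb : Cmp K b) : Cmp K fun x => min (a x) (b x) :=
  (ha.sub (ha.sub hb)).congr fun x => by omega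

/-- The quotient is the number of positive multiples of the divisor that are not larger. -/
theorem Cmp.div (ha : Cmp K a) (hb : Cmp K b) (hab : ∀ x, a x ≤ K.bd x) :
    Cmp K fun x => a x / b x := by
  have h : CmpP K.inner fun y => 0 < b y.1 ∧ (y.2 + 1) * b y.1 ≤ a y.1 :=
    (CmpP.lt (.const 0) hb.wk).and (CmpP.le ((Cmp.last.add (.const 1)).mul hb.wk) ha.wk)
  refine (Cmp.sum (F := fun x i => ind (0 < b x ∧ (i + 1) * b x ≤ a x)) h).congr fun x => ?_
  rcases Nat.eq_zero_or_pos (b x) with h0 | h0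
  · simp [h0, ind]
  · have h1 : ∀ i, (0 < b x ∧ (i + 1) * b x ≤ a x) ↔ i ∈ Finset.range (a x / b x) := by
      intro i
      rw [and_iff_right h0, Finset.mem_range, ← Nat.succ_le_iff, Nat.le_div_iff_mul_le h0]
    have h2 : a x / b x ≤ K.bd x := (Nat.div_le_self _ _).trans (hab x)
    simp only [h1, ind]
    rw [Finset.sum_ite_mem, Finset.inter_eq_right.mpr (Finset.range_subset_range.mpr h2)]
    simp

theorem Cmp.mod (ha : Cmp K a) (hb : Cmp K b) (hab : ∀ x, a x ≤ K.bd x) :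
    Cmp K fun x => a x % b x :=
  (ha.sub (hb.mul (ha.div hb hab))).congr fun x => by
    have := Nat.div_add_mod (a x) (b x)
    omega

/-- A variant of bounded quantification where the body knows that the variable is at most the loop
bound. -/
theorem CmpP.exMin {p : X → ℕ → Prop}
    (hp : CmpP K.inner fun y => p y.1 (Min.min y.2 (K.bd y.1))) :
    CmpP K fun x => ∃ i < K.bd x, p x i := by
  refine (CmpP.ex (p := fun x i => p x (Min.min i (K.bd x))) hp).congr fun x => ?_
  refine exists_congr fun i => and_congr_right fun hi => ?_
  rw [min_eq_left hi.le]

end RAM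

/-! ### The rules for the tables -/

namespace Grammar

variable (G : Grammar) (B d V : ℕ) (Zt Rt S : ℕ → Prop)

/-- The rule that generates `G.Z`. -/
def ZRule (σ : ℕ) : Prop :=
  G.init σ ∨ ∃ l < B, G.act σ l ∧ G.dl σ l = 0 ∧ S (G.f1 σ l) ∧ S (G.f2 σ l)

/-- The rule that generates `G.R`, where the pair `(σ, τ)` is encoded as `σ * NV + τ`. -/
def RRule (c : ℕ) : Prop :=
  ∃ l < B, G.act (c / G.NV) l ∧ G.dl (c / G.NV) l = 0 ∧
    ((Zt (G.f2 (c / G.NV) l) ∧ (c % G.NV = G.f1 (c / G.NV) l ∨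
        S (G.f1 (c / G.NV) l * G.NV + c % G.NV))) ∨
      (Zt (G.f1 (c / G.NV) l) ∧ (c % G.NV = G.f2 (c / G.NV) l ∨
        S (G.f2 (c / G.NV) l * G.NV + c % G.NV))))

/-- `G.Ret` in terms of the tables. -/
def RetRule (σ e : ℕ) : Prop :=
  ∃ l < B, G.act σ l ∧ G.dl σ l = 0 ∧
    ((e = 2 * l ∧ Zt (G.f2 σ l) ∧ Rt (G.f1 σ l * G.NV + σ)) ∨
      (e = 2 * l + 1 ∧ Zt (G.f1 σ l) ∧ Rt (G.f2 σ l * G.NV + σ)))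

/-- `G.Bad` in terms of the tables. -/
def BadRule (σ : ℕ) : Prop :=
  ∃ e < B, ∃ e' < B, e < e' ∧ G.RetRule B Zt Rt σ e ∧ G.RetRule B Zt Rt σ e'

/-- The number of the triple `(σ, k, v)` where `k ≤ d` and `v ≤ V`. -/
def cell (σ k v : ℕ) : ℕ := (σ * (d + 1) + k) * (V + 1) + v

/-- The rule that generates `G.A V σ k v`, where `(σ, k, v)` is encoded by `cell`. -/
def ARule (σ k v : ℕ) : Prop :=
  (k = 0 ∧ v = 0 ∧ Zt σ) ∨
  ∃ l < B, G.act σ l ∧ 0 < k ∧ ∃ k1 < B, ∃ k2 < B, k1 + k2 + G.dl σ l = k ∧ ∃ v1 < B, ∃ v2 < B,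
    v1 ≤ V ∧ v2 ≤ V ∧ S (cell d V (G.f1 σ l) k1 v1) ∧ S (cell d V (G.f2 σ l) k2 v2) ∧
    (G.BadRule B Zt Rt σ ∨ v ≤ v1 + v2 ∨ (v ≤ v1 + v2 + 1 ∧ Rt (σ * G.NV + σ) ∧
      ¬ (k1 = k ∧ Rt (G.f1 σ l * G.NV + σ)) ∧ ¬ (k2 = k ∧ Rt (G.f2 σ l * G.NV + σ))))

/-- `ARule` for the triple with number `c`. -/
def ARule' (c : ℕ) : Prop :=
  G.ARule B d V Zt Rt S (c / (V + 1) / (d + 1)) (c / (V + 1) % (d + 1)) (c % (V + 1))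

variable {G B d V Zt Rt S} {T : ℕ → Prop}

theorem ZRule.mono (h : ∀ c, S c → T c) {σ : ℕ} : G.ZRule B S σ → G.ZRule B T σ := by
  rintro (h1 | ⟨l, hl, h1, h2, h3, h4⟩)
  · exact Or.inl h1
  · exact Or.inr ⟨l, hl, h1, h2, h _ h3, h _ h4⟩

theorem RRule.mono (h : ∀ c, S c → T c) {c : ℕ} : G.RRule B Zt S c → G.RRule B Zt T c := by
  rintro ⟨l, hl, h1, h2, h3⟩
  exact ⟨l, hl, h1, h2, h3.imp (And.imp_right (Or.imp_right (h _)))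
    (And.imp_right (Or.imp_right (h _)))⟩

theorem ARule.mono (h : ∀ c, S c → T c) {σ k v : ℕ} :
    G.ARule B d V Zt Rt S σ k v → G.ARule B d V Zt Rt T σ k v := by
  rintro (h1 | ⟨l, hl, h1, h2, k1, hk1, k2, hk2, h3, v1, hv1, v2, hv2, h4, h5, h6, h7, h8⟩)
  · exact Or.inl h1
  · exact Or.inr ⟨l, hl, h1, h2, k1, hk1, k2, hk2, h3, v1, hv1, v2, hv2, h4, h5, h _ h6, h _ h7, h8⟩

section
variable (hG : ∀ {σ l}, G.act σ l → σ < G.NV ∧ l < G.NL ∧ G.f1 σ l < G.NV ∧ G.f2 σ l < G.NV)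
  (hi : ∀ {σ}, G.init σ → σ < G.NV)
include hG

theorem R_lt {σ τ : ℕ} (h : G.R σ τ) : σ < G.NV ∧ τ < G.NV := by
  have key : ∀ {σ τ}, (∃ e, G.Edge σ e τ) → σ < G.NV ∧ τ < G.NV := by
    rintro σ τ ⟨e, l, h1, -, ⟨-, -, rfl⟩ | ⟨-, -, rfl⟩⟩
    · exact ⟨(hG h1).1, (hG h1).2.2.1⟩
    · exact ⟨(hG h1).1, (hG h1).2.2.2⟩
  induction h with
  | single h => exact key h
  | tail _ h ih => exact ⟨ih.1, (key h).2⟩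

include hi in
theorem Z_lt {σ : ℕ} (h : G.Z σ) : σ < G.NV := by
  cases h with
  | init h => exact hi h
  | rule h => exact (hG h).1

include hi in
theorem lfp_ZRule (hB : G.NV ≤ B) (hB' : G.NL ≤ B) : RAM.Lfp B (G.ZRule B) = G.Z := by
  funext σ
  refine propext ⟨fun h => h G.Z ?_, fun h => ?_⟩
  · rintro σ - (h | ⟨l, -, h1, h2, h3, h4⟩)
    · exact .init h
    · exact .rule h1 h2 h3 h4
  · induction h with
    | init h =>
      exact RAM.Lfp.closed (Ψ := G.ZRule B) (fun _ _ h _ => ZRule.mono h) ((hi h).trans_le hB) (Or.inl h)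
    | rule h1 h2 h3 h4 ih1 ih2 =>
      exact RAM.Lfp.closed (Ψ := G.ZRule B) (fun _ _ h _ => ZRule.mono h) ((hG h1).1.trans_le hB)
        (Or.inr ⟨_, (hG h1).2.1.trans_le hB', h1, h2, ih1, ih2⟩)

omit hG in
theorem pair_div_mod {σ τ : ℕ} (hτ : τ < G.NV) :
    (σ * G.NV + τ) / G.NV = σ ∧ (σ * G.NV + τ) % G.NV = τ := by
  rw [mul_comm, Nat.mul_add_div (by omega), Nat.mul_add_mod, Nat.div_eq_of_lt hτ,
    Nat.mod_eq_of_lt hτ]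
  exact ⟨rfl, rfl⟩

/-- The relation `G.R` as a set of encoded pairs. -/
def RT (G : Grammar) (c : ℕ) : Prop := G.R (c / G.NV) (c % G.NV)

omit hG in
theorem RT_pair {σ τ : ℕ} (hτ : τ < G.NV) : G.RT (σ * G.NV + τ) ↔ G.R σ τ := by
  rw [RT, (pair_div_mod hτ).1, (pair_div_mod hτ).2]

theorem lfp_RRule (hB : G.NV * G.NV ≤ B) (hB' : G.NL ≤ B) :
    RAM.Lfp B (G.RRule B G.Z) = G.RT := by
  funext c
  refine propext ⟨fun h => h G.RT ?_, fun h => ?_⟩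
  · rintro c - ⟨l, -, h1, h2, h3⟩
    have hc : c % G.NV < G.NV := Nat.mod_lt _ (Nat.zero_lt_of_lt (hG h1).1)
    have e1 : G.Z (G.f2 (c / G.NV) l) → (∃ e, G.Edge (c / G.NV) e (G.f1 (c / G.NV) l)) :=
      fun h => ⟨_, l, h1, h2, Or.inl ⟨rfl, h, rfl⟩⟩
    have e2 : G.Z (G.f1 (c / G.NV) l) → (∃ e, G.Edge (c / G.NV) e (G.f2 (c / G.NV) l)) :=
      fun h => ⟨_, l, h1, h2, Or.inr ⟨rfl, h, rfl⟩⟩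
    rw [RT_pair hc, RT_pair hc] at h3
    rcases h3 with ⟨h3, h4 | h4⟩ | ⟨h3, h4 | h4⟩
    · rw [RT, h4]; exact .single (e1 h3)
    · exact .head (e1 h3) h4
    · rw [RT, h4]; exact .single (e2 h3)
    · exact .head (e2 h3) h4
  · obtain ⟨h1, h2⟩ := R_lt hG h
    have hc : c = c / G.NV * G.NV + c % G.NV := (Nat.div_add_mod' c G.NV).symm
    rw [hc]
    change G.R (c / G.NV) (c % G.NV) at h
    generalize c / G.NV = σ at *
    generalize c % G.NV = τ at *
    clear hc
    have hlt : ∀ {σ}, σ < G.NV → σ * G.NV + τ < B := fun hσ => lt_of_lt_of_le (by nlinarith) hB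
    induction h using Relation.TransGen.head_induction_on with
    | single h =>
      obtain ⟨e, l, h3, h4, h5⟩ := h
      refine RAM.Lfp.closed (Ψ := G.RRule B G.Z) (fun _ _ h _ => RRule.mono h) (hlt h1)
        ⟨l, (hG h3).2.1.trans_le hB', ?_⟩
      rw [(pair_div_mod h2).1, (pair_div_mod h2).2]
      exact ⟨h3, h4, h5.imp (fun h => ⟨h.2.1, Or.inl h.2.2⟩) (fun h => ⟨h.2.1, Or.inl h.2.2⟩)⟩
    | head h h' ih =>
      obtain ⟨e, l, h3, h4, h5⟩ := h
      refine RAM.Lfp.closed (Ψ := G.RRule B G.Z) (fun _ _ h _ => RRule.mono h) (hlt h1)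
        ⟨l, (hG h3).2.1.trans_le hB', ?_⟩
      rw [(pair_div_mod h2).1, (pair_div_mod h2).2]
      have ih' := ih (R_lt hG h').1
      refine ⟨h3, h4, h5.imp (fun h => ⟨h.2.1, Or.inr ?_⟩) (fun h => ⟨h.2.1, Or.inr ?_⟩)⟩
      · rw [← h.2.2]; exact ih'
      · rw [← h.2.2]; exact ih'

theorem retRule_iff (hB' : G.NL ≤ B) {σ e : ℕ} : G.RetRule B G.Z G.RT σ e ↔ G.Ret σ e := by
  constructor
  · rintro ⟨l, -, h1, h2, ⟨h3, h4, h5⟩ | ⟨h3, h4, h5⟩⟩ <;> rw [RT_pair (hG h1).1] at h5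
    · exact ⟨_, ⟨l, h1, h2, Or.inl ⟨h3, h4, rfl⟩⟩, h5⟩
    · exact ⟨_, ⟨l, h1, h2, Or.inr ⟨h3, h4, rfl⟩⟩, h5⟩
  · rintro ⟨τ, ⟨l, h1, h2, ⟨h3, h4, rfl⟩ | ⟨h3, h4, rfl⟩⟩, h5⟩ <;>
      rw [← RT_pair (hG h1).1] at h5
    · exact ⟨l, (hG h1).2.1.trans_le hB', h1, h2, Or.inl ⟨h3, h4, h5⟩⟩
    · exact ⟨l, (hG h1).2.1.trans_le hB', h1, h2, Or.inr ⟨h3, h4, h5⟩⟩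

theorem badRule_iff (hB' : 2 * G.NL ≤ B) {σ : ℕ} : G.BadRule B G.Z G.RT σ ↔ G.Bad σ := by
  have hlt : ∀ {e}, G.Ret σ e → e < B := by
    rintro e ⟨τ, ⟨l, h1, -, h2⟩, -⟩
    have := (hG h1).2.1
    omega
  simp only [BadRule, retRule_iff hG (show G.NL ≤ B by omega)]
  constructor
  · rintro ⟨e, -, e', -, h⟩
    exact ⟨e, e', h⟩
  · rintro ⟨e, e', h1, h2, h3⟩
    exact ⟨e, hlt h2, e', hlt h3, h1, h2, h3⟩

omit hG in
theorem cell_div_mod {σ k v : ℕ} (hk : k ≤ d) (hv : v ≤ V) :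
    cell d V σ k v / (V + 1) / (d + 1) = σ ∧ cell d V σ k v / (V + 1) % (d + 1) = k ∧
      cell d V σ k v % (V + 1) = v := by
  have h1 : cell d V σ k v / (V + 1) = σ * (d + 1) + k := by
    rw [cell, mul_comm, Nat.mul_add_div (by omega), Nat.div_eq_of_lt (by omega), add_zero]
  rw [h1]
  refine ⟨?_, ?_, ?_⟩
  · rw [mul_comm, Nat.mul_add_div (by omega), Nat.div_eq_of_lt (by omega), add_zero]
  · rw [mul_comm, Nat.mul_add_mod, Nat.mod_eq_of_lt (by omega)]
  · rw [cell, mul_comm, Nat.mul_add_mod, Nat.mod_eq_of_lt (by omega)]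

/-- The relation `G.A V` as a set of encoded triples. -/
def AT (G : Grammar) (d V c : ℕ) : Prop :=
  G.A V (c / (V + 1) / (d + 1)) (c / (V + 1) % (d + 1)) (c % (V + 1))

omit hG in
theorem AT_cell {σ k v : ℕ} (hk : k ≤ d) (hv : v ≤ V) : G.AT d V (cell d V σ k v) ↔ G.A V σ k v := by
  obtain ⟨h1, h2, h3⟩ := cell_div_mod (σ := σ) hk hv
  rw [AT, h1, h2, h3]

include hi in
theorem lfp_ARule (hB : G.NV * (d + 1) * (V + 1) ≤ B) (hB' : 2 * G.NL ≤ B) (hd : d < B) (hV : V < B) :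
    RAM.Lfp B (G.ARule' B d V G.Z G.RT) = G.AT d V := by
  funext c
  refine propext ⟨fun h => h (G.AT d V) ?_, fun h => ?_⟩
  · rintro c - hc
    have hv : c % (V + 1) ≤ V := Nat.le_of_lt_succ (Nat.mod_lt _ (Nat.succ_pos V))
    have hk : c / (V + 1) % (d + 1) ≤ d := Nat.le_of_lt_succ (Nat.mod_lt _ (Nat.succ_pos d))
    unfold AT
    rw [ARule'] at hc
    generalize c / (V + 1) / (d + 1) = σ at *
    generalize c / (V + 1) % (d + 1) = k at *
    generalize c % (V + 1) = v at *
    rcases hc with ⟨rfl, rfl, h⟩ | ⟨l, -, h1, h2, k1, -, k2, -, h3, v1, -, v2, -, h4, h5, h6, h7, h8⟩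
    · exact .zero h
    · rw [AT_cell (by omega) h4] at h6
      rw [AT_cell (by omega) h5] at h7
      have h9 := (hG h1).1
      rw [badRule_iff hG hB', RT_pair h9, RT_pair h9, RT_pair h9] at h8
      exact .rule h1 h2 h3 h6 h7 hv h8
  · have hk : c / (V + 1) % (d + 1) ≤ d := Nat.le_of_lt_succ (Nat.mod_lt _ (Nat.succ_pos d))
    have hc : c = cell d V (c / (V + 1) / (d + 1)) (c / (V + 1) % (d + 1)) (c % (V + 1)) := by
      rw [cell, Nat.div_add_mod', Nat.div_add_mod']
    rw [hc]
    unfold AT at h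
    generalize c / (V + 1) / (d + 1) = σ at *
    generalize c / (V + 1) % (d + 1) = k at *
    generalize c % (V + 1) = v at *
    clear hc
    have hlt : ∀ {σ k v}, σ < G.NV → k ≤ d → v ≤ V → cell d V σ k v < B := by
      intro σ k v h1 h2 h3
      refine lt_of_lt_of_le ?_ hB
      have h4 : σ * (d + 1) + k < G.NV * (d + 1) := by nlinarith
      unfold cell
      nlinarith
    induction h with
    | zero h =>
      refine RAM.Lfp.closed (Ψ := G.ARule' B d V G.Z G.RT) (fun _ _ h _ => ARule.mono h)
        (hlt (Z_lt hG hi h) (Nat.zero_le _) (Nat.zero_le _)) ?_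
      obtain ⟨e1, e2, e3⟩ := cell_div_mod (σ := _) (Nat.zero_le d) (Nat.zero_le V)
      rw [ARule', e1, e2, e3]
      exact Or.inl ⟨rfl, rfl, h⟩
    | @rule σ l k k1 k2 v1 v2 v h1 h2 h3 h4 h5 h6 h7 ih1 ih2 =>
      refine RAM.Lfp.closed (Ψ := G.ARule' B d V G.Z G.RT) (fun _ _ h _ => ARule.mono h) (hlt (hG h1).1 hk h6) ?_
      obtain ⟨e1, e2, e3⟩ := cell_div_mod (σ := σ) hk h6
      have h9 := (hG h1).1
      have h10 := h4.le_cap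
      have h11 := h5.le_cap
      rw [ARule', e1, e2, e3]
      refine Or.inr ⟨l, by have := (hG h1).2.1; omega, h1, h2, k1, by omega, k2, by omega, h3,
        v1, by omega, v2, by omega, h10, h11, ih1 (by omega), ih2 (by omega), ?_⟩
      rwa [badRule_iff hG hB', RT_pair h9, RT_pair h9, RT_pair h9]

end

end Grammar

/-! ### The rose automaton on the machine -/

namespace RAM

/-- The number of generators of the ambient free group, as given by the input. -/
def inN (I : List ℕ) : ℕ := I.getD 0 0

/-- The rank of the subgroup, as given by the input. -/
def inR (I : List ℕ) : ℕ := I.getD 1 0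

/-- The degree, as given by the input. -/
def inD (I : List ℕ) : ℕ := I.getD 2 0

/-- The code of letter `i` of the word that is encoded from position `p` of the input on. -/
def letterAt (I : List ℕ) (p i : ℕ) : ℕ :=
  if I.getD (p + 2 + 2 * i) 0 = 0 then inN I - 1 - I.getD (p + 1 + 2 * i) 0
  else inN I + 1 + I.getD (p + 1 + 2 * i) 0

/-- The code at position `i` of the word number `s`, where `o j` is the position in the input from which
on the word `j ≤ r` is encoded. Beyond the end it is `n`. The word `2 * r + 1 - j` is the inverse of the
word `j`. -/
def blockAt (I : List ℕ) (o : ℕ → ℕ) (s i : ℕ) : ℕ :=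
  if s ≤ inR I then (if i < I.getD (o s) 0 then letterAt I (o s) i else inN I)
  else if i < I.getD (o (2 * inR I + 1 - s)) 0 then
    2 * inN I - letterAt I (o (2 * inR I + 1 - s)) (I.getD (o (2 * inR I + 1 - s)) 0 - 1 - i)
  else inN I

/-- The end of the encoded words is used as the length of the blocks of states. -/
def width (I : List ℕ) (o : ℕ → ℕ) : ℕ := o (inR I + 1)

/-- The rose automaton of the words that are given by the input. -/
def inAuto (I : List ℕ) (B : ℕ) (o : ℕ → ℕ) : Auto where
  n := inN I
  P := (2 * inR I + 2) * width I o
  lt p := blockAt I o (p / width I o) (p % width I o)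
  ok p l := ∃ s < B, s < 2 * inR I + 2 ∧ l = s * width I o ∧ s + p / width I o ≠ 2 * inR I + 1
  dg p := if blockAt I o (p / width I o) (p % width I o) = inN I ∧
    (p / width I o = inR I ∨ p / width I o = inR I + 1) then 1 else 0

/-- The grammar of the trivial paths of this automaton. -/
def inGrammar (I : List ℕ) (B : ℕ) (o : ℕ → ℕ) : Grammar := (inAuto I B o).grammar

/-- The content of table `0`. -/
def offs (h : ℕ → ℕ) (j : ℕ) : ℕ := h (4 * j)

/-- The set whose characteristic function is table `t`. -/
def tab (h : ℕ → ℕ) (t c : ℕ) : Prop := h (4 * c + t) ≠ 0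

section
variable {X : Type} {K : Ctx X} {a s i p l : X → ℕ}

theorem Cmp.inN : Cmp K fun x => inN (K.inp x) := Cmp.input (.const 0)

theorem Cmp.inR : Cmp K fun x => inR (K.inp x) := Cmp.input (.const 1)

theorem Cmp.inD : Cmp K fun x => inD (K.inp x) := Cmp.input (.const 2)

theorem Cmp.offs (ha : Cmp K a) : Cmp K fun x => offs (K.hp x) (a x) :=
  Cmp.heap (.mul (.const 4) ha)

theorem CmpP.tab (t : ℕ) (ha : Cmp K a) : CmpP K fun x => tab (K.hp x) t (a x) :=
  (CmpP.eq_zero (Cmp.heap (.add (.mul (.const 4) ha) (.const t)))).not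

theorem Cmp.letterAt (hp : Cmp K p) (hi : Cmp K i) :
    Cmp K fun x => letterAt (K.inp x) (p x) (i x) :=
  .ite (.eq_zero (.input (.add (.add hp (.const 2)) (.mul (.const 2) hi))))
    (.sub (.sub .inN (.const 1)) (.input (.add (.add hp (.const 1)) (.mul (.const 2) hi))))
    (.add (.add .inN (.const 1)) (.input (.add (.add hp (.const 1)) (.mul (.const 2) hi))))

theorem Cmp.blockAt (hs : Cmp K s) (hi : Cmp K i) :
    Cmp K fun x => blockAt (K.inp x) (RAM.offs (K.hp x)) (s x) (i x) := by
  have h1 : Cmp K fun x => 2 * RAM.inR (K.inp x) + 1 - s x :=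
    .sub (.add (.mul (.const 2) .inR) (.const 1)) hs
  have h2 := Cmp.input (Cmp.offs h1)
  exact .ite (.le hs .inR)
    (.ite (.lt hi (.input (.offs hs))) (.letterAt (.offs hs) hi) .inN)
    (.ite (.lt hi h2) (.sub (.mul (.const 2) .inN)
      (.letterAt (.offs h1) (.sub (.sub h2 (.const 1)) hi))) .inN)

theorem Cmp.width : Cmp K fun x => width (K.inp x) (RAM.offs (K.hp x)) :=
  .offs (.add .inR (.const 1))

/-- The automaton of the input in the context `K`. -/
abbrev Ctx.auto (K : Ctx X) (x : X) : Auto := inAuto (K.inp x) (K.bd x) (RAM.offs (K.hp x))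

theorem Cmp.autoP : Cmp K fun x => (K.auto x).P :=
  .mul (.add (.mul (.const 2) .inR) (.const 2)) .width

theorem Cmp.autoLt (hp : Cmp K p) (hB : ∀ x, p x ≤ K.bd x) : Cmp K fun x => (K.auto x).lt (p x) :=
  .blockAt (.div hp .width hB) (.mod hp .width hB)

theorem CmpP.autoOk (hp : Cmp K p) (hB : ∀ x, p x ≤ K.bd x) (hl : Cmp K l) :
    CmpP K fun x => (K.auto x).ok (p x) (l x) :=
  CmpP.ex (p := fun x s => s < 2 * RAM.inR (K.inp x) + 2 ∧
      l x = s * RAM.width (K.inp x) (RAM.offs (K.hp x)) ∧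
      s + p x / RAM.width (K.inp x) (RAM.offs (K.hp x)) ≠ 2 * RAM.inR (K.inp x) + 1)
    (.and (.lt .last (.add (.mul (.const 2) .inR) (.const 2)))
      (.and (.eq hl.wk (.mul .last .width))
        (.ne (.add .last (Cmp.div hp .width hB).wk) (.add (.mul (.const 2) .inR) (.const 1)))))

theorem Cmp.autoDg (hp : Cmp K p) (hB : ∀ x, p x ≤ K.bd x) : Cmp K fun x => (K.auto x).dg (p x) :=
  .ite (.and (.eq (.autoLt hp hB) .inN)
      (.or (.eq (.div hp .width hB) .inR) (.eq (.div hp .width hB) (.add .inR (.const 1)))))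
    (.const 1) (.const 0)

theorem Cmp.enc {b p q : X → ℕ} (hb : Cmp K b) (hp : Cmp K p) (hq : Cmp K q) :
    Cmp K fun x => Auto.enc (K.auto x).P (b x) (p x) (q x) :=
  .add (.mul (.add (.mul hb (.add .autoP (.const 1))) hp) (.add .autoP (.const 1))) hq

/-- The grammar of the input in the context `K`. -/
abbrev Ctx.gr (K : Ctx X) (x : X) : Grammar := inGrammar (K.inp x) (K.bd x) (RAM.offs (K.hp x))

theorem Cmp.grNV : Cmp K fun x => (K.gr x).NV :=
  .mul (.mul (.add (.mul (.const 2) .inN) (.const 1)) (.add .autoP (.const 1)))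
    (.add .autoP (.const 1))

section
variable (hs : Cmp K s) (hsB : ∀ x, s x ≤ K.bd x)
include hs hsB

theorem Cmp.symP : Cmp K fun x => s x / ((K.auto x).P + 1) % ((K.auto x).P + 1) :=
  .mod (.div hs (.add .autoP (.const 1)) hsB) (.add .autoP (.const 1))
    fun x => (Nat.div_le_self _ _).trans (hsB x)

theorem Cmp.symB : Cmp K fun x => s x / ((K.auto x).P + 1) / ((K.auto x).P + 1) :=
  .div (.div hs (.add .autoP (.const 1)) hsB) (.add .autoP (.const 1))
    fun x => (Nat.div_le_self _ _).trans (hsB x)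

theorem Cmp.symQ : Cmp K fun x => s x % ((K.auto x).P + 1) :=
  .mod hs (.add .autoP (.const 1)) hsB

omit hs in
theorem symP_le (x : X) : s x / ((K.auto x).P + 1) % ((K.auto x).P + 1) ≤ K.bd x :=
  (Nat.mod_le _ _).trans ((Nat.div_le_self _ _).trans (hsB x))

theorem Cmp.symLt :
    Cmp K fun x => (K.auto x).lt (s x / ((K.auto x).P + 1) % ((K.auto x).P + 1)) :=
  .autoLt (.symP hs hsB) (symP_le hsB)

theorem CmpP.grInit : CmpP K fun x => (K.gr x).init (s x) :=
  .and (.lt hs .grNV) (.eq (.symP hs hsB) (.symQ hs hsB))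

variable (hl : Cmp K l)
include hl

theorem CmpP.grAct (hlB : ∀ x, l x ≤ K.bd x) : CmpP K fun x => (K.gr x).act (s x) (l x) :=
  .and (.lt hs .grNV) (.and (.lt hl .autoP) (.and (.lt (.symP hs hsB) .autoP)
    (.or (.and (.eq (.symLt hs hsB) .inN) (.autoOk (.symP hs hsB) (symP_le hsB) hl))
      (.and (.ne (.symLt hs hsB) .inN) (.and (.ne (.symLt hs hsB) (.symB hs hsB))
        (.eq (.add (.autoLt hl hlB) (.symLt hs hsB)) (.mul (.const 2) .inN)))))))

theorem Cmp.grF1 (hlB : ∀ x, l x ≤ K.bd x) : Cmp K fun x => (K.gr x).f1 (s x) (l x) :=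
  .ite (.eq (.symLt hs hsB) .inN) (.enc .inN .autoP .autoP)
    (.enc (.autoLt hl hlB) (.add (.symP hs hsB) (.const 1)) hl)

theorem Cmp.grF2 : Cmp K fun x => (K.gr x).f2 (s x) (l x) :=
  .ite (.eq (.symLt hs hsB) .inN) (.enc (.symB hs hsB) hl (.symQ hs hsB))
    (.enc (.symB hs hsB) (.add hl (.const 1)) (.symQ hs hsB))

omit hl in
theorem Cmp.grDl : Cmp K fun x => (K.gr x).dl (s x) (l x) :=
  .ite (.eq (.symLt hs hsB) .inN) (.autoDg (.symP hs hsB) (symP_le hsB)) (.const 0)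

end

/-! ### The rules on the machine -/

/-- The cut-off for the degrees of growth. -/
def cutoff (d : ℕ) (G : Grammar) : ℕ := 2 * d * (G.NV + 1) + 1

theorem Cmp.cutoff : Cmp K fun x => cutoff (RAM.inD (K.inp x)) (K.gr x) :=
  .add (.mul (.mul (.const 2) .inD) (.add .grNV (.const 1))) (.const 1)

theorem Cmp.boundMin : Cmp K.inner fun y => Min.min y.2 (K.bd y.1) := .min .last .bound

theorem boundMin_le (y : X × ℕ) : Min.min y.2 (K.bd y.1) ≤ K.inner.bd y := min_le_right _ _

section
variable (hs : Cmp K s) (hsB : ∀ x, s x ≤ K.bd x)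
include hs hsB

theorem CmpP.zRule :
    CmpP K fun x => (K.gr x).ZRule (K.bd x) (RAM.tab (K.hp x) 1) (s x) := by
  refine .or (.grInit hs hsB) (.exMin ?_)
  have hB : ∀ y, s y.1 ≤ K.inner.bd y := fun y => hsB y.1
  have h1 := CmpP.grAct hs.wk hB Cmp.boundMin boundMin_le
  have h2 := Cmp.grDl (l := fun y => Min.min y.2 (K.bd y.1)) hs.wk hB
  have h3 := Cmp.grF1 hs.wk hB Cmp.boundMin boundMin_le
  have h4 := Cmp.grF2 hs.wk hB Cmp.boundMin
  exact .and h1 (.and (.eq_zero h2) (.and (.tab 1 h3) (.tab 1 h4)))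

theorem CmpP.rRule :
    CmpP K fun x => (K.gr x).RRule (K.bd x) (RAM.tab (K.hp x) 1) (RAM.tab (K.hp x) 2) (s x) := by
  refine .exMin ?_
  have hv : Cmp K fun x => s x / (K.gr x).NV := .div hs .grNV hsB
  have hm : Cmp K fun x => s x % (K.gr x).NV := .mod hs .grNV hsB
  have hB : ∀ y : X × ℕ, s y.1 / (K.gr y.1).NV ≤ K.inner.bd y :=
    fun y => (Nat.div_le_self _ _).trans (hsB y.1)
  have h1 := CmpP.grAct hv.wk hB Cmp.boundMin boundMin_le
  have h2 := Cmp.grDl (l := fun y => Min.min y.2 (K.bd y.1)) hv.wk hB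
  have h3 := Cmp.grF1 hv.wk hB Cmp.boundMin boundMin_le
  have h4 := Cmp.grF2 hv.wk hB Cmp.boundMin
  exact .and h1 (.and (.eq_zero h2) (.or
    (.and (.tab 1 h4) (.or (.eq hm.wk h3) (.tab 2 (.add (.mul h3 .grNV) hm.wk))))
    (.and (.tab 1 h3) (.or (.eq hm.wk h4) (.tab 2 (.add (.mul h4 .grNV) hm.wk))))))

theorem CmpP.retRule {e : X → ℕ} (he : Cmp K e) :
    CmpP K fun x => (K.gr x).RetRule (K.bd x) (RAM.tab (K.hp x) 1) (RAM.tab (K.hp x) 2) (s x) (e x) := by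
  refine .exMin ?_
  have hB : ∀ y, s y.1 ≤ K.inner.bd y := fun y => hsB y.1
  have h1 := CmpP.grAct hs.wk hB Cmp.boundMin boundMin_le
  have h2 := Cmp.grDl (l := fun y => Min.min y.2 (K.bd y.1)) hs.wk hB
  have h3 := Cmp.grF1 hs.wk hB Cmp.boundMin boundMin_le
  have h4 := Cmp.grF2 hs.wk hB Cmp.boundMin
  exact .and h1 (.and (.eq_zero h2) (.or
    (.and (.eq he.wk (.mul (.const 2) .boundMin))
      (.and (.tab 1 h4) (.tab 2 (.add (.mul h3 .grNV) hs.wk))))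
    (.and (.eq he.wk (.add (.mul (.const 2) .boundMin) (.const 1)))
      (.and (.tab 1 h3) (.tab 2 (.add (.mul h4 .grNV) hs.wk))))))

theorem CmpP.badRule :
    CmpP K fun x => (K.gr x).BadRule (K.bd x) (RAM.tab (K.hp x) 1) (RAM.tab (K.hp x) 2) (s x) := by
  refine .ex (p := fun x e => ∃ e' < K.bd x, e < e' ∧
    (K.gr x).RetRule (K.bd x) (RAM.tab (K.hp x) 1) (RAM.tab (K.hp x) 2) (s x) e ∧
    (K.gr x).RetRule (K.bd x) (RAM.tab (K.hp x) 1) (RAM.tab (K.hp x) 2) (s x) e') ?_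
  refine .ex (K := K.inner) (p := fun y e' => y.2 < e' ∧
    (K.gr y.1).RetRule (K.bd y.1) (RAM.tab (K.hp y.1) 1) (RAM.tab (K.hp y.1) 2) (s y.1) y.2 ∧
    (K.gr y.1).RetRule (K.bd y.1) (RAM.tab (K.hp y.1) 1) (RAM.tab (K.hp y.1) 2) (s y.1) e') ?_
  have hB : ∀ y, s y.1.1 ≤ K.inner.inner.bd y := fun y => hsB y.1.1
  have h1 : Cmp K.inner.inner fun y => y.1.2 := Cmp.wk (K := K.inner) .last
  exact .and (.lt h1 .last) (.and (.retRule hs.wk.wk hB h1) (.retRule hs.wk.wk hB .last))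

omit hs hsB in
theorem Cmp.cell {k v : X → ℕ} (hs : Cmp K s) (hk : Cmp K k) (hv : Cmp K v) :
    Cmp K fun x => Grammar.cell (RAM.inD (K.inp x)) (RAM.cutoff (RAM.inD (K.inp x)) (K.gr x))
      (s x) (k x) (v x) :=
  .add (.mul (.add (.mul hs (.add .inD (.const 1))) hk) (.add .cutoff (.const 1))) hv

omit hsB in
theorem CmpP.aRuleCore {k v f1 f2 k1 k2 v1 v2 : X → ℕ} {bad : X → Prop} (hk : Cmp K k) (hv : Cmp K v)
    (h1 : Cmp K f1) (h2 : Cmp K f2) (hbad : CmpP K bad) (hk1 : Cmp K k1) (hk2 : Cmp K k2)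
    (hv1 : Cmp K v1) (hv2 : Cmp K v2) :
    CmpP K fun x =>
      v1 x ≤ RAM.cutoff (RAM.inD (K.inp x)) (K.gr x) ∧ v2 x ≤ RAM.cutoff (RAM.inD (K.inp x)) (K.gr x) ∧
      RAM.tab (K.hp x) 3 (Grammar.cell (RAM.inD (K.inp x)) (RAM.cutoff (RAM.inD (K.inp x)) (K.gr x))
        (f1 x) (k1 x) (v1 x)) ∧
      RAM.tab (K.hp x) 3 (Grammar.cell (RAM.inD (K.inp x)) (RAM.cutoff (RAM.inD (K.inp x)) (K.gr x))
        (f2 x) (k2 x) (v2 x)) ∧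
      (bad x ∨ v x ≤ v1 x + v2 x ∨ (v x ≤ v1 x + v2 x + 1 ∧
        RAM.tab (K.hp x) 2 (s x * (K.gr x).NV + s x) ∧
        ¬ (k1 x = k x ∧ RAM.tab (K.hp x) 2 (f1 x * (K.gr x).NV + s x)) ∧
        ¬ (k2 x = k x ∧ RAM.tab (K.hp x) 2 (f2 x * (K.gr x).NV + s x)))) :=
  .and (.le hv1 .cutoff) (.and (.le hv2 .cutoff) (.and (.tab 3 (.cell h1 hk1 hv1))
    (.and (.tab 3 (.cell h2 hk2 hv2)) (.or hbad (.or (.le hv (.add hv1 hv2))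
      (.and (.le hv (.add (.add hv1 hv2) (.const 1))) (.and (.tab 2 (.add (.mul hs .grNV) hs))
        (.and (.not (.and (.eq hk1 hk) (.tab 2 (.add (.mul h1 .grNV) hs))))
          (.not (.and (.eq hk2 hk) (.tab 2 (.add (.mul h2 .grNV) hs))))))))))))

omit hsB in
theorem CmpP.aRuleSplit {k v f1 f2 dl : X → ℕ} {bad : X → Prop} (hk : Cmp K k) (hv : Cmp K v)
    (h1 : Cmp K f1) (h2 : Cmp K f2) (hdl : Cmp K dl) (hbad : CmpP K bad) :
    CmpP K fun x => ∃ k1 < K.bd x, ∃ k2 < K.bd x, k1 + k2 + dl x = k x ∧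
      ∃ v1 < K.bd x, ∃ v2 < K.bd x,
      v1 ≤ RAM.cutoff (RAM.inD (K.inp x)) (K.gr x) ∧ v2 ≤ RAM.cutoff (RAM.inD (K.inp x)) (K.gr x) ∧
      RAM.tab (K.hp x) 3 (Grammar.cell (RAM.inD (K.inp x)) (RAM.cutoff (RAM.inD (K.inp x)) (K.gr x))
        (f1 x) k1 v1) ∧
      RAM.tab (K.hp x) 3 (Grammar.cell (RAM.inD (K.inp x)) (RAM.cutoff (RAM.inD (K.inp x)) (K.gr x))
        (f2 x) k2 v2) ∧
      (bad x ∨ v x ≤ v1 + v2 ∨ (v x ≤ v1 + v2 + 1 ∧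
        RAM.tab (K.hp x) 2 (s x * (K.gr x).NV + s x) ∧
        ¬ (k1 = k x ∧ RAM.tab (K.hp x) 2 (f1 x * (K.gr x).NV + s x)) ∧
        ¬ (k2 = k x ∧ RAM.tab (K.hp x) 2 (f2 x * (K.gr x).NV + s x)))) := by
  let Q : X → ℕ → ℕ → ℕ → ℕ → Prop := fun x k1 k2 v1 v2 =>
      v1 ≤ RAM.cutoff (RAM.inD (K.inp x)) (K.gr x) ∧ v2 ≤ RAM.cutoff (RAM.inD (K.inp x)) (K.gr x) ∧
      RAM.tab (K.hp x) 3 (Grammar.cell (RAM.inD (K.inp x)) (RAM.cutoff (RAM.inD (K.inp x)) (K.gr x))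
        (f1 x) k1 v1) ∧
      RAM.tab (K.hp x) 3 (Grammar.cell (RAM.inD (K.inp x)) (RAM.cutoff (RAM.inD (K.inp x)) (K.gr x))
        (f2 x) k2 v2) ∧
      (bad x ∨ v x ≤ v1 + v2 ∨ (v x ≤ v1 + v2 + 1 ∧
        RAM.tab (K.hp x) 2 (s x * (K.gr x).NV + s x) ∧
        ¬ (k1 = k x ∧ RAM.tab (K.hp x) 2 (f1 x * (K.gr x).NV + s x)) ∧
        ¬ (k2 = k x ∧ RAM.tab (K.hp x) 2 (f2 x * (K.gr x).NV + s x))))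
  refine .ex (p := fun x k1 => ∃ k2 < K.bd x, k1 + k2 + dl x = k x ∧
    ∃ v1 < K.bd x, ∃ v2 < K.bd x, Q x k1 k2 v1 v2) ?_
  refine .ex (K := K.inner) (p := fun y k2 => y.2 + k2 + dl y.1 = k y.1 ∧
    ∃ v1 < K.bd y.1, ∃ v2 < K.bd y.1, Q y.1 y.2 k2 v1 v2) ?_
  have l1 : Cmp K.inner.inner fun y => y.1.2 := Cmp.wk (K := K.inner) .last
  refine .and (.eq (.add (.add l1 .last) hdl.wk.wk) hk.wk.wk) ?_
  refine .ex (K := K.inner.inner) (p := fun y v1 => ∃ v2 < K.bd y.1.1, Q y.1.1 y.1.2 y.2 v1 v2) ?_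
  refine .ex (K := K.inner.inner.inner) (p := fun y v2 => Q y.1.1.1 y.1.1.2 y.1.2 y.2 v2) ?_
  exact CmpP.aRuleCore hs.wk.wk.wk.wk hk.wk.wk.wk.wk hv.wk.wk.wk.wk h1.wk.wk.wk.wk h2.wk.wk.wk.wk
    hbad.wk.wk.wk.wk l1.wk.wk (Cmp.wk (K := K.inner.inner.inner) (Cmp.wk (K := K.inner.inner) .last))
    (Cmp.wk (K := K.inner.inner.inner) .last) .last

theorem CmpP.aRule {k v : X → ℕ} (hk : Cmp K k) (hv : Cmp K v) :
    CmpP K fun x => (K.gr x).ARule (K.bd x) (RAM.inD (K.inp x))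
      (RAM.cutoff (RAM.inD (K.inp x)) (K.gr x)) (RAM.tab (K.hp x) 1) (RAM.tab (K.hp x) 2)
      (RAM.tab (K.hp x) 3) (s x) (k x) (v x) := by
  refine .or (.and (.eq_zero hk) (.and (.eq_zero hv) (.tab 1 hs))) (.exMin ?_)
  have hB : ∀ y, s y.1 ≤ K.inner.bd y := fun y => hsB y.1
  have h1 := CmpP.grAct hs.wk hB Cmp.boundMin boundMin_le
  have h2 := Cmp.grDl (l := fun y => Min.min y.2 (K.bd y.1)) hs.wk hB
  have h3 := Cmp.grF1 hs.wk hB Cmp.boundMin boundMin_le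
  have h4 := Cmp.grF2 hs.wk hB Cmp.boundMin
  have h5 := (CmpP.badRule hs hsB).wk
  exact .and h1 (.and (.lt (.const 0) hk.wk) (.aRuleSplit hs.wk hk.wk hv.wk h3 h4 h2 h5))

end

end

end RAM

/-! ### The program -/

namespace RAM

theorem Sim.mono_bound {X : Type} {inp : X → List ℕ} {bd bd' : X → ℕ} {Pre Post : X → (ℕ → ℕ) → Prop}
    (h : Sim inp bd Pre Post) (hb : ∀ x, bd x ≤ bd' x) : Sim inp bd' Pre Post := by
  obtain ⟨c, l, C, D, hl, h⟩ := h
  refine ⟨c, l, C, D, hl, fun x reg hp => ?_⟩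
  obtain ⟨r, t, ht, hq, hr⟩ := h x reg hp
  refine ⟨r, t, ht.trans ?_, hq, hr⟩
  have := hb x
  gcongr

/-- A triple for code that starts in the initial configuration is a terminating program. -/
theorem Sim.outputsWithin {bd out : List ℕ → ℕ} {Pre : List ℕ → (ℕ → ℕ) → Prop}
    (h : Sim id bd Pre fun I reg => reg 0 = out I) (h0 : ∀ I, Pre I fun _ => 0) :
    ∃ (P : Program) (C D : ℕ), ∀ I t, C * (bd I + 1) ^ D ≤ t → OutputsWithin P I t (out I) := by
  obtain ⟨c, l, C, D, hl, h⟩ := h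
  refine ⟨c 0, C, D, fun I t ht => ?_⟩
  obtain ⟨reg, t0, ht0, hq, hr⟩ := h I _ (h0 I)
  have hP : Placed (c 0) 0 (c 0) := fun i hi => by rw [Nat.zero_add]
  have h1 := hr (c 0) 0 hP
  have hhalt : ∀ m, (step (c 0) I)^[m] ⟨0 + l, reg⟩ = ⟨0 + l, reg⟩ := by
    intro m
    refine Function.iterate_fixed ?_ m
    simp [step, hl]
  obtain ⟨m, rfl⟩ : ∃ m, t = m + t0 := ⟨t - t0, by omega⟩
  have h2 : (step (c 0) I)^[m + t0] Config.init = ⟨0 + l, reg⟩ := by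
    rw [Function.iterate_add_apply]
    exact (congrArg _ h1).trans (hhalt m)
  rw [OutputsWithin, Halted, h2, hl]
  exact ⟨by simp, hq⟩

/-- The positions in the input at which the encoded words begin: `3` for the first one. -/
def offsOf (I : List ℕ) : ℕ → ℕ
  | 0 => 3
  | j + 1 => offsOf I j + 2 * I.getD (offsOf I j) 0 + 1

/-- The heap after `m` of these positions have been computed. -/
def offHeap (I : List ℕ) (m c : ℕ) : ℕ := if c % 4 = 0 ∧ c / 4 ≤ m then offsOf I (c / 4) else 0

theorem offs_offHeap {I : List ℕ} {m j : ℕ} (hj : j ≤ m) : offs (offHeap I m) j = offsOf I j := by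
  have h1 : 4 * j % 4 = 0 := by omega
  have h2 : 4 * j / 4 = j := by omega
  simp [offs, offHeap, h1, h2, hj]

theorem offHeap_zero (I : List ℕ) : offHeap I 0 = Function.update (fun _ => 0) 0 3 := by
  funext c
  by_cases hc : c = 0
  · simp [hc, offHeap, offsOf]
  · have : ¬ (c % 4 = 0 ∧ c / 4 ≤ 0) := by omega
    rw [Function.update_of_ne hc, offHeap, if_neg this]

theorem offHeap_succ (I : List ℕ) (m : ℕ) : offHeap I (m + 1) =
    Function.update (offHeap I m) (4 * (m + 1)) (offsOf I (m + 1)) := by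
  funext c
  by_cases hc : c = 4 * (m + 1)
  · have h1 : 4 * (m + 1) % 4 = 0 := by omega
    have h2 : 4 * (m + 1) / 4 = m + 1 := by omega
    simp [hc, offHeap, h1, h2]
  · rw [Function.update_of_ne hc, offHeap, offHeap]
    have : (c % 4 = 0 ∧ c / 4 ≤ m + 1) ↔ (c % 4 = 0 ∧ c / 4 ≤ m) := by omega
    simp only [this]

/-- The context in the initial configuration. -/
def initCtx : Ctx (List ℕ) := ⟨id, fun _ _ => 0, fun _ => 0, []⟩

/-- The computation of the positions of the words. -/
theorem sim_offHeap :
    HCmp { initCtx with bd := fun I => inR I + 2 } fun I => offHeap I (inR I + 2) := by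
  set K : Ctx (List ℕ) := { initCtx with bd := fun I => inR I + 2 } with hK
  have h1 : HCmp K fun I => offHeap I 0 :=
    (HCmp.store (Cmp.const 0) (Cmp.const 3)).congr fun I => (offHeap_zero I).symm
  refine h1.seq (HCmp.loop (K := K) (H := offHeap) ?_)
  set K' := K.bind fun y => offHeap y.1 y.2 with hK'
  have h2 : Cmp K' fun y => offs (K'.hp y) y.2 := .offs .last
  have h3 : Cmp K' fun y => offs (K'.hp y) y.2 + 2 * (K'.inp y).getD (offs (K'.hp y) y.2) 0 + 1 :=
    .add (.add h2 (.mul (.const 2) (.input h2))) (.const 1)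
  refine (HCmp.store (.mul (.const 4) (.add .last (.const 1))) h3).congr fun y => ?_
  have h4 : offs (K'.hp y) y.2 = offsOf y.1 y.2 := offs_offHeap le_rfl
  rw [h4, offHeap_succ]
  rfl

theorem offs_setTab {h : ℕ → ℕ} {t : ℕ} (ht : t ≠ 0) (S : ℕ → Prop) :
    offs (setTab h t S) = offs h :=
  funext fun c => setTab_of_ne (t' := 0) (by omega) ht.symm c

theorem tab_setTab {h : ℕ → ℕ} {t : ℕ} (ht : t < 4) (S : ℕ → Prop) : tab (setTab h t S) t = S :=
  funext fun c => propext (setTab_self ht c)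

theorem tab_setTab_of_ne {h : ℕ → ℕ} {t t' : ℕ} (ht : t' < 4) (hne : t' ≠ t) (S : ℕ → Prop) :
    tab (setTab h t S) t' = tab h t' := by
  funext c
  rw [tab, setTab_of_ne ht hne, tab]

theorem Lfp.min_eq {B : ℕ} (Ψ : (ℕ → Prop) → ℕ → Prop) :
    Lfp B (fun S c => Ψ S (Min.min c B)) = Lfp B Ψ := by
  funext c
  refine propext (forall_congr' fun Q => ?_)
  have : (∀ c < B, Ψ Q (Min.min c B) → Q c) ↔ ∀ c < B, Ψ Q c → Q c :=
    forall₂_congr fun c hc => by rw [min_eq_left hc.le]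
  rw [this]

/-- The rule for table `1`. -/
def zStage : Rule := fun I B h c => (inGrammar I B (offs h)).ZRule B (tab h 1) (min c B)

/-- The rule for table `2`. -/
def rStage : Rule := fun I B h c => (inGrammar I B (offs h)).RRule B (tab h 1) (tab h 2) (min c B)

/-- The rule for table `3`. -/
def aStage : Rule := fun I B h c => (inGrammar I B (offs h)).ARule' B (inD I)
  (cutoff (inD I) (inGrammar I B (offs h))) (tab h 1) (tab h 2) (tab h 3) (min c B)

theorem zStage_computable : zStage.Computable := fun _ _ _ hc =>
  .zRule (.min hc .bound) fun _ => min_le_right _ _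

theorem rStage_computable : rStage.Computable := fun _ _ _ hc =>
  .rRule (.min hc .bound) fun _ => min_le_right _ _

theorem aStage_computable : aStage.Computable := by
  intro Y K c hc
  have h1 : Cmp K fun x => Min.min (c x) (K.bd x) := .min hc .bound
  have h2 : ∀ x, Min.min (c x) (K.bd x) ≤ K.bd x := fun _ => min_le_right _ _
  have hV : Cmp K fun x => cutoff (inD (K.inp x)) (K.gr x) + 1 := .add .cutoff (.const 1)
  have hd : Cmp K fun x => inD (K.inp x) + 1 := .add .inD (.const 1)
  have h3 := h1.div hV h2
  have h4 := fun x => (Nat.div_le_self _ (cutoff (inD (K.inp x)) (K.gr x) + 1)).trans (h2 x)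
  exact .aRule (h3.div hd h4) (fun x => (Nat.div_le_self _ _).trans (h4 x)) (h3.mod hd h4)
    (h1.mod hV h2)

/-- A number that is larger than all the parameters. -/
def size (I : List ℕ) : ℕ := offsOf I (inR I + 1) + inN I + inR I + inD I + 3

/-- The number of rounds of all the loops of the main part of the program. The exponent is a power of two
for which all the tables fit into this number of cells. -/
def rounds (I : List ℕ) : ℕ := size I ^ 32

/-- The table of the positions of the words. -/
def posTable (I : List ℕ) : ℕ → ℕ := offs (offHeap I (inR I + 2))

/-- The grammar that the program works with. -/
def progGrammar (I : List ℕ) : Grammar := inGrammar I (rounds I) (posTable I)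

/-- The cut-off that the program works with. -/
def progCutoff (I : List ℕ) : ℕ := cutoff (inD I) (progGrammar I)

/-- Table `1`. -/
def zTable (I : List ℕ) : ℕ → Prop := Lfp (rounds I) ((progGrammar I).ZRule (rounds I))

/-- Table `2`. -/
def rTable (I : List ℕ) : ℕ → Prop := Lfp (rounds I) ((progGrammar I).RRule (rounds I) (zTable I))

/-- Table `3`. -/
def aTable (I : List ℕ) : ℕ → Prop :=
  Lfp (rounds I) ((progGrammar I).ARule' (rounds I) (inD I) (progCutoff I) (zTable I) (rTable I))

/-- According to the table `T`, the number of closed paths of degree `d` at the beginning of some word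
grows at least with degree `v`. -/
def someStart (I : List ℕ) (B : ℕ) (o : ℕ → ℕ) (T : ℕ → Prop) (v : ℕ) : Prop :=
  ∃ s < B, s < 2 * inR I + 2 ∧ T (Grammar.cell (inD I) (cutoff (inD I) (inGrammar I B o))
    (Auto.enc (inAuto I B o).P (inN I) (s * width I o) (s * width I o)) (inD I) v)

open Classical in
/-- The answer that is read off the table `T`. -/
noncomputable def readAnswer (I : List ℕ) (B : ℕ) (o : ℕ → ℕ) (T : ℕ → Prop) : ℕ :=
  if inD I = 0 then 2
  else if someStart I B o T (cutoff (inD I) (inGrammar I B o)) then 1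
  else if someStart I B o T 0 then
    2 + ∑ v ∈ Finset.range B, ind (v < cutoff (inD I) (inGrammar I B o) ∧ someStart I B o T (v + 1))
  else 0

theorem CmpP.someStart {X : Type} {K : Ctx X} {v : X → ℕ} (hv : Cmp K v) :
    CmpP K fun x =>
      RAM.someStart (K.inp x) (K.bd x) (RAM.offs (K.hp x)) (RAM.tab (K.hp x) 3) (v x) := by
  refine .ex (.and (.lt .last (.add (.mul (.const 2) .inR) (.const 2))) (.tab 3 ?_))
  have h : Cmp K.inner fun y => y.2 * RAM.width (K.inp y.1) (RAM.offs (K.hp y.1)) := .mul .last .width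
  exact .cell (.enc .inN h h) .inD hv.wk

theorem Cmp.readAnswer {X : Type} (K : Ctx X) :
    Cmp K fun x =>
      RAM.readAnswer (K.inp x) (K.bd x) (RAM.offs (K.hp x)) (RAM.tab (K.hp x) 3) := by
  classical
  refine .ite (.eq_zero .inD) (.const 2) (.ite (.someStart .cutoff) (.const 1)
    (.ite (.someStart (.const 0)) (.add (.const 2) ?_) (.const 0)))
  refine Cmp.sum (F := fun x v => ind (v < RAM.cutoff (RAM.inD (K.inp x)) (K.gr x) ∧
    RAM.someStart (K.inp x) (K.bd x) (RAM.offs (K.hp x)) (RAM.tab (K.hp x) 3) (v + 1))) ?_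
  exact CmpP.and (.lt .last (Cmp.wk .cutoff))
    (CmpP.someStart (K := K.inner) (.add .last (.const 1)))

/-- The result of the program. -/
noncomputable def result (I : List ℕ) : ℕ := readAnswer I (rounds I) (posTable I) (aTable I)

theorem three_le_size (I : List ℕ) : 3 ≤ size I := by unfold size; omega

theorem size_le_rounds (I : List ℕ) : size I ≤ rounds I := Nat.le_self_pow (by norm_num) _

theorem sim_result : Sim id rounds (St initCtx) fun I reg => reg 0 = result I := by
  set K1 : Ctx (List ℕ) := { initCtx with bd := fun I => inR I + 2 } with hK1
  set K2 : Ctx (List ℕ) := K1.setHeap fun I => offHeap I (inR I + 2) with hK2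
  set K3 : Ctx (List ℕ) := { K2 with bd := rounds } with hK3
  have s1 : Sim id (fun _ => 0) (St initCtx) (St K1) :=
    Sim.setBound (K := initCtx) (.add .inR (.const 2))
  have s2 : Sim id (fun I => inR I + 2) (St K1) (St K2) := sim_offHeap
  have hsize : Cmp K2 size := by
    have h1 : Cmp K2 fun I => offsOf I (inR I + 1) :=
      (Cmp.width (K := K2)).congr fun I => offs_offHeap (Nat.le_succ _)
    exact .add (.add (.add (.add h1 .inN) .inR) .inD) (.const 3)
  have s3 : Sim id (fun I => inR I + 2) (St K2) (St K3) := by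
    have h2 := hsize.mul hsize
    have h4 := h2.mul h2
    have h8 := h4.mul h4
    have h16 := h8.mul h8
    exact Sim.setBound (K := K2) ((h16.mul h16).congr fun I => by rw [rounds]; ring)
  set K4 : Ctx (List ℕ) := K3.setHeap fun I => setTab (offHeap I (inR I + 2)) 1 (zTable I) with hK4
  set K5 : Ctx (List ℕ) := K3.setHeap fun I =>
    setTab (setTab (offHeap I (inR I + 2)) 1 (zTable I)) 2 (rTable I) with hK5
  set K6 : Ctx (List ℕ) := K3.setHeap fun I =>
    setTab (setTab (setTab (offHeap I (inR I + 2)) 1 (zTable I)) 2 (rTable I)) 3 (aTable I) with hK6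
  have hoff : ∀ {t}, 0 < t → t < 4 → ∀ I c, offHeap I (inR I + 2) (4 * c + t) = 0 := by
    intro t h1 h2 I c
    have : ¬ ((4 * c + t) % 4 = 0 ∧ (4 * c + t) / 4 ≤ inR I + 2) := by omega
    rw [offHeap, if_neg this]
  have e1 : ∀ I, zStage.on I (rounds I) (offHeap I (inR I + 2)) 1 =
      fun S c => (progGrammar I).ZRule (rounds I) S (Min.min c (rounds I)) := by
    intro I
    funext S c
    simp only [Rule.on, zStage, offs_setTab one_ne_zero, tab_setTab (show 1 < 4 by omega)]
    rfl
  have e2 : ∀ I, rStage.on I (rounds I) (setTab (offHeap I (inR I + 2)) 1 (zTable I)) 2 =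
      fun S c => (progGrammar I).RRule (rounds I) (zTable I) S (Min.min c (rounds I)) := by
    intro I
    funext S c
    simp only [Rule.on, rStage, offs_setTab one_ne_zero, offs_setTab two_ne_zero,
      tab_setTab (show 2 < 4 by omega), tab_setTab_of_ne (show 1 < 4 by omega) (show 1 ≠ 2 by omega),
      tab_setTab (show 1 < 4 by omega)]
    rfl
  have e3 : ∀ I, aStage.on I (rounds I)
      (setTab (setTab (offHeap I (inR I + 2)) 1 (zTable I)) 2 (rTable I)) 3 =
      fun S c => (progGrammar I).ARule' (rounds I) (inD I) (progCutoff I) (zTable I) (rTable I) S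
        (Min.min c (rounds I)) := by
    intro I
    funext S c
    simp only [Rule.on, aStage, offs_setTab one_ne_zero, offs_setTab two_ne_zero,
      offs_setTab three_ne_zero, tab_setTab (show 3 < 4 by omega),
      tab_setTab_of_ne (show 1 < 4 by omega) (show 1 ≠ 2 by omega),
      tab_setTab_of_ne (show 1 < 4 by omega) (show 1 ≠ 3 by omega),
      tab_setTab_of_ne (show 2 < 4 by omega) (show 2 ≠ 3 by omega),
      tab_setTab (show 2 < 4 by omega), tab_setTab (show 1 < 4 by omega)]
    rfl
  have s4 : Sim id rounds (St K3) (St K4) := by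
    refine (HCmp.lfp (K := K3) zStage_computable (t := 1) (by omega)
      (hoff (by omega) (by omega)) ?_).congr ?_
    · intro I S T h c
      change zStage.on I (rounds I) (offHeap I (inR I + 2)) 1 S c →
        zStage.on I (rounds I) (offHeap I (inR I + 2)) 1 T c
      rw [e1]
      exact Grammar.ZRule.mono h
    · intro I
      change setTab (offHeap I (inR I + 2)) 1 (Lfp (rounds I)
        (zStage.on I (rounds I) (offHeap I (inR I + 2)) 1)) = _
      rw [e1, Lfp.min_eq]
      rfl
  have s5 : Sim id rounds (St K4) (St K5) := by
    refine (HCmp.lfp (K := K4) rStage_computable (t := 2) (by omega) ?_ ?_).congr ?_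
    · intro I c
      change setTab _ 1 _ (4 * c + 2) = 0
      rw [setTab_of_ne (by omega) (by omega), hoff (by omega) (by omega)]
    · intro I S T h c
      change rStage.on I (rounds I) (setTab (offHeap I (inR I + 2)) 1 (zTable I)) 2 S c →
        rStage.on I (rounds I) (setTab (offHeap I (inR I + 2)) 1 (zTable I)) 2 T c
      rw [e2]
      exact Grammar.RRule.mono h
    · intro I
      change setTab (setTab (offHeap I (inR I + 2)) 1 (zTable I)) 2 (Lfp (rounds I)
        (rStage.on I (rounds I) (setTab (offHeap I (inR I + 2)) 1 (zTable I)) 2)) = _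
      rw [e2, Lfp.min_eq]
      rfl
  have s6 : Sim id rounds (St K5) (St K6) := by
    refine (HCmp.lfp (K := K5) aStage_computable (t := 3) (by omega) ?_ ?_).congr ?_
    · intro I c
      change setTab (setTab _ 1 _) 2 _ (4 * c + 3) = 0
      rw [setTab_of_ne (by omega) (by omega), setTab_of_ne (by omega) (by omega),
        hoff (by omega) (by omega)]
    · intro I S T h c
      change aStage.on I (rounds I)
          (setTab (setTab (offHeap I (inR I + 2)) 1 (zTable I)) 2 (rTable I)) 3 S c →
        aStage.on I (rounds I)
          (setTab (setTab (offHeap I (inR I + 2)) 1 (zTable I)) 2 (rTable I)) 3 T c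
      rw [e3]
      exact Grammar.ARule.mono h
    · intro I
      change setTab (setTab (setTab (offHeap I (inR I + 2)) 1 (zTable I)) 2 (rTable I)) 3
        (Lfp (rounds I) (aStage.on I (rounds I)
          (setTab (setTab (offHeap I (inR I + 2)) 1 (zTable I)) 2 (rTable I)) 3)) = _
      rw [e3, Lfp.min_eq]
      rfl
  have s7 : Sim id rounds (St K6) fun I reg => reg 0 = result I := by
    refine Sim.output (K := K6) ((Cmp.readAnswer K6).congr fun I => ?_)
    change readAnswer I (rounds I) (offs (setTab (setTab (setTab (offHeap I (inR I + 2)) 1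
      (zTable I)) 2 (rTable I)) 3 (aTable I))) (tab (setTab (setTab (setTab (offHeap I (inR I + 2)) 1
      (zTable I)) 2 (rTable I)) 3 (aTable I)) 3) = _
    rw [offs_setTab three_ne_zero, offs_setTab two_ne_zero, offs_setTab one_ne_zero,
      tab_setTab (by omega)]
    rfl
  have hr : ∀ I, inR I + 2 ≤ rounds I := fun I =>
    le_trans (by unfold size; omega) (size_le_rounds I)
  exact (s1.mono_bound fun I => Nat.zero_le (rounds I)).seq ((s2.mono_bound hr).seq
    ((s3.mono_bound hr).seq (s4.seq (s5.seq (s6.seq s7)))))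

theorem exists_program : ∃ (P : Program) (C D : ℕ), ∀ I t, C * (rounds I + 1) ^ D ≤ t →
    OutputsWithin P I t (result I) :=
  sim_result.outputsWithin fun _ => ⟨rfl, fun i f h => by simp [initCtx] at h, fun _ => rfl⟩

end RAM

/-! ### The encoding of the input -/

namespace FreeEq

theorem getD_flatten {L : List (List ℕ)} {j i : ℕ} (hj : j < L.length) (hi : i < L[j].length) :
    L.flatten.getD ((L.take j).flatten.length + i) 0 = L[j].getD i 0 := by
  have h : L.flatten = (L.take j).flatten ++ (L[j] ++ (L.drop (j + 1)).flatten) := by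
    rw [← List.flatten_cons, ← List.drop_eq_getElem_cons hj, ← List.flatten_append,
      List.take_append_drop]
  rw [h, List.getD_append_right _ _ _ _ (by omega), Nat.add_sub_cancel_left,
    List.getD_append _ _ _ _ hi]

section
variable {n : ℕ}

theorem length_flatMap_letters (w : List (Fin n × Bool)) :
    (w.flatMap fun s => [(s.1 : ℕ), if s.2 then 1 else 0]).length = 2 * w.length := by
  induction w with
  | nil => rfl
  | cons z w ih => rw [List.flatMap_cons, List.length_append, ih]; simp; ring

theorem length_encodeWord (w : List (Fin n × Bool)) : (encodeWord w).length = 2 * w.length + 1 := by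
  rw [encodeWord, List.length_cons, length_flatMap_letters]

theorem getD_encodeWord (w : List (Fin n × Bool)) {i : ℕ} (hi : i < w.length) :
    (encodeWord w).getD (1 + 2 * i) 0 = w[i].1 ∧
      (encodeWord w).getD (2 + 2 * i) 0 = if w[i].2 then 1 else 0 := by
  have key : (w.flatMap fun s => [(s.1 : ℕ), if s.2 then 1 else 0]).getD (2 * i) 0 = w[i].1 ∧
      (w.flatMap fun s => [(s.1 : ℕ), if s.2 then 1 else 0]).getD (2 * i + 1) 0 =
        if w[i].2 then 1 else 0 := by
    induction w generalizing i with
    | nil => simp at hi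
    | cons z w ih =>
      rw [List.flatMap_cons]
      cases i with
      | zero => exact ⟨rfl, rfl⟩
      | succ i => exact ih (by simpa using hi)
  rw [encodeWord, show 1 + 2 * i = 2 * i + 1 by ring, show 2 + 2 * i = 2 * i + 1 + 1 by ring]
  exact key

end

variable {n r : ℕ} {H : Subgroup (FreeGroup (Fin n))} (b : FreeGroupBasis (Fin r) H)
  (g : FreeGroup (Fin n)) (d : ℕ)

/-- The pieces of the input: the three numbers and the encoded words. -/
def pieces : List (List ℕ) :=
  [n, r, d] :: (List.range (r + 1)).map fun j => encodeWord (baseWord b g j)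

theorem encodeInput_eq : encodeInput b g d = (pieces b g d).flatten := by
  rw [encodeInput, pieces, List.flatten_cons, List.range_succ, List.map_append, List.flatten_append]
  congr 2
  · congr 1
    refine List.ext_getElem (by simp) fun i h1 h2 => ?_
    have hi : i < r := by simpa using h1
    simp [baseWord, hi]
  · simp [baseWord]

theorem length_pieces : (pieces b g d).length = r + 2 := by simp [pieces]

theorem inN_encodeInput : RAM.inN (encodeInput b g d) = n := rfl

theorem inR_encodeInput : RAM.inR (encodeInput b g d) = r := rfl

theorem inD_encodeInput : RAM.inD (encodeInput b g d) = d := rfl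

variable {b g d}

/-- The word `j` is encoded from the position `offsOf I j` on. -/
theorem offsOf_encodeInput {j : ℕ} (hj : j ≤ r + 1) :
    RAM.offsOf (encodeInput b g d) j = ((pieces b g d).take (j + 1)).flatten.length := by
  induction j with
  | zero => rfl
  | succ j ih =>
    have h1 : j + 1 < (pieces b g d).length := by rw [length_pieces]; omega
    have h2 : (pieces b g d)[j + 1] = encodeWord (baseWord b g j) := by simp [pieces]
    rw [RAM.offsOf, ih (by omega), encodeInput_eq]
    have h3 := getD_flatten (i := 0) h1 (by rw [h2, length_encodeWord]; omega)
    rw [add_zero] at h3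
    rw [h3, h2, List.take_succ_eq_append_getElem h1, List.flatten_append, List.length_append, h2]
    simp only [List.flatten_singleton, length_encodeWord]
    rfl

theorem getD_encodeInput {j i : ℕ} (hj : j ≤ r) (hi : i < 2 * (baseWord b g j).length + 1) :
    (encodeInput b g d).getD (RAM.offsOf (encodeInput b g d) j + i) 0 =
      (encodeWord (baseWord b g j)).getD i 0 := by
  have h1 : j + 1 < (pieces b g d).length := by rw [length_pieces]; omega
  have h2 : (pieces b g d)[j + 1] = encodeWord (baseWord b g j) := by simp [pieces]
  rw [offsOf_encodeInput (by omega), encodeInput_eq, getD_flatten h1, h2]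
  rw [h2, length_encodeWord]; exact hi

theorem getD_offsOf {j : ℕ} (hj : j ≤ r) :
    (encodeInput b g d).getD (RAM.offsOf (encodeInput b g d) j) 0 = (baseWord b g j).length :=
  getD_encodeInput (i := 0) hj (by omega)

theorem letterAt_encodeInput {j i : ℕ} (hj : j ≤ r) (hi : i < (baseWord b g j).length) :
    RAM.letterAt (encodeInput b g d) (RAM.offsOf (encodeInput b g d) j) i =
      codeOf (baseWord b g j)[i] := by
  obtain ⟨h1, h2⟩ := getD_encodeWord (baseWord b g j) hi
  rw [RAM.letterAt, add_assoc, add_assoc, getD_encodeInput hj (by omega),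
    getD_encodeInput hj (by omega), h1, h2, inN_encodeInput, codeOf]
  cases (baseWord b g j)[i].2 <;> simp

theorem posTable_encodeInput {j : ℕ} (hj : j ≤ r + 2) :
    RAM.posTable (encodeInput b g d) j = RAM.offsOf (encodeInput b g d) j :=
  RAM.offs_offHeap hj

theorem blockAt_encodeInput (s i : ℕ) :
    RAM.blockAt (encodeInput b g d) (RAM.posTable (encodeInput b g d)) s i =
      (block b g s).getD i n := by
  rw [RAM.blockAt, inR_encodeInput, inN_encodeInput, block]
  by_cases hs : s ≤ r
  · rw [if_pos hs, if_pos hs, posTable_encodeInput (by omega), getD_offsOf hs]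
    split_ifs with hi
    · rw [letterAt_encodeInput hs hi, List.getD_eq_getElem _ _ (by simpa using hi), List.getElem_map]
    · rw [List.getD_eq_default _ _ (by simpa using hi)]
  · have hs' : 2 * r + 1 - s ≤ r := by omega
    rw [if_neg hs, if_neg hs, posTable_encodeInput (by omega), getD_offsOf hs']
    split_ifs with hi
    · rw [letterAt_encodeInput hs' (by omega), List.getD_eq_getElem _ _ (by simpa using hi),
        List.getElem_reverse, List.getElem_map]
      simp
    · rw [List.getD_eq_default _ _ (by simpa using hi)]

/-- The length of the blocks of states, for the input. -/
def inWidth (b : FreeGroupBasis (Fin r) H) (g : FreeGroup (Fin n)) (d : ℕ) : ℕ :=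
  RAM.offsOf (encodeInput b g d) (r + 1)

theorem width_encodeInput :
    RAM.width (encodeInput b g d) (RAM.posTable (encodeInput b g d)) = inWidth b g d :=
  posTable_encodeInput (Nat.le_succ _)

theorem offsOf_mono (I : List ℕ) : Monotone (RAM.offsOf I) :=
  monotone_nat_of_le_succ fun j => by rw [RAM.offsOf]; omega

theorem length_lt_inWidth : ∀ j ≤ r, (baseWord b g j).length < inWidth b g d := by
  intro j hj
  have h1 := offsOf_mono (encodeInput b g d) (show j + 1 ≤ r + 1 by omega)
  rw [RAM.offsOf, getD_offsOf hj] at h1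
  unfold inWidth
  omega

theorem inWidth_le :
    inWidth b g d ≤ 3 + (r + 1) * (2 * maxLength b g + 1) := by
  have hlen : ∀ j, (baseWord b g j).length ≤ maxLength b g := by
    intro j
    rw [baseWord, maxLength]
    split_ifs with h
    · exact le_max_of_le_left
        (Finset.le_sup (f := fun i : Fin r => (b i : FreeGroup (Fin n)).norm)
          (Finset.mem_univ (⟨j, h⟩ : Fin r)))
    · exact le_max_right _ _
  have key : ∀ j ≤ r + 1, RAM.offsOf (encodeInput b g d) j ≤ 3 + j * (2 * maxLength b g + 1) := by
    intro j hj
    induction j with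
    | zero => simp [RAM.offsOf]
    | succ j ih =>
      have h1 := hlen j
      have h2 := ih (by omega)
      rw [RAM.offsOf, getD_offsOf (by omega), add_mul]
      omega
  exact key _ le_rfl

theorem inAuto_encodeInput {B : ℕ} (hB : 2 * r + 2 ≤ B) :
    RAM.inAuto (encodeInput b g d) B (RAM.posTable (encodeInput b g d)) =
      rose n r (inWidth b g d) (block b g) := by
  simp only [RAM.inAuto, rose, blockAt_encodeInput, width_encodeInput, inN_encodeInput,
    inR_encodeInput, Auto.mk.injEq, true_and, and_true]
  funext p l
  refine propext (exists_congr fun s => ?_)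
  constructor
  · exact fun h => h.2
  · exact fun h => ⟨h.1.trans_le hB, h⟩

/-! ### Correctness of the program -/

theorem sum_ind_eq_findGreatest {p : ℕ → Prop} [DecidablePred p] (hp : ∀ v w, w ≤ v → p v → p w)
    {V B : ℕ} (hV : V ≤ B) :
    ∑ v ∈ Finset.range B, RAM.ind (v < V ∧ p (v + 1)) = Nat.findGreatest p V := by
  have h : ∀ v, (v < V ∧ p (v + 1)) ↔ v ∈ Finset.range (Nat.findGreatest p V) := by
    intro v
    rw [Finset.mem_range]
    constructor
    · rintro ⟨h1, h2⟩
      exact Nat.le_findGreatest h1 h2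
    · intro h
      refine ⟨h.trans_le (Nat.findGreatest_le V), hp _ _ h ?_⟩
      exact Nat.findGreatest_of_ne_zero rfl (by omega)
  simp only [h, RAM.ind]
  rw [Finset.sum_ite_mem, Finset.inter_eq_right.mpr
    (Finset.range_subset_range.mpr ((Nat.findGreatest_le V).trans hV))]
  simp

variable (b g d)

/-- The grammar that belongs to the input. -/
noncomputable def roseGrammar : Grammar := (rose n r (inWidth b g d) (block b g)).grammar

theorem roseGrammar_act {σ l : ℕ} (h : (roseGrammar b g d).act σ l) :
    σ < (roseGrammar b g d).NV ∧ l < (roseGrammar b g d).NL ∧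
      (roseGrammar b g d).f1 σ l < (roseGrammar b g d).NV ∧
      (roseGrammar b g d).f2 σ l < (roseGrammar b g d).NV :=
  Auto.act_bounds (Rose.valid (blocks b g length_lt_inWidth)) h

theorem roseGrammar_init {σ : ℕ} (h : (roseGrammar b g d).init σ) : σ < (roseGrammar b g d).NV := h.1

/-- The sizes of all the tables are bounded by the number of rounds. -/
theorem bounds_rounds : 2 * r + 2 ≤ RAM.rounds (encodeInput b g d) ∧
    (roseGrammar b g d).NV * (roseGrammar b g d).NV ≤ RAM.rounds (encodeInput b g d) ∧
    2 * (roseGrammar b g d).NL ≤ RAM.rounds (encodeInput b g d) ∧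
    (roseGrammar b g d).NV * (d + 1) * (RAM.cutoff d (roseGrammar b g d) + 1) ≤
      RAM.rounds (encodeInput b g d) ∧
    RAM.cutoff d (roseGrammar b g d) < RAM.rounds (encodeInput b g d) ∧
    d < RAM.rounds (encodeInput b g d) ∧
    (roseGrammar b g d).NV ≤ RAM.rounds (encodeInput b g d) := by
  have hU : RAM.size (encodeInput b g d) = inWidth b g d + n + r + d + 3 := rfl
  have hU3 := RAM.three_le_size (encodeInput b g d)
  rw [RAM.rounds]
  set U := RAM.size (encodeInput b g d) with hUdef
  have hNL : (roseGrammar b g d).NL = (2 * r + 2) * inWidth b g d := rfl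
  have hNV : (roseGrammar b g d).NV =
      (2 * n + 1) * ((2 * r + 2) * inWidth b g d + 1) * ((2 * r + 2) * inWidth b g d + 1) := rfl
  have hcut : RAM.cutoff d (roseGrammar b g d) = 2 * d * ((roseGrammar b g d).NV + 1) + 1 := rfl
  generalize (roseGrammar b g d).NV = NV at *
  generalize (roseGrammar b g d).NL = NL at *
  generalize RAM.cutoff d (roseGrammar b g d) = V at *
  have hP : NL + 1 ≤ U ^ 2 := by rw [hNL, hU]; nlinarith [Nat.zero_le (inWidth b g d)]
  have hn : 2 * n + 1 ≤ U ^ 2 := by nlinarith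
  have hd2 : 2 * d + 1 ≤ U ^ 2 := by nlinarith
  have hr2 : 2 * r + 2 ≤ U ^ 2 := by nlinarith
  have hU1 : 1 ≤ U := by omega
  have hpow : ∀ {a c}, a ≤ c → U ^ a ≤ U ^ c := fun h => Nat.pow_le_pow_right hU1 h
  have hNV6 : NV ≤ U ^ 6 := by
    rw [hNV, ← hNL]
    calc (2 * n + 1) * (NL + 1) * (NL + 1) ≤ U ^ 2 * U ^ 2 * U ^ 2 := by gcongr
      _ = U ^ 6 := by ring
  have hNV7 : NV + 1 ≤ U ^ 7 := by
    have : 1 ≤ U ^ 6 := Nat.one_le_pow _ _ hU1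
    calc NV + 1 ≤ U ^ 6 * 2 := by omega
      _ ≤ U ^ 6 * U := by gcongr; omega
      _ = U ^ 7 := by ring
  have hV : V + 1 ≤ U ^ 10 := by
    have : 1 ≤ U ^ 9 := Nat.one_le_pow _ _ hU1
    have h2 : 2 * d * (NV + 1) ≤ U ^ 9 := by
      calc 2 * d * (NV + 1) ≤ U ^ 2 * U ^ 7 := by gcongr; omega
        _ = U ^ 9 := by ring
    calc V + 1 ≤ U ^ 9 * 3 := by omega
      _ ≤ U ^ 9 * U := by gcongr
      _ = U ^ 10 := by ring
  have hd1 : d + 1 ≤ U ^ 2 := by omega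
  refine ⟨hr2.trans (hpow (by omega)), ?_, ?_, ?_, ?_, ?_, hNV6.trans (hpow (by omega))⟩
  · calc NV * NV ≤ U ^ 6 * U ^ 6 := by gcongr
      _ = U ^ 12 := by ring
      _ ≤ U ^ 32 := hpow (by omega)
  · calc 2 * NL ≤ U * U ^ 2 := by gcongr <;> omega
      _ = U ^ 3 := by ring
      _ ≤ U ^ 32 := hpow (by omega)
  · calc NV * (d + 1) * (V + 1) ≤ U ^ 6 * U ^ 2 * U ^ 10 := by gcongr
      _ = U ^ 18 := by ring
      _ ≤ U ^ 32 := hpow (by omega)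
  · exact lt_of_lt_of_le (Nat.lt_succ_self V) (hV.trans (hpow (by omega)))
  · exact lt_of_lt_of_le (Nat.lt_succ_self d) (hd1.trans (hpow (by omega)))

theorem progGrammar_encodeInput : RAM.progGrammar (encodeInput b g d) = roseGrammar b g d := by
  rw [RAM.progGrammar, RAM.inGrammar, inAuto_encodeInput (bounds_rounds b g d).1]
  rfl

theorem aTable_encodeInput : RAM.aTable (encodeInput b g d) =
    (roseGrammar b g d).AT d (RAM.cutoff d (roseGrammar b g d)) := by
  obtain ⟨-, h2, h3, h4, h5, h6, h7⟩ := bounds_rounds b g d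
  have hact := fun {σ l} => roseGrammar_act b g d (σ := σ) (l := l)
  have hinit := fun {σ} => roseGrammar_init b g d (σ := σ)
  have hz : RAM.zTable (encodeInput b g d) = (roseGrammar b g d).Z := by
    rw [RAM.zTable, progGrammar_encodeInput]
    exact Grammar.lfp_ZRule hact hinit h7 (by omega)
  have hr : RAM.rTable (encodeInput b g d) = (roseGrammar b g d).RT := by
    rw [RAM.rTable, progGrammar_encodeInput, hz]
    exact Grammar.lfp_RRule hact h2 (by omega)
  rw [RAM.aTable, RAM.progCutoff, progGrammar_encodeInput, hz, hr]
  exact Grammar.lfp_ARule hact hinit h4 h3 h6 h5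

theorem someStart_encodeInput {v : ℕ} (hv : v ≤ RAM.cutoff d (roseGrammar b g d)) :
    RAM.someStart (encodeInput b g d) (RAM.rounds (encodeInput b g d))
      (RAM.posTable (encodeInput b g d)) (RAM.aTable (encodeInput b g d)) v ↔
    ∃ s < 2 * r + 2, (roseGrammar b g d).A (RAM.cutoff d (roseGrammar b g d))
      (startSym n r (inWidth b g d) s) d v := by
  have hB := (bounds_rounds b g d).1
  have hgr : RAM.inGrammar (encodeInput b g d) (RAM.rounds (encodeInput b g d))
    (RAM.posTable (encodeInput b g d)) = roseGrammar b g d := progGrammar_encodeInput b g d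
  have hiff : ∀ s, RAM.aTable (encodeInput b g d) (Grammar.cell d
      (RAM.cutoff d (roseGrammar b g d)) (startSym n r (inWidth b g d) s) d v) ↔
      (roseGrammar b g d).A (RAM.cutoff d (roseGrammar b g d))
        (startSym n r (inWidth b g d) s) d v := by
    intro s
    rw [aTable_encodeInput]
    exact Grammar.AT_cell le_rfl hv
  rw [RAM.someStart, hgr, inAuto_encodeInput hB, width_encodeInput, inN_encodeInput, inR_encodeInput,
    inD_encodeInput]
  constructor
  · rintro ⟨s, -, hs, h⟩
    exact ⟨s, hs, (hiff s).mp h⟩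
  · rintro ⟨s, hs, h⟩
    exact ⟨s, hs.trans_le hB, hs, (hiff s).mpr h⟩

/-- The program computes a correct answer; in particular there is one. -/
theorem exists_answer :
    ∃ a : Answer, a.IsCorrect b g d ∧ a.code = RAM.result (encodeInput b g d) := by
  classical
  rcases Nat.eq_zero_or_pos d with rfl | hd
  · refine ⟨.polynomial 0, hasPolynomialGrowth_zero, ?_⟩
    rw [RAM.result, RAM.readAnswer, inD_encodeInput, if_pos rfl]; rfl
  have hgr : RAM.inGrammar (encodeInput b g d) (RAM.rounds (encodeInput b g d))
    (RAM.posTable (encodeInput b g d)) = roseGrammar b g d := progGrammar_encodeInput b g d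
  have hV : 2 * d * ((roseGrammar b g d).NV + 1) < RAM.cutoff d (roseGrammar b g d) :=
    Nat.lt_succ_self _
  have hVB := (bounds_rounds b g d).2.2.2.2.1
  have hres : RAM.result (encodeInput b g d) = RAM.readAnswer (encodeInput b g d)
    (RAM.rounds (encodeInput b g d)) (RAM.posTable (encodeInput b g d))
    (RAM.aTable (encodeInput b g d)) := rfl
  rw [RAM.readAnswer, inD_encodeInput, if_neg hd.ne', hgr] at hres
  have hW := length_lt_inWidth (b := b) (g := g) (d := d)
  by_cases h1 : ∃ s < 2 * r + 2, (roseGrammar b g d).A (RAM.cutoff d (roseGrammar b g d))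
      (startSym n r (inWidth b g d) s) d (RAM.cutoff d (roseGrammar b g d))
  · rw [if_pos ((someStart_encodeInput b g d le_rfl).mpr h1)] at hres
    obtain ⟨s, hs, h⟩ := h1
    exact ⟨.exponential, hasExponentialGrowth hW hd hV hs h, hres.symm⟩
  rw [if_neg (fun h => h1 ((someStart_encodeInput b g d le_rfl).mp h))] at hres
  by_cases h0 : ∃ s < 2 * r + 2, (roseGrammar b g d).A (RAM.cutoff d (roseGrammar b g d))
      (startSym n r (inWidth b g d) s) d 0
  · rw [if_pos ((someStart_encodeInput b g d (Nat.zero_le _)).mpr h0)] at hres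
    have hcong : ∀ v, (v < RAM.cutoff d (roseGrammar b g d) ∧
        RAM.someStart (encodeInput b g d) (RAM.rounds (encodeInput b g d))
          (RAM.posTable (encodeInput b g d)) (RAM.aTable (encodeInput b g d)) (v + 1)) ↔
        (v < RAM.cutoff d (roseGrammar b g d) ∧ ∃ s < 2 * r + 2, (roseGrammar b g d).A
          (RAM.cutoff d (roseGrammar b g d)) (startSym n r (inWidth b g d) s) d (v + 1)) :=
      fun v => and_congr_right fun hv => someStart_encodeInput b g d hv
    simp only [hcong] at hres
    rw [sum_ind_eq_findGreatest (p := fun v => ∃ s < 2 * r + 2, (roseGrammar b g d).A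
          (RAM.cutoff d (roseGrammar b g d)) (startSym n r (inWidth b g d) s) d v)
      (fun v w hw ⟨s, hs, h⟩ => ⟨s, hs, h.of_le hw⟩) hVB.le] at hres
    set m := Nat.findGreatest (fun v => ∃ s < 2 * r + 2, (roseGrammar b g d).A
          (RAM.cutoff d (roseGrammar b g d)) (startSym n r (inWidth b g d) s) d v)
          (RAM.cutoff d (roseGrammar b g d)) with hm
    obtain ⟨s, hs, h⟩ := Nat.findGreatest_spec (P := fun v => ∃ s < 2 * r + 2,
      (roseGrammar b g d).A (RAM.cutoff d (roseGrammar b g d)) (startSym n r (inWidth b g d) s) d v)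
      (Nat.zero_le _) h0
    refine ⟨.polynomial m, hasPolynomialGrowth hW hd (fun s hs h => h1 ⟨s, hs, h⟩) hs h ?_, ?_⟩
    · intro s hs w hw
      exact Nat.le_findGreatest hw.le_cap ⟨s, hs, hw⟩
    · rw [hres, Answer.code, add_comm]
  · rw [if_neg (fun h => h0 ((someStart_encodeInput b g d (Nat.zero_le _)).mp h))] at hres
    exact ⟨.noEquation, idealDeg_eq_empty hW hd fun s hs h => h0 ⟨s, hs, h⟩, hres.symm⟩

theorem rounds_le : RAM.rounds (encodeInput b g d) + 1 ≤
    2 * 9 ^ 32 * (n + r + maxLength b g + d + 1) ^ 64 := by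
  have h1 := inWidth_le (b := b) (g := g) (d := d)
  have hU : RAM.size (encodeInput b g d) = inWidth b g d + n + r + d + 3 := rfl
  set N := n + r + maxLength b g + d + 1 with hN
  have h2 : RAM.size (encodeInput b g d) ≤ 9 * N ^ 2 := by
    have h3 : r + 1 ≤ N := by omega
    have h4 : 2 * maxLength b g + 1 ≤ 2 * N := by omega
    have h5 := Nat.mul_le_mul h3 h4
    have h6 : 1 ≤ N := by omega
    nlinarith
  have h3 : RAM.rounds (encodeInput b g d) ≤ 9 ^ 32 * N ^ 64 := by
    calc RAM.rounds (encodeInput b g d) ≤ (9 * N ^ 2) ^ 32 := Nat.pow_le_pow_left h2 32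
      _ = 9 ^ 32 * N ^ 64 := by rw [mul_pow, ← pow_mul]
  have h4 : 1 ≤ 9 ^ 32 * N ^ 64 := Nat.mul_pos (by positivity) (Nat.pow_pos (by omega))
  rw [mul_assoc]
  omega

end FreeEq

theorem mainTheorem6 :
    (∀ (n r : ℕ) (H : Subgroup (FreeGroup (Fin n))) (b : FreeGroupBasis (Fin r) H)
      (g : FreeGroup (Fin n)) (d : ℕ), (FreeEq.idealDeg b g d).Nonempty →
        Xor (HasExponentialGrowth (FreeEq.rho b g d))
          (∃ k : ℕ, HasPolynomialGrowth (FreeEq.rho b g d) k)) ∧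
    ∃ (P : RAM.Program) (C c : ℕ),
      ∀ (n r : ℕ) (H : Subgroup (FreeGroup (Fin n))) (b : FreeGroupBasis (Fin r) H)
        (g : FreeGroup (Fin n)) (d : ℕ),
        ∃ a : FreeEq.Answer, a.IsCorrect b g d ∧
          RAM.OutputsWithin P (FreeEq.encodeInput b g d)
            (C * (n + r + FreeEq.maxLength b g + d + 1) ^ c) a.code := by
  constructor
  · intro n r H b g d hne
    obtain ⟨a, ha, -⟩ := FreeEq.exists_answer b g d
    cases a with
    | noEquation => exact absurd ha hne.ne_empty
    | exponential => exact Or.inl ⟨ha, fun ⟨k, hk⟩ => ha.not_polynomial hk⟩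
    | polynomial k => exact Or.inr ⟨⟨k, ha⟩, fun h => h.not_polynomial ha⟩
  · obtain ⟨P, C, D, hP⟩ := RAM.exists_program
    refine ⟨P, C * (2 * 9 ^ 32) ^ D, 64 * D, fun n r H b g d => ?_⟩
    obtain ⟨a, ha, hc⟩ := FreeEq.exists_answer b g d
    refine ⟨a, ha, ?_⟩
    rw [hc]
    refine hP _ _ ?_
    rw [mul_assoc, pow_mul, ← mul_pow]
    exact Nat.mul_le_mul_left C (Nat.pow_le_pow_left (FreeEq.rounds_le b g d) D)
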